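/- **Setting.** Let $N=\mathbb{Z}^2$, $M=\mathrm{Hom}(N,\mathbb{Z})$, and let $\Sigma$ be a complete fan (finite, of strictly convex rational polyhedral cones) in $N_{\mathbb{R}}=\mathbb{R}^2$; $\Sigma(d)$ denotes its $d$-dimensional cones. A *tropical Lagrangian multi-section of rank $r$* over $\Sigma$ is $\mathbb{L}=(L,\Sigma_L,\mu,\pi,\varphi)$, where $(L,\Sigma_L)$ is a cone complex (a finite collection of closed cones, closed under faces, such that $L$ is the disjoint union of their relative interiors), $\mu:L\to\mathbb{Z}_{>0}$ is constant on relative interiors of cones, $\pi:L\to\mathbb{R}^2$ is continuous, surjective, and maps each $\sigma'\in\Sigma_L$ isomorphically (homeomorphically, with $M(\sigma')=\pi^*M(\pi(\sigma'))$ for the groups of integral linear functions) onto a cone of $\Sigma$; for every connected open $U\subset\mathbb{R}^2$ and every connected component $V$ of $\pi^{-1}(U)$ the sum $\sum_{x'\in V\cap\pi^{-1}(x)}\mu(x')$ is constant in $x\in U$; $\sum_{x'\in\pi^{-1}(x)}\mu(x')=r$ for all $x$; and $\varphi:L\to\mathbb{R}$ satisfies $\varphi|_{\sigma'}\in M(\sigma')$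 for all $\sigma'\in\Sigma_L$. For $\sigma'\in\Sigma_L(2)$, $m(\sigma')\in M$ is the slope of $\varphi|_{\sigma'}$. The lifts of $\sigma\in\Sigma$ are the $\sigma'\in\Sigma_L$ with $\pi(\sigma')=\sigma$. **Combinatorial indecomposability.** Write $\mathbb{L}_1\le\mathbb{L}_2$ if there is a surjective morphism of cone complexes $f:L_2\to L_1$ with $\pi_1\circ f=\pi_2$, $f^*\varphi_1=\varphi_2$ and $\mu_1(y)=\sum_{x\in f^{-1}(y)}\mu_2(x)$. Connected multi-sections of the same rank are related by $\sim_c$ if they have a common lower bound for $\le$; combinatorial equivalence is the transitive closure of $\sim_c$. The combinatorial union $\mathbb{L}_1\cup_c\mathbb{L}_2$ is obtained from $L_1\sqcup L_2$ by gluing $\tau'\in\Sigma_{L_1}$ to $\tau''\in\Sigma_{L_2}$ whenever they lie over the same cone of $\Sigma$ and $\varphi_1|_{\tau'}=\varphi_2|_{\tau''}$; weights are added. $\mathbb{L}$ is *combinatorially indecomposable* if it is connected and not combinatorially equivalent to any $\mathbb{L}_1\cup_c\mathbb{L}_2$ with $\mathbb{L}_1,\mathbb{L}_2$ connected. **Unobstructedness.**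 Let $\mathbb{L}$ be combinatorially indecomposable. A $\mathbb{C}^\times$-local system $\mathcal{L}$ on $L\setminus L^{(0)}$ is given by transition constants $g_{\sigma_1'\sigma_2'}\in\mathbb{C}^\times$, one for each ordered pair of maximal cones of $L$ sharing a ray, with $g_{\sigma_2'\sigma_1'}=g_{\sigma_1'\sigma_2'}^{-1}$. For $\sigma\in\Sigma(2)$ let $\mathcal{E}_\sigma$ be the free module over $\mathbb{C}[\sigma^\vee\cap M]$ with frame $1(\sigma^{(\alpha)})$ indexed by the lifts $\sigma^{(\alpha)}$ of $\sigma$. For $\sigma_1,\sigma_2\in\Sigma(2)$ with $\tau=\sigma_1\cap\sigma_2\in\Sigma(1)$ put, over $\mathbb{C}[\tau^\vee\cap M]$, $$G^{sf}_{\sigma_1\sigma_2}:1(\sigma_1^{(\alpha)})\mapsto g_{\sigma_1^{(\alpha)}\sigma_2^{(\beta)}}z^{m(\sigma_1^{(\alpha)})-m(\sigma_2^{(\beta)})}1(\sigma_2^{(\beta)}),$$ where $\sigma_2^{(\beta)}$ is the lift of $\sigma_2$ sharing a ray with $\sigma_1^{(\alpha)}$. The wall-crossing automorphism is $\Theta_{\sigma_1\sigma_2}=\prod_{\omega'}\exp(N_{\sigma_1\sigma_2}(\omega'))$,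 where $$N_{\sigma_1\sigma_2}(\omega'):1(\sigma_1^{(\alpha)})\mapsto\sum_{\beta}n^{(\alpha\beta)}_{\sigma_1\sigma_2}(\omega')\,z^{m(\sigma_1^{(\alpha)})-m(\sigma_1^{(\beta)})}1(\sigma_1^{(\beta)}),$$ the sum being over the $\beta\neq\alpha$ with $\omega'\subset\sigma_1^{(\alpha)}\cap\sigma_1^{(\beta)}$ and $m(\sigma_1^{(\alpha)})-m(\sigma_1^{(\beta)})\in\tau^\vee$, the $n^{(\alpha\beta)}_{\sigma_1\sigma_2}(\omega')\in\mathbb{C}$ are arbitrary, and $\omega'$ runs over the intersections $\sigma_1^{(\alpha)}\cap\sigma_1^{(\beta)}$ with $\alpha\ne\beta$ and $m(\sigma_1^{(\alpha)})-m(\sigma_1^{(\beta)})\in\tau^\vee$. Put $G_{\sigma_1\sigma_2}=G^{sf}_{\sigma_1\sigma_2}\circ\Theta_{\sigma_1\sigma_2}$. These data are *consistent* if for every $\omega\in\Sigma$ and every cycle $\sigma_1,\dots,\sigma_l,\sigma_{l+1}=\sigma_1$ of maximal cones containing $\omega$, with $\sigma_i\cap\sigma_{i+1}\in\Sigma(1)$,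 one has $G_{\sigma_l\sigma_{l+1}}\circ\cdots\circ G_{\sigma_1\sigma_2}=\mathrm{Id}$. $\mathbb{L}$ is *unobstructed* if it admits $\mathcal{L}$ and $\Theta$ that are consistent. **Slope condition.** Let $\mathbb{L}$ have rank $2$. An *arrangement* is a listing $\sigma_1^{(1)},\dots,\sigma_k^{(1)},\sigma_1^{(2)},\dots,\sigma_k^{(2)}$ of all maximal cones of $L$, each once, such that $\pi(\sigma_i^{(1)})=\pi(\sigma_i^{(2)})=:\sigma_i$ and cyclically consecutive cones share a ray which is crossed anti-clockwise. The slope matrix $M_{\sigma_i\sigma_j}$ is the $2\times2$ matrix whose entry in column $\alpha$ and row $\beta$ is $m(\sigma_i^{(\alpha)})-m(\sigma_j^{(\beta)})$ if this lies in $(\sigma_i\cap\sigma_j)^\vee$, and $\infty$ otherwise; in the monomial matrix $Z_{\sigma_i\sigma_j}$ the entry $m$ is replaced by $z^m$ and $\infty$ by $0$. $M_{\sigma_i\sigma_j}$ is called upper- (lower-) triangular if $Z_{\sigma_i\sigma_j}$ is. The arrangement is *normalized* if the lower right entry of $Z_{\sigma_k\sigma_1}$ is $0$, its other three entries are nonzero,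 and each $M_{\sigma_i\sigma_{i+1}}$, $1\le i<k$, is upper- or lower-triangular. A normalized arrangement *satisfies the slope condition* if one of the following holds: 1. $M_{\sigma_{k-1}\sigma_k}$ is upper-triangular and there is $1\le i<k-1$ such that $M_{\sigma_i\sigma_{i+1}}$ is lower-triangular; 2. $M_{\sigma_{k-1}\sigma_k}$ is lower-triangular and there are $1\le i<j<k-1$ such that $M_{\sigma_j\sigma_{j+1}}$ is upper-triangular and $M_{\sigma_i\sigma_{i+1}}$ is lower-triangular. **Theorem.** Let $\mathbb{L}$ be a combinatorially indecomposable tropical Lagrangian multi-section of rank $2$ over a complete fan $\Sigma$ in $\mathbb{R}^2$. Then the maximal cones of $L$ admit a normalized arrangement, and for every normalized arrangement, $\mathbb{L}$ is unobstructed if and only if the slope condition is satisfied. -/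

import Mathlib

universe u

namespace TropLag

noncomputable section

/-! ### Lattice, dual lattice, cones and fans

The lattice is `N = ℤ²`, so that `N_ℝ = ℝ²`; its dual `M` is identified with `ℤ²` through the
standard pairing. -/

/-- The plane `N_ℝ = ℝ²`. -/
abbrev Plane : Type := Fin 2 → ℝ

/-- The dual lattice `M = Hom(N, ℤ) = ℤ²`. -/
abbrev DualLattice : Type := Fin 2 → ℤ

/-- The pairing `⟨m, x⟩` of `m ∈ M` with `x ∈ N_ℝ`. -/
def pairing (m : DualLattice) (x : Plane) : ℝ := ∑ i, (m i : ℝ) * x i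

/-- A rational polyhedral cone: the set of non-negative combinations of finitely many lattice
vectors. -/
def IsRationalCone (σ : Set Plane) : Prop :=
  ∃ S : Finset (Fin 2 → ℤ),
    σ = {x | ∃ a : (Fin 2 → ℤ) → ℝ, (∀ v, 0 ≤ a v) ∧ x = ∑ v ∈ S, a v • (fun i => (v i : ℝ))}

/-- A cone is strictly convex if it contains no line. -/
def IsStrictlyConvexCone (σ : Set Plane) : Prop :=
  ∀ x, x ∈ σ → -x ∈ σ → x = 0

/-- The faces of a polyhedral cone: its intersections with `u^⊥`, for `u` non-negative on it. -/
def IsFace (τ σ : Set Plane) : Prop :=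
  ∃ u : Plane, (∀ x ∈ σ, 0 ≤ ∑ i, u i * x i) ∧ τ = {x | x ∈ σ ∧ ∑ i, u i * x i = 0}

/-- The relative interior of a polyhedral cone: its points that lie on no proper face. -/
def relInt (σ : Set Plane) : Set Plane :=
  {x | x ∈ σ ∧ ∀ τ, IsFace τ σ → x ∈ τ → τ = σ}

/-- The dimension of a cone. -/
def coneDim (σ : Set Plane) : ℕ := Module.finrank ℝ (Submodule.span ℝ σ)

/-- `m ∈ σ^∨ ∩ M`. -/
def InDual (m : DualLattice) (σ : Set Plane) : Prop := ∀ x ∈ σ, 0 ≤ pairing m x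

/-- A complete fan in `ℝ²`. -/
structure CompleteFan where
  /-- the cones of the fan -/
  cones : Set (Set Plane)
  finite : cones.Finite
  rational : ∀ σ ∈ cones, IsRationalCone σ
  strictlyConvex : ∀ σ ∈ cones, IsStrictlyConvexCone σ
  face_mem : ∀ σ ∈ cones, ∀ τ, IsFace τ σ → τ ∈ cones
  inter_face : ∀ σ₁ ∈ cones, ∀ σ₂ ∈ cones, IsFace (σ₁ ∩ σ₂) σ₁
  complete : ⋃₀ cones = Set.univ

/-- `Σ(d)`, the set of `d`-dimensional cones. -/
def CompleteFan.dimCones (F : CompleteFan) (d : ℕ) : Set (Set Plane) :=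
  {σ | σ ∈ F.cones ∧ coneDim σ = d}

/-! ### Tropical Lagrangian multi-sections -/

/-- A tropical Lagrangian multi-section `(L, Σ_L, μ, π, φ)` over a complete fan `Σ` in `ℝ²`.

The space `L` is a weighted cone complex and `π : L → ℝ²` is a branched covering map of cone
complexes. Every cone `σ'` of `L` is isomorphic, through `π`, to a cone `σ` of `Σ`, so its group
of integral linear functions is `M(σ') = π^* M(σ) = {⟨m, π(·)⟩ |_{σ'} : m ∈ M}`, and `π|_{σ'}` is
its canonical embedding in the dual vector space of `M(σ')`. Therefore the group `M(σ')` is not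
a separate field, and the axioms of a cone complex are stated through `π`. -/
structure TropicalMultisection (F : CompleteFan) where
  /-- the domain `L` -/
  X : Type u
  [top : TopologicalSpace X]
  /-- the collection `Σ_L` of cones of `L` -/
  cones : Set (Set X)
  finite : cones.Finite
  isClosed : ∀ σ' ∈ cones, IsClosed σ'
  /-- the projection `π` -/
  proj : X → Plane
  continuous_proj : Continuous proj
  surjective_proj : Function.Surjective proj
  /-- `π` maps each cone of `L` homeomorphically onto a cone of `Σ`. -/
  proj_mem : ∀ σ' ∈ cones, proj '' σ' ∈ F.cones
  isEmbedding_proj : ∀ σ' ∈ cones, Topology.IsEmbedding (σ'.domRestrict proj)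
  /-- The faces of a cone of `L` are cones of `L`. -/
  face_mem : ∀ σ' ∈ cones, ∀ τ, IsFace τ (proj '' σ') → σ' ∩ proj ⁻¹' τ ∈ cones
  /-- `L` is the disjoint union of the relative interiors of its cones. -/
  partition : ∀ x : X, ∃! σ' : Set X, σ' ∈ cones ∧ x ∈ σ' ∧ proj x ∈ relInt (proj '' σ')
  /-- the weight `μ` -/
  weight : X → ℕ
  weight_pos : ∀ x, 0 < weight x
  weight_const : ∀ σ' ∈ cones, ∀ x ∈ σ', ∀ y ∈ σ',
    proj x ∈ relInt (proj '' σ') → proj y ∈ relInt (proj '' σ') → weight x = weight y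
  /-- For every connected open `U` and every connected component `V` of `π⁻¹(U)` (the component
  of a point `y`), the trace of the weight along `π|_V` is constant on `U`. -/
  trace_const : ∀ U : Set Plane, IsOpen U → IsConnected U → ∀ y ∈ proj ⁻¹' U,
    ∀ p ∈ U, ∀ q ∈ U,
      ∑ᶠ x ∈ connectedComponentIn (proj ⁻¹' U) y ∩ proj ⁻¹' {p}, weight x =
        ∑ᶠ x ∈ connectedComponentIn (proj ⁻¹' U) y ∩ proj ⁻¹' {q}, weight x
  /-- the rank, which is the total trace of the weight -/
  rank : ℕ
  trace_eq_rank : ∀ p : Plane, ∑ᶠ x ∈ proj ⁻¹' {p}, weight x = rank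
  /-- the piecewise linear function `φ` -/
  phi : X → ℝ
  phi_linear : ∀ σ' ∈ cones, ∃ m : DualLattice, ∀ x ∈ σ', phi x = pairing m (proj x)

namespace TropicalMultisection

variable {F : CompleteFan}

instance instTopX (L : TropicalMultisection.{u} F) : TopologicalSpace L.X := L.top

/-- `L` is connected. -/
def Connected (L : TropicalMultisection.{u} F) : Prop := ConnectedSpace L.X

/-- `Σ_L(d)`, the set of `d`-dimensional cones of `L`. -/
def dimCones (L : TropicalMultisection.{u} F) (d : ℕ) : Set (Set L.X) :=
  {σ' | σ' ∈ L.cones ∧ coneDim (L.proj '' σ') = d}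

/-! ### Combinatorial indecomposability -/

/-- `𝕃₁ ≤ 𝕃₂`: there is a surjective morphism of cone complexes `f : L₂ → L₁` over `ℝ²` which
pushes the weight of `L₂` forward to that of `L₁` and pulls `φ₁` back to `φ₂`. -/
def Le (L₁ L₂ : TropicalMultisection.{u} F) : Prop :=
  ∃ f : L₂.X → L₁.X, Continuous f ∧ Function.Surjective f ∧
    (∀ σ' ∈ L₂.cones, ∃ σ ∈ L₁.cones, f '' σ' ⊆ σ) ∧
    (∀ x, L₁.proj (f x) = L₂.proj x) ∧
    (∀ y, ∑ᶠ x ∈ f ⁻¹' {y}, L₂.weight x = L₁.weight y) ∧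
    (∀ x, L₁.phi (f x) = L₂.phi x)

/-- The relation `∼_c` between connected multi-sections: same rank, and a common lower bound. -/
def CombRel (L₁ L₂ : TropicalMultisection.{u} F) : Prop :=
  L₁.Connected ∧ L₂.Connected ∧ L₁.rank = L₂.rank ∧
    ∃ L₀ : TropicalMultisection.{u} F, Le L₀ L₁ ∧ Le L₀ L₂

/-- Combinatorial equivalence: the transitive closure of `∼_c`. -/
def CombEquiv (L₁ L₂ : TropicalMultisection.{u} F) : Prop :=
  Relation.ReflTransGen CombRel L₁ L₂

/-- The gluing of a cone `τ'` of `L₁` with a cone `τ''` of `L₂`, whenever they lie over the same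
cone `τ` of `Σ` and `φ₁|_{τ'} = φ₂|_{τ''}` as functions on `τ`. -/
def Glue (L₁ L₂ : TropicalMultisection.{u} F) (x y : L₁.X ⊕ L₂.X) : Prop :=
  ∃ τ₁ ∈ L₁.cones, ∃ τ₂ ∈ L₂.cones, L₁.proj '' τ₁ = L₂.proj '' τ₂ ∧
    (∀ x₁ ∈ τ₁, ∀ x₂ ∈ τ₂, L₁.proj x₁ = L₂.proj x₂ → L₁.phi x₁ = L₂.phi x₂) ∧
    ∃ x₁ ∈ τ₁, ∃ x₂ ∈ τ₂, L₁.proj x₁ = L₂.proj x₂ ∧ x = Sum.inl x₁ ∧ y = Sum.inr x₂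

/-- `U` is (a copy of) the combinatorial union `𝕃₁ ∪_c 𝕃₂`: its domain is the quotient of
`L₁ ⊔ L₂` by the gluing, its cones are the images of the cones of `L₁` and `L₂`, the weights are
added up along the quotient map `q`, and `π` and `φ` are induced. -/
def IsCombUnion (U L₁ L₂ : TropicalMultisection.{u} F) : Prop :=
  ∃ q : L₁.X ⊕ L₂.X → U.X, Topology.IsQuotientMap q ∧
    (∀ x y, q x = q y ↔ Relation.EqvGen (Glue L₁ L₂) x y) ∧
    U.cones = {σ | (∃ σ₁ ∈ L₁.cones, σ = (q ∘ Sum.inl) '' σ₁) ∨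
      (∃ σ₂ ∈ L₂.cones, σ = (q ∘ Sum.inr) '' σ₂)} ∧
    (∀ x, U.proj (q x) = Sum.elim L₁.proj L₂.proj x) ∧
    (∀ y, U.weight y = ∑ᶠ x ∈ q ⁻¹' {y}, Sum.elim L₁.weight L₂.weight x) ∧
    (∀ x, U.phi (q x) = Sum.elim L₁.phi L₂.phi x)

/-- A connected multi-section is combinatorially indecomposable if it is not combinatorially
equivalent to a combinatorial union of two connected multi-sections. -/
def CombIndecomposable (L : TropicalMultisection.{u} F) : Prop :=
  L.Connected ∧
    ¬ ∃ L₁ L₂ U : TropicalMultisection.{u} F,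
      L₁.Connected ∧ L₂.Connected ∧ IsCombUnion U L₁ L₂ ∧ CombEquiv L U

/-! ### Slopes and monomials -/

/-- The slope `m(σ') ∈ M` of `φ` on a maximal cone `σ'` of `L`: the `m` with
`φ|_{σ'} = ⟨m, π(·)⟩`, which is unique as `π(σ')` spans the plane. -/
def slope (L : TropicalMultisection.{u} F) (σ' : Set L.X) : DualLattice :=
  Classical.epsilon fun m : DualLattice => ∀ x ∈ σ', L.phi x = pairing m (L.proj x)

/-- The Laurent polynomial ring `ℂ[M]`, which contains the rings `ℂ[σ^∨ ∩ M]`. -/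
abbrev Laurent : Type := AddMonoidAlgebra ℂ DualLattice

/-- `c z^m ∈ ℂ[M]`. -/
def mono (m : DualLattice) (c : ℂ) : Laurent := AddMonoidAlgebra.single m c

/-- The lifts of a maximal cone `σ` of `Σ`. They index the frame `1(σ^{(α)})` of `E_σ`. For a
combinatorially indecomposable `L` they all have weight one. -/
def Lift (L : TropicalMultisection.{u} F) (σ : Set Plane) : Type u :=
  {σ' : Set L.X // σ' ∈ L.cones ∧ L.proj '' σ' = σ}

instance instFintypeLift (L : TropicalMultisection.{u} F) (σ : Set Plane) :
    Fintype (L.Lift σ) :=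
  have : Finite L.cones := L.finite
  have : Finite (L.Lift σ) :=
    Finite.of_injective (fun α : L.Lift σ => (⟨α.1, α.2.1⟩ : L.cones))
      (fun _ _ h => Subtype.ext (congrArg (fun s : L.cones => (s : Set L.X)) h))
  Fintype.ofFinite _

instance instDecidableEqLift (L : TropicalMultisection.{u} F) (σ : Set Plane) :
    DecidableEq (L.Lift σ) :=
  Classical.decEq _

/-! ### Local systems, wall-crossing factors, unobstructedness

A bundle map `E_{σ₁} → E_{σ₂}` is written as a matrix over `ℂ[M]` with columns indexed by the lifts
of `σ₁` and rows indexed by the lifts of `σ₂`, so that composition is the product of matrices. As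
`ℂ[ω^∨ ∩ M]` is a subring of `ℂ[M]`, equalities of bundle maps over `U(ω)` can be checked there. -/

/-- A `ℂˣ`-local system on `L ∖ L⁽⁰⁾`, given by its transition maps `1_{σ₁'} ↦ g_{σ₁'σ₂'} 1_{σ₂'}` on
the good cover of `L ∖ L⁽⁰⁾` by small neighborhoods of the maximal cones. Two of them meet if and only
if the cones share a ray, and no three of them meet, so a 1-cocycle is a choice of units `g_{σ₁'σ₂'}`
with `g_{σ₂'σ₁'} = g_{σ₁'σ₂'}⁻¹`. -/
structure LocalSystem (L : TropicalMultisection.{u} F) where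
  /-- the transition maps (only those of maximal cones that share a ray are relevant) -/
  g : Set L.X → Set L.X → ℂˣ
  g_symm : ∀ σ₁' ∈ L.dimCones 2, ∀ σ₂' ∈ L.dimCones 2, σ₁' ∩ σ₂' ∈ L.dimCones 1 →
    g σ₂' σ₁' = (g σ₁' σ₂')⁻¹

open scoped Classical in
/-- The semi-flat transition map
`G^{sf}_{σ₁σ₂} : 1(σ₁^{(α)}) ↦ g_{σ₁^{(α)}σ₂^{(β)}} z^{m(σ₁^{(α)}) - m(σ₂^{(β)})} 1(σ₂^{(β)})`, with
`σ₂^{(β)}` the lift of `σ₂` that shares a ray with `σ₁^{(α)}`. -/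
def Gsf (L : TropicalMultisection.{u} F) (ℒ : L.LocalSystem) (σ₁ σ₂ : Set Plane) :
    Matrix (L.Lift σ₂) (L.Lift σ₁) Laurent :=
  Matrix.of fun β α =>
    if α.1 ∩ β.1 ∈ L.dimCones 1 then mono (L.slope α.1 - L.slope β.1) (ℒ.g α.1 β.1 : ℂ) else 0

/-- The coefficients `n_{σ₁σ₂}^{(αβ)}(ω')` of the wall-crossing factors, as a function of `σ₁`, `σ₂`,
`ω'`, `σ₁^{(α)}` and `σ₁^{(β)}`. -/
abbrev WallData (L : TropicalMultisection.{u} F) : Type u :=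
  Set Plane → Set Plane → Set L.X → Set L.X → Set L.X → ℂ

/-- The set `S'_τ(σ₁)` of all `σ₁^{(α)} ∩ σ₁^{(β)}`, for distinct lifts of `σ₁` such that
`m(σ₁^{(α)}) - m(σ₁^{(β)}) ∈ τ^∨`, where `τ = σ₁ ∩ σ₂`. -/
def wallSet (L : TropicalMultisection.{u} F) (σ₁ σ₂ : Set Plane) : Set (Set L.X) :=
  Set.range fun p : {p : L.Lift σ₁ × L.Lift σ₁ //
    p.1 ≠ p.2 ∧ InDual (L.slope p.1.1 - L.slope p.2.1) (σ₁ ∩ σ₂)} => p.1.1.1 ∩ p.1.2.1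

theorem finite_wallSet (L : TropicalMultisection.{u} F) (σ₁ σ₂ : Set Plane) :
    (L.wallSet σ₁ σ₂).Finite :=
  Set.finite_range _

open scoped Classical in
/-- The endomorphism `N_τ(ω')` of `E_{σ₁}` over `U(τ)`, where `τ = σ₁ ∩ σ₂`: the coefficient of
`1(σ₁^{(β)})` in the image of `1(σ₁^{(α)})` is `n_{σ₁σ₂}^{(αβ)}(ω') z^{m(σ₁^{(α)}) - m(σ₁^{(β)})}`
if `α ≠ β`, `ω' ⊆ σ₁^{(α)} ∩ σ₁^{(β)}` and the exponent lies in `τ^∨`, and `0` otherwise. -/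
def wallN (L : TropicalMultisection.{u} F) (n : L.WallData) (σ₁ σ₂ : Set Plane) (ω' : Set L.X) :
    Matrix (L.Lift σ₁) (L.Lift σ₁) Laurent :=
  Matrix.of fun β α =>
    if α ≠ β ∧ ω' ⊆ α.1 ∩ β.1 ∧ InDual (L.slope α.1 - L.slope β.1) (σ₁ ∩ σ₂) then
      mono (L.slope α.1 - L.slope β.1) (n σ₁ σ₂ ω' α.1 β.1) else 0

/-- The wall-crossing automorphism `Θ_τ = ∏_{ω' ∈ S'_τ} exp (N_τ(ω'))`. For a combinatorially
indecomposable `L` the `N_τ(ω')` are nilpotent and commute, so the order is irrelevant. -/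
def wallTheta (L : TropicalMultisection.{u} F) (n : L.WallData) (σ₁ σ₂ : Set Plane) :
    Matrix (L.Lift σ₁) (L.Lift σ₁) Laurent :=
  ((L.finite_wallSet σ₁ σ₂).toFinset.toList.map fun ω' =>
    IsNilpotent.exp (L.wallN n σ₁ σ₂ ω')).prod

/-- The corrected transition map `G_{σ₁σ₂} = G^{sf}_{σ₁σ₂} ∘ Θ_{σ₁σ₂}`. -/
def transition (L : TropicalMultisection.{u} F) (ℒ : L.LocalSystem) (n : L.WallData)
    (σ₁ σ₂ : Set Plane) : Matrix (L.Lift σ₂) (L.Lift σ₁) Laurent :=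
  L.Gsf ℒ σ₁ σ₂ * L.wallTheta n σ₁ σ₂

/-- The composition `G_{σ_{l-1}σ_l} ∘ ⋯ ∘ G_{σ₀σ₁}` along a sequence of maximal cones. -/
def holonomy (L : TropicalMultisection.{u} F) (ℒ : L.LocalSystem) (n : L.WallData)
    (σ : ℕ → Set Plane) : (l : ℕ) → Matrix (L.Lift (σ l)) (L.Lift (σ 0)) Laurent
  | 0 => 1
  | l + 1 => L.transition ℒ n (σ l) (σ (l + 1)) * L.holonomy ℒ n σ l

open scoped Classical in
/-- `ω`-consistency: for every cycle `σ₀, σ₁, …, σ_l = σ₀` of maximal cones that contain `ω`, with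
successive cones sharing a ray, the composition of the transition maps is the identity. -/
def ConsistentAt (L : TropicalMultisection.{u} F) (ℒ : L.LocalSystem) (n : L.WallData)
    (ω : Set Plane) : Prop :=
  ∀ (l : ℕ) (σ : ℕ → Set Plane), σ l = σ 0 →
    (∀ i ≤ l, σ i ∈ F.dimCones 2 ∧ ω ⊆ σ i) →
    (∀ i < l, σ i ∩ σ (i + 1) ∈ F.dimCones 1) →
    ∀ (β : L.Lift (σ l)) (α : L.Lift (σ 0)),
      L.holonomy ℒ n σ l β α = if β.1 = α.1 then 1 else 0

/-- `𝕃` is unobstructed: there are a local system and wall-crossing automorphisms that are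
consistent at every cone of `Σ`. -/
def Unobstructed (L : TropicalMultisection.{u} F) : Prop :=
  ∃ (ℒ : L.LocalSystem) (n : L.WallData), ∀ ω ∈ F.cones, L.ConsistentAt ℒ n ω

/-! ### The slope condition -/

open scoped Classical in
/-- The entry of the slope matrix `M_{σ₁σ₂}` for lifts `σ₁'` of `σ₁` and `σ₂'` of `σ₂`. -/
def slopeEntry (L : TropicalMultisection.{u} F) (σ₁' σ₂' : Set L.X) : WithTop DualLattice :=
  if InDual (L.slope σ₁' - L.slope σ₂') (L.proj '' σ₁' ∩ L.proj '' σ₂') then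
    ((L.slope σ₁' - L.slope σ₂' : DualLattice) : WithTop DualLattice) else ⊤

/-- The orientation form `det (x, y)` on the plane. -/
def planeDet (x y : Plane) : ℝ := x 0 * y 1 - x 1 * y 0

/-- `σ₁'` and `σ₂'` share a ray which is crossed anti-clockwise on the way from `σ₁'` to `σ₂'`. -/
def NextAnticlockwise (L : TropicalMultisection.{u} F) (σ₁' σ₂' : Set L.X) : Prop :=
  σ₁' ∩ σ₂' ∈ L.dimCones 1 ∧
    ∀ v ∈ relInt (L.proj '' (σ₁' ∩ σ₂')),
      (∀ x ∈ relInt (L.proj '' σ₁'), 0 < planeDet x v) ∧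
      (∀ y ∈ relInt (L.proj '' σ₂'), 0 < planeDet v y)

/-- An anti-clockwise arrangement
`σ_1^{(1)}, …, σ_k^{(1)}, σ_1^{(2)}, …, σ_k^{(2)}` of all the maximal cones of a rank-2 `L`, where
`σ_i^{(1)}`, `σ_i^{(2)}` lie over the same maximal cone `σ_i` of `Σ`. It is recorded as the
`2k`-periodic sequence `seq` with `σ_i^{(1)} = seq i` and `σ_i^{(2)} = seq (i + k)`. -/
structure Arrangement (L : TropicalMultisection.{u} F) where
  /-- the number of maximal cones of `Σ` -/
  k : ℕ
  /-- the sequence of maximal cones of `L` -/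
  seq : ℕ → Set L.X
  periodic : ∀ i, seq (i + 2 * k) = seq i
  bijOn : Set.BijOn seq (Set.Icc 1 (2 * k)) (L.dimCones 2)
  same_base : ∀ i, L.proj '' seq (i + k) = L.proj '' seq i
  next : ∀ i, L.NextAnticlockwise (seq i) (seq (i + 1))

namespace Arrangement

variable {L : TropicalMultisection.{u} F}

/-- The lift `σ_i^{(α)}`; the indices `α = 1, 2` are `0, 1 : Fin 2`. -/
def cone (A : L.Arrangement) (i : ℕ) (α : Fin 2) : Set L.X := A.seq (i + (α : ℕ) * A.k)

/-- The slope matrix `M_{σ_iσ_j}`. The entry for `σ_i^{(α)}` and `σ_j^{(β)}` stands in column `α`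
and row `β`, as in the matrix of `G_{σ_iσ_j}` acting on column vectors. -/
def slopeMatrix (A : L.Arrangement) (i j : ℕ) : Matrix (Fin 2) (Fin 2) (WithTop DualLattice) :=
  Matrix.of fun β α => L.slopeEntry (A.cone i α) (A.cone j β)

end Arrangement

/-- The monomial matrix of a slope matrix: `m` becomes `z^m` and `∞` becomes `0`. -/
def monomialMatrix (S : Matrix (Fin 2) (Fin 2) (WithTop DualLattice)) :
    Matrix (Fin 2) (Fin 2) Laurent :=
  S.map (WithTop.recTopCoe (C := fun _ => Laurent) 0 (fun m => mono m 1))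

/-- A slope matrix is upper-triangular if its monomial matrix is. -/
def IsUpper (S : Matrix (Fin 2) (Fin 2) (WithTop DualLattice)) : Prop :=
  ∀ a b : Fin 2, b < a → monomialMatrix S a b = 0

/-- A slope matrix is lower-triangular if its monomial matrix is. -/
def IsLower (S : Matrix (Fin 2) (Fin 2) (WithTop DualLattice)) : Prop :=
  ∀ a b : Fin 2, a < b → monomialMatrix S a b = 0

namespace Arrangement

variable {L : TropicalMultisection.{u} F}

/-- The normalization of an arrangement: exactly the lower right entry of the monomial matrix of
`σ_k, σ_1` vanishes, and all the other slope matrices `M_{σ_iσ_{i+1}}`, `1 ≤ i < k`, are upper- or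
lower-triangular. -/
def Normalized (A : L.Arrangement) : Prop :=
  (monomialMatrix (A.slopeMatrix A.k 1) 0 0 ≠ 0 ∧ monomialMatrix (A.slopeMatrix A.k 1) 0 1 ≠ 0 ∧
    monomialMatrix (A.slopeMatrix A.k 1) 1 0 ≠ 0 ∧ monomialMatrix (A.slopeMatrix A.k 1) 1 1 = 0) ∧
  ∀ i, 1 ≤ i → i < A.k → IsUpper (A.slopeMatrix i (i + 1)) ∨ IsLower (A.slopeMatrix i (i + 1))

/-- The slope condition, for a normalized arrangement. -/
def SlopeCondition (A : L.Arrangement) : Prop :=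
  (IsUpper (A.slopeMatrix (A.k - 1) A.k) ∧
    ∃ i, 1 ≤ i ∧ i < A.k - 1 ∧ IsLower (A.slopeMatrix i (i + 1))) ∨
  (IsLower (A.slopeMatrix (A.k - 1) A.k) ∧
    ∃ i j, 1 ≤ i ∧ i < j ∧ j < A.k - 1 ∧
      IsUpper (A.slopeMatrix j (j + 1)) ∧ IsLower (A.slopeMatrix i (i + 1)))

end Arrangement

end TropicalMultisection

end

end TropLag

/-!
# Unobstructed tropical Lagrangian multi-sections of rank two

Over a complete fan in the plane the maximal cones form a single anti-clockwise cycle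
`σ_1, …, σ_k`, and a multi-section of rank two has at most two lifts of each of them. Starting from
a labelling of the lifts of one maximal cone by two sheets, one continues it ray by ray around the
origin. If the labelling closes up, or if `φ` takes the same values on the lifts of some ray, where
the sheets may then be exchanged, the two sheets carry piecewise linear functions of the plane, and
`L` lies above the combinatorial union of these functions
(`not_combIndecomposable_of_labelling`, based on `le_gluedUnion`). So for a combinatorially
indecomposable `L` the maximal cones of `L` form one cycle of length `2k` which covers that of `Σ`
twice, and `φ` separates the two lifts of each ray (`exists_arrangement`). Exchanging the sheets
if necessary normalizes this arrangement (`exists_normalized_arrangement`).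

Over each ray exactly one of the two sheets receives a wall-crossing term from the other one,
namely the sheet on which `φ` is smaller; this is the predicate `Arrangement.Moves`. Triangularity
of the slope matrices translates into this language, and the slope condition says that, among the
rays crossed before closing up, the second sheet moves at some ray and the first sheet moves at a
later one (`slopeCondition_iff`).

Up to monomials, the transition maps are constant `2 × 2` matrices: a unipotent elementary matrix
followed by a diagonal one, and for `σ_k, σ_1` also the exchange of the two sheets. The evaluation
of Laurent polynomials at `1` removes the monomials.
* If the slope condition fails, follow the image of the first frame vector of `E_{σ_1}`. Its
  component on the first sheet never vanishes: its component on the second sheet is zero until the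
  second sheet moves, and from then on the first sheet does not move. As the first sheet of `σ_k`
  continues to the second sheet of `σ_1`, the composition around the origin has a non-zero
  off-diagonal entry (`slopeCondition_of_unobstructed`).
* If the second sheet moves at the `i`-th ray and the first one at the `j`-th ray with `i < j < k`,
  put the vectors `(1, 0)`, `(0, 1)`, `(1, 1)` on the arrangement `seq 1, …, seq (2k)`, changing
  from one vector to the next at the positions `j` and `k + i`. Each step adds a multiple of the
  vector of the other sheet, where this is allowed, up to a sign which is absorbed by the local
  system. The vectors twisted by the monomials `z^{-m}` form a global flat frame, so the
  composition of the transition maps along any cycle is the identity (`unobstructed_of_vectors`).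
-/

namespace TropLag

open TropicalMultisection (planeDet)

/-! ### Cones in the plane -/

/-- The ray spanned by `v` (the origin, for `v = 0`). -/
def ray (v : Plane) : Set Plane := {x | ∃ t : ℝ, 0 ≤ t ∧ x = t • v}

/-- `σ` is the two-dimensional cone spanned by `u` and `v`, with `v` anti-clockwise of `u`. -/
def IsSector (σ : Set Plane) (u v : Plane) : Prop :=
  0 < planeDet u v ∧ ∀ x, x ∈ σ ↔ 0 ≤ planeDet u x ∧ 0 ≤ planeDet x v

section planeDet

variable (x y z : Plane) (a : ℝ)

theorem planeDet_add_left : planeDet (x + y) z = planeDet x z + planeDet y z := by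
  simp only [planeDet, Pi.add_apply]; ring

theorem planeDet_add_right : planeDet x (y + z) = planeDet x y + planeDet x z := by
  simp only [planeDet, Pi.add_apply]; ring

theorem planeDet_smul_left : planeDet (a • x) y = a * planeDet x y := by
  simp only [planeDet, Pi.smul_apply, smul_eq_mul]; ring

theorem planeDet_smul_right : planeDet x (a • y) = a * planeDet x y := by
  simp only [planeDet, Pi.smul_apply, smul_eq_mul]; ring

@[simp] theorem planeDet_self : planeDet x x = 0 := by
  simp only [planeDet]; ring

theorem planeDet_swap : planeDet y x = -planeDet x y := by
  simp only [planeDet]; ring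

@[simp] theorem planeDet_zero_left : planeDet 0 x = 0 := by simp [planeDet]

@[simp] theorem planeDet_zero_right : planeDet x 0 = 0 := by simp [planeDet]

theorem planeDet_cyclic : planeDet y z • x + planeDet z x • y + planeDet x y • z = 0 := by
  ext i
  fin_cases i <;> simp [planeDet] <;> ring

theorem continuous_planeDet_right : Continuous (planeDet x) := by
  unfold planeDet; fun_prop

theorem continuous_planeDet_left : Continuous fun y => planeDet y x := by
  unfold planeDet; fun_prop

end planeDet

theorem exists_smul_of_planeDet_eq_zero {u x : Plane} (hu : u ≠ 0) (h : planeDet u x = 0) :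
    ∃ c : ℝ, x = c • u := by
  have h' : u 0 * x 1 = u 1 * x 0 := by simp only [planeDet] at h; linarith
  by_cases h0 : u 0 = 0
  · have h1 : u 1 ≠ 0 := fun h1 => hu (by ext i; fin_cases i <;> simp [h0, h1])
    refine ⟨x 1 / u 1, ?_⟩
    ext i
    fin_cases i
    · have : x 0 = 0 := by simpa [h0, h1] using h'
      simp [h0, this]
    · simp [h1]
  · refine ⟨x 0 / u 0, ?_⟩
    ext i
    fin_cases i
    · simp [h0]
    · simp; field_simp; linarith

/-- The rotation of a vector by a right angle. -/
def quarterTurn (v : Plane) : Plane := ![-v 1, v 0]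

theorem planeDet_quarterTurn_pos {v : Plane} (hv : v ≠ 0) : 0 < planeDet v (quarterTurn v) := by
  have : planeDet v (quarterTurn v) = v 0 ^ 2 + v 1 ^ 2 := by
    simp [planeDet, quarterTurn]; ring
  rw [this]
  by_contra hle
  have h0 : v 0 = 0 := by nlinarith [sq_nonneg (v 0), sq_nonneg (v 1)]
  have h1 : v 1 = 0 := by nlinarith [sq_nonneg (v 0), sq_nonneg (v 1)]
  exact hv (by ext i; fin_cases i <;> simp [h0, h1])

theorem pairing_smul (m : DualLattice) (a : ℝ) (x : Plane) :
    pairing m (a • x) = a * pairing m x := by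
  simp [pairing]; ring

theorem pairing_sub (m m' : DualLattice) (x : Plane) :
    pairing (m - m') x = pairing m x - pairing m' x := by
  simp [pairing]; ring

@[simp] theorem pairing_zero (m : DualLattice) : pairing m 0 = 0 := by simp [pairing]

theorem mem_ray_self (v : Plane) : v ∈ ray v := ⟨1, zero_le_one, by simp⟩

theorem zero_mem_ray (v : Plane) : 0 ∈ ray v := ⟨0, le_rfl, by simp⟩

theorem ray_smul {c : ℝ} (hc : 0 < c) (v : Plane) : ray (c • v) = ray v := by
  ext x
  constructor
  · rintro ⟨t, ht, rfl⟩
    exact ⟨t * c, by positivity, by rw [smul_smul]⟩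
  · rintro ⟨t, ht, rfl⟩
    exact ⟨t / c, by positivity, by rw [smul_smul]; congr 1; field_simp⟩

namespace IsSector

variable {σ : Set Plane} {u v x : Plane}

theorem left_ne_zero (h : IsSector σ u v) : u ≠ 0 := by
  rintro rfl; simpa using h.1

theorem right_ne_zero (h : IsSector σ u v) : v ≠ 0 := by
  rintro rfl; simpa using h.1

theorem left_mem (h : IsSector σ u v) : u ∈ σ := (h.2 u).2 ⟨by simp, h.1.le⟩

theorem right_mem (h : IsSector σ u v) : v ∈ σ := (h.2 v).2 ⟨h.1.le, by simp⟩

theorem zero_mem (h : IsSector σ u v) : 0 ∈ σ := (h.2 0).2 ⟨by simp, by simp⟩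

theorem decomp (h : IsSector σ u v) (x : Plane) :
    x = (planeDet x v / planeDet u v) • u + (planeDet u x / planeDet u v) • v := by
  have h0 := h.1.ne'
  ext i
  simp only [Pi.add_apply, Pi.smul_apply, smul_eq_mul]
  field_simp
  fin_cases i <;> simp [planeDet] <;> ring

theorem mem_iff (h : IsSector σ u v) :
    x ∈ σ ↔ ∃ a b : ℝ, 0 ≤ a ∧ 0 ≤ b ∧ x = a • u + b • v := by
  constructor
  · intro hx
    exact ⟨_, _, div_nonneg ((h.2 x).1 hx).2 h.1.le, div_nonneg ((h.2 x).1 hx).1 h.1.le,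
      h.decomp x⟩
  · rintro ⟨a, b, ha, hb, rfl⟩
    rw [h.2]
    simp only [planeDet_add_left, planeDet_add_right, planeDet_smul_left, planeDet_smul_right,
      planeDet_self]
    have := h.1
    constructor <;> nlinarith [mul_nonneg ha this.le, mul_nonneg hb this.le]

theorem smul_left (h : IsSector σ u v) {c : ℝ} (hc : 0 < c) : IsSector σ (c • u) v := by
  refine ⟨by rw [planeDet_smul_left]; exact mul_pos hc h.1, fun x => ?_⟩
  rw [h.2, planeDet_smul_left, mul_nonneg_iff_of_pos_left hc]

theorem smul_right (h : IsSector σ u v) {c : ℝ} (hc : 0 < c) : IsSector σ u (c • v) := by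
  refine ⟨by rw [planeDet_smul_right]; exact mul_pos hc h.1, fun x => ?_⟩
  rw [h.2, planeDet_smul_right, mul_nonneg_iff_of_pos_left hc]

end IsSector

/-! ### Faces and relative interiors -/

theorem sum_mul_eq (w x : Plane) : ∑ i, w i * x i = w 0 * x 0 + w 1 * x 1 := by
  simp [Fin.sum_univ_two]

theorem isFace_self (σ : Set Plane) : IsFace σ σ := ⟨0, by simp, by simp⟩

theorem IsFace.subset {τ σ : Set Plane} (h : IsFace τ σ) : τ ⊆ σ := by
  obtain ⟨w, -, rfl⟩ := h
  exact fun x hx => hx.1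

theorem IsSector.eq_of_isFace {σ τ : Set Plane} {u v : Plane} (h : IsSector σ u v)
    (hτ : IsFace τ σ) : τ = {0} ∨ τ = ray u ∨ τ = ray v ∨ τ = σ := by
  obtain ⟨w, hw, rfl⟩ := hτ
  have hu := hw u h.left_mem
  have hv := hw v h.right_mem
  have key : ∀ a b : ℝ, ∑ i, w i * (a • u + b • v) i =
      a * (∑ i, w i * u i) + b * (∑ i, w i * v i) := by
    intro a b; simp [Fin.sum_univ_two]; ring
  have set_eq : {x | x ∈ σ ∧ ∑ i, w i * x i = 0} = {x | ∃ a b : ℝ, 0 ≤ a ∧ 0 ≤ b ∧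
      x = a • u + b • v ∧ a * (∑ i, w i * u i) + b * (∑ i, w i * v i) = 0} := by
    ext x
    constructor
    · rintro ⟨hx, h0⟩
      obtain ⟨a, b, ha, hb, rfl⟩ := h.mem_iff.1 hx
      exact ⟨a, b, ha, hb, rfl, by rw [← key, h0]⟩
    · rintro ⟨a, b, ha, hb, rfl, h0⟩
      exact ⟨h.mem_iff.2 ⟨a, b, ha, hb, rfl⟩, by rw [key, h0]⟩
  rcases hu.eq_or_lt with hu | hu <;> rcases hv.eq_or_lt with hv | hv
  · right; right; right
    ext x
    refine ⟨fun hx => hx.1, fun hx => ?_⟩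
    rw [set_eq]
    obtain ⟨a, b, ha, hb, rfl⟩ := h.mem_iff.1 hx
    exact ⟨a, b, ha, hb, rfl, by rw [← hu, ← hv]; simp⟩
  · right; left
    rw [set_eq]
    ext x
    constructor
    · rintro ⟨a, b, ha, hb, rfl, h0⟩
      rw [← hu, mul_zero, zero_add] at h0
      have : b = 0 := by rcases mul_eq_zero.1 h0 with h | h; exacts [h, absurd h hv.ne']
      exact ⟨a, ha, by simp [this]⟩
    · rintro ⟨a, ha, rfl⟩
      exact ⟨a, 0, ha, le_rfl, by simp, by rw [← hu]; simp⟩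
  · right; right; left
    rw [set_eq]
    ext x
    constructor
    · rintro ⟨a, b, ha, hb, rfl, h0⟩
      rw [← hv, mul_zero, add_zero] at h0
      have : a = 0 := by rcases mul_eq_zero.1 h0 with h | h; exacts [h, absurd h hu.ne']
      exact ⟨b, hb, by simp [this]⟩
    · rintro ⟨a, ha, rfl⟩
      exact ⟨0, a, le_rfl, ha, by simp, by rw [← hv]; simp⟩
  · left
    rw [set_eq]
    ext x
    constructor
    · rintro ⟨a, b, ha, hb, rfl, h0⟩
      have h1 := mul_nonneg ha hu.le
      have h2 := mul_nonneg hb hv.le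
      have ha0 : a = 0 := by
        rcases mul_eq_zero.1 (by linarith : a * (∑ i, w i * u i) = 0) with h | h
        exacts [h, absurd h hu.ne']
      have hb0 : b = 0 := by
        rcases mul_eq_zero.1 (by linarith : b * (∑ i, w i * v i) = 0) with h | h
        exacts [h, absurd h hv.ne']
      simp [ha0, hb0]
    · rintro rfl
      exact ⟨0, 0, le_rfl, le_rfl, by simp, by simp⟩

/-- The functional `det(u, ·)` in coordinates. -/
theorem planeDet_eq_sum (u x : Plane) :
    planeDet u x = ∑ i, (![-u 1, u 0] : Plane) i * x i := by
  simp [planeDet, Fin.sum_univ_two]; ring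

theorem planeDet_eq_sum' (x v : Plane) :
    planeDet x v = ∑ i, (![v 1, -v 0] : Plane) i * x i := by
  simp [planeDet, Fin.sum_univ_two]; ring

namespace IsSector

variable {σ : Set Plane} {u v x : Plane}

theorem isFace_left (h : IsSector σ u v) : IsFace (ray u) σ := by
  refine ⟨![-u 1, u 0], fun x hx => ?_, ?_⟩
  · rw [← planeDet_eq_sum]; exact ((h.2 x).1 hx).1
  · ext x
    simp only [Set.mem_ofPred_eq, ← planeDet_eq_sum]
    constructor
    · rintro ⟨t, ht, rfl⟩
      exact ⟨h.mem_iff.2 ⟨t, 0, ht, le_rfl, by simp⟩, by simp [planeDet_smul_right]⟩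
    · rintro ⟨hx, h0⟩
      have := h.decomp x
      rw [h0, zero_div, zero_smul, add_zero] at this
      exact ⟨_, div_nonneg ((h.2 x).1 hx).2 h.1.le, this⟩

theorem isFace_right (h : IsSector σ u v) : IsFace (ray v) σ := by
  refine ⟨![v 1, -v 0], fun x hx => ?_, ?_⟩
  · rw [← planeDet_eq_sum']; exact ((h.2 x).1 hx).2
  · ext x
    simp only [Set.mem_ofPred_eq, ← planeDet_eq_sum']
    constructor
    · rintro ⟨t, ht, rfl⟩
      exact ⟨h.mem_iff.2 ⟨0, t, le_rfl, ht, by simp⟩, by simp [planeDet_smul_left]⟩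
    · rintro ⟨hx, h0⟩
      have := h.decomp x
      rw [h0, zero_div, zero_smul, zero_add] at this
      exact ⟨_, div_nonneg ((h.2 x).1 hx).1 h.1.le, this⟩

theorem isFace_zero (h : IsSector σ u v) : IsFace {0} σ := by
  have key : ∀ x, ∑ i, ((![-u 1, u 0] : Plane) + ![v 1, -v 0]) i * x i =
      planeDet u x + planeDet x v := by
    intro x
    rw [planeDet_eq_sum, planeDet_eq_sum', ← Finset.sum_add_distrib]
    simp [add_mul]
  refine ⟨![-u 1, u 0] + ![v 1, -v 0], fun x hx => ?_, ?_⟩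
  · rw [key]; exact add_nonneg ((h.2 x).1 hx).1 ((h.2 x).1 hx).2
  · ext x
    simp only [Set.mem_ofPred_eq, Set.mem_singleton_iff, key]
    constructor
    · rintro rfl; exact ⟨h.zero_mem, by simp⟩
    · rintro ⟨hx, h0⟩
      obtain ⟨h1, h2⟩ := (h.2 x).1 hx
      have h1' : planeDet u x = 0 := by linarith
      have h2' : planeDet x v = 0 := by linarith
      rw [h.decomp x, h1', h2']; simp

theorem ray_left_ne (h : IsSector σ u v) : ray u ≠ σ := fun he => by
  have := h.right_mem
  rw [← he] at this
  obtain ⟨t, -, rfl⟩ := this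
  simpa [planeDet_smul_right] using h.1

theorem ray_right_ne (h : IsSector σ u v) : ray v ≠ σ := fun he => by
  have := h.left_mem
  rw [← he] at this
  obtain ⟨t, -, rfl⟩ := this
  simpa [planeDet_smul_left] using h.1

theorem zero_ne (h : IsSector σ u v) : {0} ≠ σ := fun he => by
  have := h.left_mem
  rw [← he] at this
  exact h.left_ne_zero this

theorem mem_relInt (h : IsSector σ u v) :
    x ∈ relInt σ ↔ 0 < planeDet u x ∧ 0 < planeDet x v := by
  constructor
  · rintro ⟨hx, hf⟩
    obtain ⟨h1, h2⟩ := (h.2 x).1 hx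
    have hd := h.decomp x
    refine ⟨lt_of_le_of_ne h1 fun h0 => ?_, lt_of_le_of_ne h2 fun h0 => ?_⟩
    · rw [← h0, zero_div, zero_smul, add_zero] at hd
      exact h.ray_left_ne (hf _ h.isFace_left ⟨_, div_nonneg h2 h.1.le, hd⟩)
    · rw [← h0, zero_div, zero_smul, zero_add] at hd
      exact h.ray_right_ne (hf _ h.isFace_right ⟨_, div_nonneg h1 h.1.le, hd⟩)
  · rintro ⟨h1, h2⟩
    refine ⟨(h.2 x).2 ⟨h1.le, h2.le⟩, fun τ hτ hx => ?_⟩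
    rcases h.eq_of_isFace hτ with rfl | rfl | rfl | rfl
    · rw [Set.mem_singleton_iff.1 hx] at h1; simp at h1
    · obtain ⟨t, -, rfl⟩ := hx
      simp [planeDet_smul_right] at h1
    · obtain ⟨t, -, rfl⟩ := hx
      simp [planeDet_smul_left] at h2
    · rfl

theorem add_mem_relInt (h : IsSector σ u v) : u + v ∈ relInt σ := by
  rw [h.mem_relInt, planeDet_add_left, planeDet_add_right]
  simp [h.1]

end IsSector

theorem eq_of_isFace_ray {τ : Set Plane} {v : Plane} (hτ : IsFace τ (ray v)) :
    τ = {0} ∨ τ = ray v := by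
  obtain ⟨w, hw, rfl⟩ := hτ
  have key : ∀ a : ℝ, ∑ i, w i * (a • v) i = a * (∑ i, w i * v i) := by
    intro a; simp [Fin.sum_univ_two]; ring
  rcases (hw v (mem_ray_self v)).eq_or_lt with hv | hv
  · right
    ext x
    refine ⟨fun hx => hx.1, fun hx => ⟨hx, ?_⟩⟩
    obtain ⟨t, -, rfl⟩ := hx
    rw [key, ← hv, mul_zero]
  · left
    ext x
    constructor
    · rintro ⟨⟨t, ht, rfl⟩, h0⟩
      rw [key] at h0
      have : t = 0 := by rcases mul_eq_zero.1 h0 with h | h; exacts [h, absurd h hv.ne']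
      simp [this]
    · rintro rfl
      exact ⟨zero_mem_ray v, by simp⟩

theorem isFace_zero_ray (v : Plane) : IsFace {0} (ray v) := by
  refine ⟨v, ?_, ?_⟩
  · rintro x ⟨t, ht, rfl⟩
    rw [sum_mul_eq]
    simp only [Pi.smul_apply, smul_eq_mul]
    nlinarith [mul_nonneg ht (add_nonneg (sq_nonneg (v 0)) (sq_nonneg (v 1)))]
  · ext x
    constructor
    · rintro rfl
      exact ⟨zero_mem_ray v, by simp⟩
    · rintro ⟨⟨t, ht, rfl⟩, h0⟩
      rw [sum_mul_eq] at h0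
      simp only [Pi.smul_apply, smul_eq_mul] at h0
      have h1 : (t * v 0) ^ 2 + (t * v 1) ^ 2 = 0 := by linear_combination t * h0
      have h2 : t * v 0 = 0 := by nlinarith [sq_nonneg (t * v 0), sq_nonneg (t * v 1)]
      have h3 : t * v 1 = 0 := by nlinarith [sq_nonneg (t * v 0), sq_nonneg (t * v 1)]
      ext i; fin_cases i <;> simp [h2, h3]

theorem mem_relInt_ray {v x : Plane} (hv : v ≠ 0) :
    x ∈ relInt (ray v) ↔ ∃ t : ℝ, 0 < t ∧ x = t • v := by
  constructor
  · rintro ⟨⟨t, ht, rfl⟩, hf⟩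
    refine ⟨t, lt_of_le_of_ne ht ?_, rfl⟩
    rintro rfl
    have := hf _ (isFace_zero_ray v) (by simp)
    exact hv (by have h := mem_ray_self v; rw [← this] at h; exact h)
  · rintro ⟨t, ht, rfl⟩
    refine ⟨⟨t, ht.le, rfl⟩, fun τ hτ hx => ?_⟩
    rcases eq_of_isFace_ray hτ with rfl | h
    · exact absurd hx (by simp [ht.ne', hv])
    · exact h

theorem eq_of_isFace_zero {τ : Set Plane} (hτ : IsFace τ {0}) : τ = {0} := by
  obtain ⟨w, hw, rfl⟩ := hτ
  ext x
  refine ⟨fun hx => hx.1, ?_⟩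
  rintro rfl
  exact ⟨rfl, by simp⟩

theorem relInt_zero : relInt {(0 : Plane)} = {0} := by
  ext x
  exact ⟨fun h => h.1, fun h => ⟨h, fun τ hτ _ => eq_of_isFace_zero hτ⟩⟩

/-! ### Classification of the pointed rational cones in the plane -/

theorem coneDim_zero : coneDim {(0 : Plane)} = 0 := by
  simp [coneDim]

theorem coneDim_ray {v : Plane} (hv : v ≠ 0) : coneDim (ray v) = 1 := by
  have : Submodule.span ℝ (ray v) = Submodule.span ℝ {v} := by
    apply le_antisymm
    · rw [Submodule.span_le]
      rintro x ⟨t, -, rfl⟩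
      exact Submodule.smul_mem _ _ (Submodule.mem_span_singleton_self v)
    · rw [Submodule.span_singleton_le_iff_mem]
      exact Submodule.subset_span (mem_ray_self v)
  rw [coneDim, this, finrank_span_singleton hv]

theorem IsSector.coneDim {σ : Set Plane} {u v : Plane} (h : IsSector σ u v) : coneDim σ = 2 := by
  have : Submodule.span ℝ σ = ⊤ := by
    rw [eq_top_iff]
    intro x _
    rw [h.decomp x]
    exact Submodule.add_mem _ (Submodule.smul_mem _ _ (Submodule.subset_span h.left_mem))
      (Submodule.smul_mem _ _ (Submodule.subset_span h.right_mem))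
  rw [TropLag.coneDim, this, finrank_top]
  simp

section rational

variable {σ : Set Plane}

theorem IsRationalCone.add_mem (h : IsRationalCone σ) {x y : Plane} (hx : x ∈ σ) (hy : y ∈ σ) :
    x + y ∈ σ := by
  obtain ⟨S, rfl⟩ := h
  obtain ⟨a, ha, rfl⟩ := hx
  obtain ⟨b, hb, rfl⟩ := hy
  exact ⟨a + b, fun v => add_nonneg (ha v) (hb v), by simp [add_smul, Finset.sum_add_distrib]⟩

theorem IsRationalCone.smul_mem (h : IsRationalCone σ) {x : Plane} (hx : x ∈ σ) {c : ℝ}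
    (hc : 0 ≤ c) : c • x ∈ σ := by
  obtain ⟨S, rfl⟩ := h
  obtain ⟨a, ha, rfl⟩ := hx
  exact ⟨c • a, fun v => mul_nonneg hc (ha v), by simp [Finset.smul_sum, smul_smul]⟩

theorem IsRationalCone.exists_generators (h : IsRationalCone σ) :
    ∃ T : Finset Plane, (∀ w ∈ T, w ≠ 0 ∧ w ∈ σ) ∧
      ∀ x ∈ σ, ∃ a : Plane → ℝ, (∀ w, 0 ≤ a w) ∧ x = ∑ w ∈ T, a w • w := by
  classical
  obtain ⟨S, rfl⟩ := h
  set e : (Fin 2 → ℤ) → Plane := fun v i => (v i : ℝ) with he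
  have einj : Function.Injective e := by
    intro v w hvw
    ext i
    have := congrFun hvw i
    simpa [he] using this
  refine ⟨(S.image e).filter (· ≠ 0), ?_, ?_⟩
  · intro w hw
    rw [Finset.mem_filter, Finset.mem_image] at hw
    obtain ⟨⟨v, hv, rfl⟩, hne⟩ := hw
    refine ⟨hne, fun v' => if v' = v then 1 else 0, fun v' => by dsimp only; split_ifs <;> norm_num, ?_⟩
    simp [hv, he]
  · rintro x ⟨a, ha, rfl⟩
    refine ⟨fun w => a (Function.invFun e w), fun w => ha _, ?_⟩
    rw [Finset.sum_filter_of_ne (by rintro w - h rfl; simp at h),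
      Finset.sum_image (fun _ _ _ _ h => einj h)]
    refine Finset.sum_congr rfl fun v _ => ?_
    change a v • e v = a (Function.invFun e (e v)) • e v
    rw [Function.leftInverse_invFun einj v]

/-- In a pointed cone, the non-zero vectors are totally preordered by the sign of the
determinant. -/
theorem planeDet_nonneg_trans (hr : IsRationalCone σ) (hs : IsStrictlyConvexCone σ) {x y z : Plane}
    (hx : x ∈ σ) (hy : y ∈ σ) (hz : z ∈ σ) (hy0 : y ≠ 0) (hxy : 0 ≤ planeDet x y)
    (hyz : 0 ≤ planeDet y z) : 0 ≤ planeDet x z := by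
  by_contra! hlt
  have hzx : 0 < planeDet z x := by rw [planeDet_swap]; linarith
  have key := planeDet_cyclic x y z
  have hmem : planeDet y z • x + planeDet x y • z ∈ σ :=
    hr.add_mem (hr.smul_mem hx hyz) (hr.smul_mem hz hxy)
  have hneg : -(planeDet z x • y) ∈ σ := by
    have : -(planeDet z x • y) = planeDet y z • x + planeDet x y • z := by
      rw [neg_eq_iff_add_eq_zero, ← key]; abel
    rwa [this]
  have := hs _ (hr.smul_mem hy hzx.le) hneg
  rcases smul_eq_zero.1 this with h | h
  exacts [hzx.ne' h, hy0 h]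

theorem exists_det_min (hr : IsRationalCone σ) (hs : IsStrictlyConvexCone σ) (T : Finset Plane)
    (hT : ∀ w ∈ T, w ≠ 0 ∧ w ∈ σ) (hne : T.Nonempty) :
    ∃ u ∈ T, ∀ w ∈ T, 0 ≤ planeDet u w := by
  classical
  induction hne using Finset.Nonempty.cons_induction with
  | singleton a => exact ⟨a, by simp, by simp⟩
  | cons a s ha hs' ih =>
    obtain ⟨u, hu, hmin⟩ := ih fun w hw => hT w (by simp [hw])
    have hua := hT u (by simp [hu])
    have haa := hT a (by simp)
    rcases le_total 0 (planeDet u a) with h | h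
    · refine ⟨u, by simp [hu], fun w hw => ?_⟩
      rcases Finset.mem_cons.1 hw with rfl | hw
      exacts [h, hmin w hw]
    · refine ⟨a, by simp, fun w hw => ?_⟩
      have h' : 0 ≤ planeDet a u := by rw [planeDet_swap]; linarith
      rcases Finset.mem_cons.1 hw with rfl | hw
      · simp
      · exact planeDet_nonneg_trans hr hs haa.2 hua.2 (hT w (by simp [hw])).2 hua.1 h' (hmin w hw)

theorem exists_det_max (hr : IsRationalCone σ) (hs : IsStrictlyConvexCone σ) (T : Finset Plane)
    (hT : ∀ w ∈ T, w ≠ 0 ∧ w ∈ σ) (hne : T.Nonempty) :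
    ∃ u ∈ T, ∀ w ∈ T, 0 ≤ planeDet w u := by
  classical
  induction hne using Finset.Nonempty.cons_induction with
  | singleton a => exact ⟨a, by simp, by simp⟩
  | cons a s ha hs' ih =>
    obtain ⟨u, hu, hmax⟩ := ih fun w hw => hT w (by simp [hw])
    have hua := hT u (by simp [hu])
    have haa := hT a (by simp)
    rcases le_total 0 (planeDet a u) with h | h
    · refine ⟨u, by simp [hu], fun w hw => ?_⟩
      rcases Finset.mem_cons.1 hw with rfl | hw
      exacts [h, hmax w hw]
    · refine ⟨a, by simp, fun w hw => ?_⟩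
      have h' : 0 ≤ planeDet u a := by rw [planeDet_swap]; linarith
      rcases Finset.mem_cons.1 hw with rfl | hw
      · simp
      · exact planeDet_nonneg_trans hr hs (hT w (by simp [hw])).2 hua.2 haa.2 hua.1 (hmax w hw) h'

/-- A pointed rational cone in the plane is the origin, a ray or a sector: a sector is bounded by
the first and the last of its generators. -/
theorem cone_trichotomy (hr : IsRationalCone σ) (hs : IsStrictlyConvexCone σ) :
    σ = {0} ∨ (∃ v, v ≠ 0 ∧ σ = ray v) ∨ ∃ u v, IsSector σ u v := by
  obtain ⟨T, hT, hgen⟩ := hr.exists_generators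
  have h0 : (0 : Plane) ∈ σ := by
    obtain ⟨S, rfl⟩ := hr
    exact ⟨0, fun _ => le_rfl, by simp⟩
  rcases T.eq_empty_or_nonempty with rfl | hne
  · left
    refine Set.Subset.antisymm (fun x hx => ?_) (by simpa using h0)
    obtain ⟨a, -, rfl⟩ := hgen x hx
    simp
  right
  obtain ⟨u, hu, hmin⟩ := exists_det_min hr hs T hT hne
  obtain ⟨v, hv, hmax⟩ := exists_det_max hr hs T hT hne
  have hL : ∀ x ∈ σ, 0 ≤ planeDet u x ∧ 0 ≤ planeDet x v := by
    intro x hx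
    obtain ⟨a, ha, rfl⟩ := hgen x hx
    have e1 : planeDet u (∑ w ∈ T, a w • w) = ∑ w ∈ T, a w * planeDet u w := by
      simp only [planeDet, Finset.sum_apply, Pi.smul_apply, smul_eq_mul, Finset.mul_sum]
      rw [← Finset.sum_sub_distrib]
      exact Finset.sum_congr rfl fun w _ => by ring
    have e2 : planeDet (∑ w ∈ T, a w • w) v = ∑ w ∈ T, a w * planeDet w v := by
      simp only [planeDet, Finset.sum_apply, Pi.smul_apply, smul_eq_mul, Finset.sum_mul]
      rw [← Finset.sum_sub_distrib]
      exact Finset.sum_congr rfl fun w _ => by ring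
    rw [e1, e2]
    exact ⟨Finset.sum_nonneg fun w hw => mul_nonneg (ha w) (hmin w hw),
      Finset.sum_nonneg fun w hw => mul_nonneg (ha w) (hmax w hw)⟩
  have hu' := hT u hu
  have hv' := hT v hv
  rcases (hmin v hv).eq_or_lt with hd | hd
  · left
    obtain ⟨c, rfl⟩ := exists_smul_of_planeDet_eq_zero hu'.1 hd.symm
    refine ⟨u, hu'.1, Set.Subset.antisymm (fun x hx => ?_) ?_⟩
    · have hc : 0 < c := by
        by_contra! hc
        have hc0 : c ≠ 0 := by rintro rfl; exact hv'.1 (by simp)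
        have : -(c • u) ∈ σ := by
          rw [← neg_smul]; exact hr.smul_mem hu'.2 (by linarith)
        exact hv'.1 (hs _ hv'.2 this)
      obtain ⟨h1, h2⟩ := hL x hx
      rw [planeDet_smul_right, mul_nonneg_iff_of_pos_left hc, planeDet_swap] at h2
      obtain ⟨t, rfl⟩ := exists_smul_of_planeDet_eq_zero hu'.1 (by linarith : planeDet u x = 0)
      refine ⟨t, ?_, rfl⟩
      by_contra! ht
      have : -(t • u) ∈ σ := by
        rw [← neg_smul]; exact hr.smul_mem hu'.2 (by linarith)
      rcases smul_eq_zero.1 (hs _ hx this) with h | h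
      exacts [ht.ne h, hu'.1 h]
    · rintro x ⟨t, ht, rfl⟩
      exact hr.smul_mem hu'.2 ht
  · right
    refine ⟨u, v, hd, fun x => ⟨hL x, fun ⟨h1, h2⟩ => ?_⟩⟩
    have key : x = (planeDet x v / planeDet u v) • u + (planeDet u x / planeDet u v) • v :=
      IsSector.decomp (σ := {x | 0 ≤ planeDet u x ∧ 0 ≤ planeDet x v}) ⟨hd, fun _ => Iff.rfl⟩ x
    rw [key]
    exact hr.add_mem (hr.smul_mem hu'.2 (div_nonneg h2 hd.le))
      (hr.smul_mem hv'.2 (div_nonneg h1 hd.le))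

theorem exists_isFace_mem_relInt (hr : IsRationalCone σ) (hs : IsStrictlyConvexCone σ) {x : Plane}
    (hx : x ∈ σ) : ∃ τ, IsFace τ σ ∧ x ∈ relInt τ := by
  rcases cone_trichotomy hr hs with rfl | ⟨v, hv, rfl⟩ | ⟨u, v, h⟩
  · exact ⟨{0}, isFace_self _, by rwa [relInt_zero]⟩
  · by_cases h0 : x = 0
    · exact ⟨{0}, isFace_zero_ray v, by rwa [relInt_zero]⟩
    · refine ⟨ray v, isFace_self _, (mem_relInt_ray hv).2 ?_⟩
      obtain ⟨t, ht, rfl⟩ := hx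
      exact ⟨t, lt_of_le_of_ne ht (by rintro rfl; simp at h0), rfl⟩
  · obtain ⟨h1, h2⟩ := (h.2 x).1 hx
    have hd := h.decomp x
    rcases h1.eq_or_lt with h1' | h1' <;> rcases h2.eq_or_lt with h2' | h2'
    · refine ⟨{0}, h.isFace_zero, ?_⟩
      rw [← h1', ← h2'] at hd
      rw [relInt_zero, hd]; simp
    · rw [← h1', zero_div, zero_smul, add_zero] at hd
      exact ⟨_, h.isFace_left, (mem_relInt_ray h.left_ne_zero).2 ⟨_, div_pos h2' h.1, hd⟩⟩
    · rw [← h2', zero_div, zero_smul, zero_add] at hd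
      exact ⟨_, h.isFace_right, (mem_relInt_ray h.right_ne_zero).2 ⟨_, div_pos h1' h.1, hd⟩⟩
    · exact ⟨σ, isFace_self _, h.mem_relInt.2 ⟨h1', h2'⟩⟩

theorem relInt_nonempty (hr : IsRationalCone σ) (hs : IsStrictlyConvexCone σ) :
    (relInt σ).Nonempty := by
  rcases cone_trichotomy hr hs with rfl | ⟨v, hv, rfl⟩ | ⟨u, v, h⟩
  · exact ⟨0, by simp [relInt_zero]⟩
  · exact ⟨v, (mem_relInt_ray hv).2 ⟨1, one_pos, by simp⟩⟩
  · exact ⟨_, h.add_mem_relInt⟩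

theorem isClosed_cone (hr : IsRationalCone σ) (hs : IsStrictlyConvexCone σ) : IsClosed σ := by
  rcases cone_trichotomy hr hs with rfl | ⟨v, hv, rfl⟩ | ⟨u, v, h⟩
  · exact isClosed_singleton
  · have : ray v = {x | planeDet v x = 0 ∧ 0 ≤ ∑ i, v i * x i} := by
      have hv2 : 0 < v 0 * v 0 + v 1 * v 1 := by
        have := planeDet_quarterTurn_pos hv
        simpa [planeDet, quarterTurn] using this
      ext x
      constructor
      · rintro ⟨t, ht, rfl⟩
        refine ⟨by simp [planeDet_smul_right], ?_⟩
        rw [sum_mul_eq]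
        simp only [Pi.smul_apply, smul_eq_mul]
        nlinarith [mul_nonneg ht hv2.le]
      · rintro ⟨h1, h2⟩
        obtain ⟨t, rfl⟩ := exists_smul_of_planeDet_eq_zero hv h1
        refine ⟨t, ?_, rfl⟩
        rw [sum_mul_eq] at h2
        simp only [Pi.smul_apply, smul_eq_mul] at h2
        by_contra! ht
        nlinarith [mul_pos_of_neg_of_neg ht (neg_neg_of_pos hv2)]
    rw [this]
    exact (isClosed_eq (continuous_planeDet_right v) continuous_const).inter
      (isClosed_le continuous_const
        (continuous_finsetSum _ fun i _ => continuous_const.mul (continuous_apply i)))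
  · have : σ = {x | 0 ≤ planeDet u x} ∩ {x | 0 ≤ planeDet x v} := by
      ext x; exact h.2 x
    rw [this]
    exact (isClosed_le continuous_const (continuous_planeDet_right u)).inter
      (isClosed_le continuous_const (continuous_planeDet_left v))

end rational

end TropLag

namespace TropLag

open TropicalMultisection (planeDet)

/-! ### The cyclic order of the maximal cones of a complete fan -/

/-- `σ'` follows `σ` anti-clockwise: the last ray of `σ` is the first ray of `σ'`. -/
def Succeeds (σ σ' : Set Plane) : Prop :=
  ∃ u v w, IsSector σ u v ∧ IsSector σ' v w

theorem IsSector.left_unique {σ : Set Plane} {u v u' v' : Plane} (h : IsSector σ u v)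
    (h' : IsSector σ u' v') : ∃ c : ℝ, 0 < c ∧ u = c • u' := by
  have h1 := ((h.2 u').1 h'.left_mem).1
  have h2 := ((h'.2 u).1 h.left_mem).1
  rw [planeDet_swap] at h1
  obtain ⟨c, rfl⟩ := exists_smul_of_planeDet_eq_zero h'.left_ne_zero
    (by linarith : planeDet u' u = 0)
  refine ⟨c, ?_, rfl⟩
  have h3 := ((h'.2 _).1 h.left_mem).2
  rw [planeDet_smul_left, mul_nonneg_iff_of_pos_right h'.1] at h3
  exact lt_of_le_of_ne h3 (by rintro rfl; exact h.left_ne_zero (by simp))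

theorem IsSector.right_unique {σ : Set Plane} {u v u' v' : Plane} (h : IsSector σ u v)
    (h' : IsSector σ u' v') : ∃ c : ℝ, 0 < c ∧ v = c • v' := by
  have h1 := ((h.2 v').1 h'.right_mem).2
  have h2 := ((h'.2 v).1 h.right_mem).2
  rw [planeDet_swap] at h1
  obtain ⟨c, rfl⟩ := exists_smul_of_planeDet_eq_zero h'.right_ne_zero
    (by rw [planeDet_swap]; linarith : planeDet v' v = 0)
  refine ⟨c, ?_, rfl⟩
  have h3 := ((h'.2 _).1 h.right_mem).1
  rw [planeDet_smul_right, mul_nonneg_iff_of_pos_right h'.1] at h3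
  exact lt_of_le_of_ne h3 (by rintro rfl; exact h.right_ne_zero (by simp))

theorem Succeeds.exists_right {σ σ' : Set Plane} {u v : Plane} (h : Succeeds σ σ')
    (hσ : IsSector σ u v) : ∃ w, IsSector σ' v w := by
  obtain ⟨u', v', w, h1, h2⟩ := h
  obtain ⟨c, hc, rfl⟩ := hσ.right_unique h1
  exact ⟨w, h2.smul_left hc⟩

theorem Succeeds.exists_left {σ σ' : Set Plane} {v w : Plane} (h : Succeeds σ σ')
    (hσ : IsSector σ' v w) : ∃ u, IsSector σ u v := by
  obtain ⟨u, v', w, h1, h2⟩ := h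
  obtain ⟨c, hc, rfl⟩ := hσ.left_unique h2
  exact ⟨u, h1.smul_right hc⟩

namespace CompleteFan

variable (F : CompleteFan)

theorem isFace_of_mem_relInt {σ₁ σ₂ : Set Plane} (h₁ : σ₁ ∈ F.cones) (h₂ : σ₂ ∈ F.cones)
    {x : Plane} (hx₁ : x ∈ relInt σ₁) (hx₂ : x ∈ σ₂) : IsFace σ₁ σ₂ := by
  have e := hx₁.2 _ (F.inter_face σ₁ h₁ σ₂ h₂) ⟨hx₁.1, hx₂⟩
  have := F.inter_face σ₂ h₂ σ₁ h₁
  rwa [Set.inter_comm, e] at this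

theorem eq_of_mem_relInt {σ₁ σ₂ : Set Plane} (h₁ : σ₁ ∈ F.cones) (h₂ : σ₂ ∈ F.cones)
    {x : Plane} (hx₁ : x ∈ relInt σ₁) (hx₂ : x ∈ relInt σ₂) : σ₁ = σ₂ :=
  hx₂.2 _ (F.isFace_of_mem_relInt h₁ h₂ hx₁ hx₂.1) hx₁.1

theorem exists_mem_relInt (p : Plane) : ∃ σ ∈ F.cones, p ∈ relInt σ := by
  have : p ∈ ⋃₀ F.cones := by rw [F.complete]; trivial
  obtain ⟨σ, hσ, hp⟩ := this
  obtain ⟨τ, hτ, hpτ⟩ := exists_isFace_mem_relInt (F.rational σ hσ) (F.strictlyConvex σ hσ) hp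
  exact ⟨τ, F.face_mem σ hσ τ hτ, hpτ⟩

theorem relInt_nonempty {σ : Set Plane} (hσ : σ ∈ F.cones) : (relInt σ).Nonempty :=
  TropLag.relInt_nonempty (F.rational σ hσ) (F.strictlyConvex σ hσ)

theorem isClosed {σ : Set Plane} (hσ : σ ∈ F.cones) : IsClosed σ :=
  isClosed_cone (F.rational σ hσ) (F.strictlyConvex σ hσ)

theorem trichotomy {σ : Set Plane} (hσ : σ ∈ F.cones) :
    σ = {0} ∨ (∃ v, v ≠ 0 ∧ σ = ray v) ∨ ∃ u v, IsSector σ u v :=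
  cone_trichotomy (F.rational σ hσ) (F.strictlyConvex σ hσ)

theorem zero_mem {σ : Set Plane} (hσ : σ ∈ F.cones) : 0 ∈ σ := by
  rcases F.trichotomy hσ with rfl | ⟨v, -, rfl⟩ | ⟨u, v, h⟩
  exacts [rfl, zero_mem_ray v, h.zero_mem]

theorem exists_sector {σ : Set Plane} (hσ : σ ∈ F.dimCones 2) : ∃ u v, IsSector σ u v := by
  rcases F.trichotomy hσ.1 with rfl | ⟨v, hv, rfl⟩ | h
  · have := hσ.2; rw [coneDim_zero] at this; omega
  · have := hσ.2; rw [coneDim_ray hv] at this; omega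
  · exact h

theorem exists_ray {τ : Set Plane} (hτ : τ ∈ F.dimCones 1) : ∃ v, v ≠ 0 ∧ τ = ray v := by
  rcases F.trichotomy hτ.1 with rfl | h | ⟨u, v, h⟩
  · have := hτ.2; rw [coneDim_zero] at this; omega
  · exact h
  · have := hτ.2; rw [h.coneDim] at this; omega

/-- A small neighborhood of a point meets only the cones that contain it. -/
theorem exists_ball (p : Plane) :
    ∃ ε > 0, ∀ σ ∈ F.cones, ∀ x ∈ Metric.ball p ε, x ∈ σ → p ∈ σ := by
  have hcl : IsClosed (⋃ σ ∈ {σ | σ ∈ F.cones ∧ p ∉ σ}, σ) :=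
    Set.Finite.isClosed_biUnion (F.finite.subset fun σ h => h.1) fun σ h => F.isClosed h.1
  have hp : p ∈ (⋃ σ ∈ {σ | σ ∈ F.cones ∧ p ∉ σ}, σ)ᶜ := by
    simp only [Set.mem_compl_iff, Set.mem_iUnion, not_exists]
    exact fun σ h hx => h.2 hx
  obtain ⟨ε, hε, hb⟩ := Metric.isOpen_iff.1 hcl.isOpen_compl p hp
  refine ⟨ε, hε, fun σ hσ x hx hxσ => ?_⟩
  by_contra hpσ
  exact hb hx (Set.mem_biUnion (show σ ∈ {σ | σ ∈ F.cones ∧ p ∉ σ} from ⟨hσ, hpσ⟩) hxσ)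

/-- The sector into which one gets by turning anti-clockwise from the direction `v`. -/
theorem exists_sector_turn {v : Plane} (hv : v ≠ 0) : ∃ σ ∈ F.cones, ∃ u w, IsSector σ u w ∧
    v ∈ σ ∧ ∃ ε : ℝ, 0 < ε ∧ v + ε • quarterTurn v ∈ σ := by
  obtain ⟨r, hr, hball⟩ := F.exists_ball v
  have hlim : Filter.Tendsto (fun ε : ℝ => v + ε • quarterTurn v) (nhds 0) (nhds v) := by
    have : Continuous fun ε : ℝ => v + ε • quarterTurn v := by fun_prop
    simpa using this.tendsto 0
  obtain ⟨δ, hδ, hδb⟩ := Metric.mem_nhds_iff.1 (hlim (Metric.ball_mem_nhds v hr))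
  have hε : δ / 2 ∈ Metric.ball (0 : ℝ) δ := by
    rw [Metric.mem_ball, dist_zero_right, Real.norm_eq_abs, abs_of_pos (by linarith)]; linarith
  have hmem := hδb hε
  set p := v + (δ / 2) • quarterTurn v with hp
  have : p ∈ ⋃₀ F.cones := by rw [F.complete]; trivial
  obtain ⟨σ, hσ, hpσ⟩ := this
  have hvσ := hball σ hσ p hmem hpσ
  refine ⟨σ, hσ, ?_⟩
  have hdet : 0 < planeDet v p := by
    rw [hp, planeDet_add_right, planeDet_smul_right, planeDet_self]
    have := planeDet_quarterTurn_pos hv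
    positivity
  rcases F.trichotomy hσ with rfl | ⟨w, hw, rfl⟩ | ⟨u, w, h⟩
  · exact absurd hvσ hv
  · obtain ⟨s, -, hs⟩ := hvσ
    obtain ⟨t, -, ht⟩ := hpσ
    rw [ht, hs] at hdet
    simp [planeDet_smul_left, planeDet_smul_right] at hdet
  · exact ⟨u, w, h, hvσ, δ / 2, by linarith, hpσ⟩

theorem eq_of_mem_relInt_sector {σ σ' : Set Plane} {u v x : Plane} (hσ : σ ∈ F.cones)
    (hσ' : σ' ∈ F.cones) (h : IsSector σ u v) (hx : x ∈ relInt σ) (hx' : x ∈ σ') : σ = σ' := by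
  have hf := F.isFace_of_mem_relInt hσ hσ' hx hx'
  rcases F.trichotomy hσ' with rfl | ⟨w, -, rfl⟩ | ⟨u', v', h'⟩
  · exact eq_of_isFace_zero hf
  · rcases eq_of_isFace_ray hf with rfl | h
    · exact absurd rfl h.zero_ne
    · exact h
  · have hd := h.coneDim
    rcases h'.eq_of_isFace hf with rfl | rfl | rfl | h
    · rw [coneDim_zero] at hd; omega
    · rw [coneDim_ray h'.left_ne_zero] at hd; omega
    · rw [coneDim_ray h'.right_ne_zero] at hd; omega
    · exact h

theorem sector_left_injective {σ σ' : Set Plane} {v w w' : Plane} (hσ : σ ∈ F.cones)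
    (hσ' : σ' ∈ F.cones) (h : IsSector σ v w) (h' : IsSector σ' v w') : σ = σ' := by
  rcases le_total 0 (planeDet w w') with hd | hd
  · refine F.eq_of_mem_relInt_sector hσ hσ' h h.add_mem_relInt ((h'.2 _).2 ?_)
    rw [planeDet_add_left, planeDet_add_right, planeDet_self, zero_add]
    exact ⟨h.1.le, add_nonneg h'.1.le hd⟩
  · refine (F.eq_of_mem_relInt_sector hσ' hσ h' h'.add_mem_relInt ((h.2 _).2 ?_)).symm
    rw [planeDet_add_left, planeDet_add_right, planeDet_self, zero_add, planeDet_swap w w']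
    exact ⟨h'.1.le, add_nonneg h.1.le (by linarith)⟩

theorem sector_right_injective {σ σ' : Set Plane} {u u' v : Plane} (hσ : σ ∈ F.cones)
    (hσ' : σ' ∈ F.cones) (h : IsSector σ u v) (h' : IsSector σ' u' v) : σ = σ' := by
  rcases le_total 0 (planeDet u' u) with hd | hd
  · refine F.eq_of_mem_relInt_sector hσ hσ' h h.add_mem_relInt ((h'.2 _).2 ?_)
    rw [planeDet_add_left, planeDet_add_right, planeDet_self, add_zero]
    exact ⟨add_nonneg hd h'.1.le, h.1.le⟩
  · refine (F.eq_of_mem_relInt_sector hσ' hσ h' h'.add_mem_relInt ((h.2 _).2 ?_)).symm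
    rw [planeDet_add_left, planeDet_add_right, planeDet_self, add_zero, planeDet_swap u' u]
    exact ⟨add_nonneg (by linarith) h.1.le, h'.1.le⟩

theorem succeeds_right_unique {σ σ₁ σ₂ : Set Plane} (h₁ : σ₁ ∈ F.cones) (h₂ : σ₂ ∈ F.cones)
    (hs₁ : Succeeds σ σ₁) (hs₂ : Succeeds σ σ₂) : σ₁ = σ₂ := by
  obtain ⟨u, v, w, h, hw⟩ := hs₁
  obtain ⟨w', hw'⟩ := hs₂.exists_right h
  exact F.sector_left_injective h₁ h₂ hw hw'

theorem succeeds_left_unique {σ σ₁ σ₂ : Set Plane} (h₁ : σ₁ ∈ F.cones) (h₂ : σ₂ ∈ F.cones)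
    (hs₁ : Succeeds σ₁ σ) (hs₂ : Succeeds σ₂ σ) : σ₁ = σ₂ := by
  obtain ⟨u, v, w, hu, h⟩ := hs₁
  obtain ⟨u', hu'⟩ := hs₂.exists_left h
  exact F.sector_right_injective h₁ h₂ hu hu'

theorem inter_eq_ray {σ σ' : Set Plane} {u v w : Plane} (hσ : σ ∈ F.cones) (hσ' : σ' ∈ F.cones)
    (h : IsSector σ u v) (h' : IsSector σ' v w) : σ ∩ σ' = ray v := by
  have hv : v ∈ σ ∩ σ' := ⟨h.right_mem, h'.left_mem⟩
  have hu : u ∉ σ' := fun hu => by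
    have h1 := ((h'.2 u).1 hu).1
    have h2 := h.1
    rw [planeDet_swap] at h1
    linarith
  rcases h.eq_of_isFace (F.inter_face σ hσ σ' hσ') with he | he | he | he
  · rw [he] at hv; exact absurd hv h.right_ne_zero
  · have := mem_ray_self u
    rw [← he] at this
    exact absurd this.2 hu
  · exact he
  · have := h.left_mem
    rw [← he] at this
    exact absurd this.2 hu

theorem exists_succeeds {σ : Set Plane} (hσ : σ ∈ F.dimCones 2) :
    ∃ σ' ∈ F.dimCones 2, Succeeds σ σ' := by
  obtain ⟨u, v, h⟩ := F.exists_sector hσ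
  obtain ⟨σ', hσ', u', w, h', hv, ε, hε, hp⟩ := F.exists_sector_turn h.right_ne_zero
  refine ⟨σ', ⟨hσ', h'.coneDim⟩, u, v, w, h, ?_⟩
  set p := v + ε • quarterTurn v with hpdef
  have hdet : 0 < planeDet v p := by
    rw [hpdef, planeDet_add_right, planeDet_smul_right, planeDet_self]
    have := planeDet_quarterTurn_pos h.right_ne_zero
    positivity
  have hpσ : p ∉ σ := fun hpσ => by
    have := ((h.2 p).1 hpσ).2
    rw [planeDet_swap] at this
    linarith
  have hvm : v ∈ σ' ∩ σ := ⟨hv, h.right_mem⟩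
  rcases h'.eq_of_isFace (F.inter_face σ' hσ' σ hσ.1) with he | he | he | he
  · rw [he] at hvm; exact absurd hvm h.right_ne_zero
  · rw [he] at hvm
    obtain ⟨c, hc, rfl⟩ := hvm
    exact h'.smul_left (lt_of_le_of_ne hc
      (by rintro rfl; exact h.right_ne_zero (by simp)))
  · rw [he] at hvm
    obtain ⟨c, hc, rfl⟩ := hvm
    have h1 := ((h'.2 p).1 hp).2
    rw [planeDet_swap] at h1
    rw [planeDet_smul_left] at hdet
    nlinarith [mul_nonneg hc h1]
  · rw [← he] at hp
    exact absurd hp.2 hpσ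

theorem dimCones_two_nonempty : (F.dimCones 2).Nonempty := by
  obtain ⟨σ, hσ, u, w, h, -⟩ := F.exists_sector_turn (v := fun _ => 1)
    (fun h => one_ne_zero (congrFun h 0))
  exact ⟨σ, hσ, h.coneDim⟩

theorem exists_dimCones_two_superset {σ : Set Plane} (hσ : σ ∈ F.cones) :
    ∃ σ' ∈ F.dimCones 2, σ ⊆ σ' := by
  obtain ⟨p, hp⟩ := F.relInt_nonempty hσ
  by_cases h0 : p = 0
  · obtain ⟨σ', hσ'⟩ := F.dimCones_two_nonempty
    exact ⟨σ', hσ', (F.isFace_of_mem_relInt hσ hσ'.1 hp (h0 ▸ F.zero_mem hσ'.1)).subset⟩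
  · obtain ⟨σ', hσ', u, w, h, hpσ, -⟩ := F.exists_sector_turn h0
    exact ⟨σ', ⟨hσ', h.coneDim⟩, (F.isFace_of_mem_relInt hσ hσ' hp hpσ).subset⟩

/-- A union of maximal cones that contains with each cone its two neighbors is the whole plane:
away from the origin it is open and closed. -/
theorem mem_of_succeeds_closed {C : Set (Set Plane)} (hC : C ⊆ F.dimCones 2) (hne : C.Nonempty)
    (hsucc : ∀ σ ∈ C, ∃ σ' ∈ C, Succeeds σ σ') (hpred : ∀ σ ∈ C, ∃ σ' ∈ C, Succeeds σ' σ)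
    {σ : Set Plane} (hσ : σ ∈ F.dimCones 2) : σ ∈ C := by
  set A : Set Plane := ⋃ σ ∈ C, σ with hA
  have hAcl : IsClosed A :=
    Set.Finite.isClosed_biUnion (F.finite.subset fun σ h => (hC h).1) fun σ h => F.isClosed (hC h).1
  have mem_of : ∀ τ ∈ C, τ ⊆ A := fun τ hτ => Set.subset_biUnion_of_mem (u := id) hτ
  -- two consecutive sectors contain a neighborhood of their common ray
  have hglue : ∀ (τ τ' : Set Plane) (u v w : Plane) (t : ℝ), τ ∈ C → τ' ∈ C → IsSector τ u v →
      IsSector τ' v w → 0 < t → t • v ∈ interior A := by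
    intro τ τ' u v w t hτ hτ' h h' ht
    rw [mem_interior_iff_mem_nhds]
    have h1 : 0 < planeDet u (t • v) := by rw [planeDet_smul_right]; exact mul_pos ht h.1
    have h2 : 0 < planeDet (t • v) w := by rw [planeDet_smul_left]; exact mul_pos ht h'.1
    filter_upwards [(isOpen_lt continuous_const (continuous_planeDet_right u)).mem_nhds h1,
      (isOpen_lt continuous_const (continuous_planeDet_left w)).mem_nhds h2] with y hy1 hy2
    change 0 < planeDet u y at hy1
    change 0 < planeDet y w at hy2
    rcases le_total 0 (planeDet v y) with hy | hy
    · exact mem_of τ' hτ' ((h'.2 y).2 ⟨hy, hy2.le⟩)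
    · exact mem_of τ hτ ((h.2 y).2 ⟨hy1.le, by rw [planeDet_swap]; linarith⟩)
  have hint : ∀ x ∈ A, x ≠ 0 → x ∈ interior A := by
    intro x hx hx0
    obtain ⟨τ, hτ, hxτ⟩ := Set.mem_iUnion₂.1 hx
    obtain ⟨u, v, h⟩ := F.exists_sector (hC hτ)
    obtain ⟨h1, h2⟩ := (h.2 x).1 hxτ
    have hd := h.decomp x
    rcases h1.eq_or_lt with h1' | h1'
    · rw [← h1', zero_div, zero_smul, add_zero] at hd
      obtain ⟨τ', hτ', hs⟩ := hpred τ hτ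
      obtain ⟨t, ht⟩ := hs.exists_left h
      have hpos : 0 < planeDet x v / planeDet u v :=
        lt_of_le_of_ne (div_nonneg h2 h.1.le) fun h0 => hx0 (by rw [hd, ← h0, zero_smul])
      rw [hd]
      exact hglue τ' τ t u v _ hτ' hτ ht h hpos
    rcases h2.eq_or_lt with h2' | h2'
    · rw [← h2', zero_div, zero_smul, zero_add] at hd
      obtain ⟨τ', hτ', hs⟩ := hsucc τ hτ
      obtain ⟨t, ht⟩ := hs.exists_right h
      have hpos : 0 < planeDet u x / planeDet u v :=
        lt_of_le_of_ne (div_nonneg h1 h.1.le) fun h0 => hx0 (by rw [hd, ← h0, zero_smul])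
      rw [hd]
      exact hglue τ τ' u v t _ hτ hτ' h ht hpos
    · rw [mem_interior_iff_mem_nhds]
      filter_upwards [(isOpen_lt continuous_const (continuous_planeDet_right u)).mem_nhds h1',
        (isOpen_lt continuous_const (continuous_planeDet_left v)).mem_nhds h2'] with y hy1 hy2
      exact mem_of τ hτ ((h.2 y).2 ⟨le_of_lt hy1, le_of_lt hy2⟩)
  have hconn : IsPreconnected ({0}ᶜ : Set Plane) :=
    (isConnected_compl_singleton_of_one_lt_rank (by simp) 0).isPreconnected
  have hcover : ({0}ᶜ : Set Plane) ⊆ interior A := by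
    refine hconn.subset_left_of_subset_union isOpen_interior hAcl.isOpen_compl ?_ ?_ ?_
    · exact Set.disjoint_left.2 fun x hx hx' => hx' (interior_subset hx)
    · intro x hx
      by_cases hxA : x ∈ A
      · exact Or.inl (hint x hxA hx)
      · exact Or.inr hxA
    · obtain ⟨τ, hτ⟩ := hne
      obtain ⟨u, v, h⟩ := F.exists_sector (hC hτ)
      exact ⟨u, h.left_ne_zero, hint u (mem_of τ hτ h.left_mem) h.left_ne_zero⟩
  obtain ⟨u, v, h⟩ := F.exists_sector hσ
  have hx := h.add_mem_relInt
  have hx0 : u + v ≠ 0 := fun h0 => by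
    have := (h.mem_relInt.1 hx).1
    rw [h0] at this
    simp at this
  obtain ⟨τ, hτ, hxτ⟩ := Set.mem_iUnion₂.1 (interior_subset (hcover hx0))
  rwa [F.eq_of_mem_relInt_sector hσ.1 (hC hτ).1 h hx hxτ]

/-- The maximal cones of a complete fan in the plane form a single cycle. -/
theorem exists_cyclic_order : ∃ (k : ℕ) (S : ℕ → Set Plane), 0 < k ∧ (∀ i, S (i + k) = S i) ∧
    (∀ i, S i ∈ F.dimCones 2) ∧ (∀ i, Succeeds (S i) (S (i + 1))) ∧
    Set.InjOn S (Set.Iio k) ∧ ∀ σ ∈ F.dimCones 2, ∃ i < k, S i = σ := by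
  choose! nx hnx hs using fun σ (hσ : σ ∈ F.dimCones 2) => F.exists_succeeds hσ
  have : Finite (F.dimCones 2) := F.finite.subset fun σ h => h.1
  let f : F.dimCones 2 → F.dimCones 2 := fun σ => ⟨nx σ, hnx σ σ.2⟩
  have hf : Function.Injective f := by
    intro σ τ h
    have h' : nx σ = nx τ := congrArg Subtype.val h
    refine Subtype.ext (F.succeeds_left_unique σ.2.1 τ.2.1 (hs σ σ.2) ?_)
    rw [h']; exact hs τ τ.2
  obtain ⟨σ₀, hσ₀⟩ := F.dimCones_two_nonempty
  set s₀ : F.dimCones 2 := ⟨σ₀, hσ₀⟩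
  have hper : s₀ ∈ Function.periodicPts f := hf.mem_periodicPts s₀
  set k := Function.minimalPeriod f s₀ with hk
  have hkpos : 0 < k := Function.minimalPeriod_pos_of_mem_periodicPts hper
  have hit : ∀ i, f^[i + k] s₀ = f^[i] s₀ := fun i => by
    rw [Function.iterate_add_apply, hk, Function.iterate_minimalPeriod]
  have hinj : Set.InjOn (fun i => ((f^[i] s₀ : F.dimCones 2) : Set Plane)) (Set.Iio k) :=
    fun i hi j hj hij => Function.iterate_injOn_Iio_minimalPeriod hi hj (Subtype.ext hij)
  refine ⟨k, fun i => f^[i] s₀, hkpos, fun i => by simp only [hit], fun i => (f^[i] s₀).2,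
    fun i => ?_, hinj, ?_⟩
  · dsimp only
    rw [Function.iterate_succ_apply']
    exact hs _ (f^[i] s₀).2
  · have hsucc : ∀ i, Succeeds (f^[i] s₀ : F.dimCones 2) (f^[i + 1] s₀ : F.dimCones 2) := by
      intro i
      rw [Function.iterate_succ_apply']
      exact hs _ (f^[i] s₀).2
    intro σ hσ
    have hmem : σ ∈ Set.range fun i => ((f^[i] s₀ : F.dimCones 2) : Set Plane) := by
      refine F.mem_of_succeeds_closed (C := Set.range fun i =>
        ((f^[i] s₀ : F.dimCones 2) : Set Plane)) ?_ ⟨_, 0, rfl⟩ ?_ ?_ hσ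
      · rintro _ ⟨i, rfl⟩; exact (f^[i] s₀).2
      · rintro _ ⟨i, rfl⟩; exact ⟨(f^[i + 1] s₀ : F.dimCones 2), ⟨i + 1, rfl⟩, hsucc i⟩
      · rintro _ ⟨i, rfl⟩
        refine ⟨(f^[i + k - 1] s₀ : F.dimCones 2), ⟨i + k - 1, rfl⟩, ?_⟩
        have := hsucc (i + k - 1)
        rwa [show i + k - 1 + 1 = i + k by omega, hit] at this
    obtain ⟨i, rfl⟩ := hmem
    refine ⟨i % k, Nat.mod_lt _ hkpos, ?_⟩
    simp only [hk, Function.iterate_mod_minimalPeriod_eq]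

/-- Two maximal cones that meet away from the origin are equal or consecutive. -/
theorem eq_or_succeeds {σ σ' : Set Plane} (hσ : σ ∈ F.dimCones 2) (hσ' : σ' ∈ F.dimCones 2)
    {p : Plane} (hp0 : p ≠ 0) (hp : p ∈ σ) (hp' : p ∈ σ') :
    σ = σ' ∨ Succeeds σ σ' ∨ Succeeds σ' σ := by
  obtain ⟨u, v, h⟩ := F.exists_sector hσ
  obtain ⟨u', v', h'⟩ := F.exists_sector hσ'
  obtain ⟨τ, hτ, hpτ⟩ := F.exists_mem_relInt p
  have hpos : ∀ {w w' : Plane}, w ≠ 0 → ray w' = ray w → ∃ c : ℝ, 0 < c ∧ w = c • w' := by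
    intro w w' hw e
    have := mem_ray_self w
    rw [← e] at this
    obtain ⟨c, hc, rfl⟩ := this
    exact ⟨c, lt_of_le_of_ne hc (by rintro rfl; simp at hw), rfl⟩
  have h0 : τ ≠ {0} := by
    rintro rfl; exact hp0 hpτ.1
  rcases h.eq_of_isFace (F.isFace_of_mem_relInt hτ hσ.1 hpτ hp) with e | e | e | e
  · exact absurd e h0
  · rcases h'.eq_of_isFace (F.isFace_of_mem_relInt hτ hσ'.1 hpτ hp') with e' | e' | e' | e'
    · exact absurd e' h0
    · obtain ⟨c, hc, rfl⟩ := hpos h'.left_ne_zero (e.symm.trans e')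
      exact Or.inl (F.sector_left_injective hσ.1 hσ'.1 (h.smul_left hc) h')
    · obtain ⟨c, hc, rfl⟩ := hpos h'.right_ne_zero (e.symm.trans e')
      exact Or.inr (Or.inr ⟨u', _, v, h', h.smul_left hc⟩)
    · subst e'
      exact Or.inl (F.eq_of_mem_relInt_sector hσ'.1 hσ.1 h' hpτ hp).symm
  · rcases h'.eq_of_isFace (F.isFace_of_mem_relInt hτ hσ'.1 hpτ hp') with e' | e' | e' | e'
    · exact absurd e' h0
    · obtain ⟨c, hc, rfl⟩ := hpos h'.left_ne_zero (e.symm.trans e')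
      exact Or.inr (Or.inl ⟨u, _, v', h.smul_right hc, h'⟩)
    · obtain ⟨c, hc, rfl⟩ := hpos h'.right_ne_zero (e.symm.trans e')
      exact Or.inl (F.sector_right_injective hσ.1 hσ'.1 (h.smul_right hc) h')
    · subst e'
      exact Or.inl (F.eq_of_mem_relInt_sector hσ'.1 hσ.1 h' hpτ hp).symm
  · subst e
    exact Or.inl (F.eq_of_mem_relInt_sector hσ.1 hσ'.1 h hpτ hp')

theorem succeeds_of_inter_mem {σ σ' : Set Plane} (hσ : σ ∈ F.dimCones 2) (hσ' : σ' ∈ F.dimCones 2)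
    (hi : σ ∩ σ' ∈ F.dimCones 1) : Succeeds σ σ' ∨ Succeeds σ' σ := by
  obtain ⟨p, hp, e⟩ := F.exists_ray hi
  have hpm : p ∈ σ ∩ σ' := by rw [e]; exact mem_ray_self p
  rcases F.eq_or_succeeds hσ hσ' hp hpm.1 hpm.2 with rfl | h
  · have h1 := hi.2
    rw [Set.inter_self, hσ.2] at h1
    omega
  · exact h

end CompleteFan

end TropLag

namespace TropLag

namespace TropicalMultisection

variable {F : CompleteFan} (L : TropicalMultisection.{u} F)

/-! ### Cones and lifts in a multi-section -/

theorem injOn_proj {σ' : Set L.X} (h : σ' ∈ L.cones) : Set.InjOn L.proj σ' := by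
  intro x hx y hy hxy
  have := (L.isEmbedding_proj σ' h).injective (a₁ := ⟨x, hx⟩) (a₂ := ⟨y, hy⟩) hxy
  exact congrArg Subtype.val this

/-- The cone of `L` that contains `x` in its relative interior. -/
def carrier (x : L.X) : Set L.X := (L.partition x).choose

theorem carrier_mem (x : L.X) : L.carrier x ∈ L.cones := (L.partition x).choose_spec.1.1

theorem mem_carrier (x : L.X) : x ∈ L.carrier x := (L.partition x).choose_spec.1.2.1

theorem proj_mem_relInt_carrier (x : L.X) : L.proj x ∈ relInt (L.proj '' L.carrier x) :=
  (L.partition x).choose_spec.1.2.2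

theorem eq_carrier {x : L.X} {σ' : Set L.X} (h : σ' ∈ L.cones) (hx : x ∈ σ')
    (hr : L.proj x ∈ relInt (L.proj '' σ')) : σ' = L.carrier x :=
  (L.partition x).choose_spec.2 σ' ⟨h, hx, hr⟩

theorem carrier_subset {x : L.X} {σ' : Set L.X} (h : σ' ∈ L.cones) (hx : x ∈ σ') :
    L.carrier x ⊆ σ' := by
  have hF := L.proj_mem σ' h
  obtain ⟨τ, hτ, hxτ⟩ := exists_isFace_mem_relInt (F.rational _ hF) (F.strictlyConvex _ hF)
    (Set.mem_image_of_mem L.proj hx)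
  have him : L.proj '' (σ' ∩ L.proj ⁻¹' τ) = τ := by
    rw [Set.image_inter_preimage]; exact Set.inter_eq_right.2 hτ.subset
  have := L.eq_carrier (L.face_mem σ' h τ hτ) ⟨hx, hxτ.1⟩ (by rwa [him])
  rw [← this]
  exact Set.inter_subset_left

theorem proj_carrier_of_mem_relInt {x : L.X} {σ : Set Plane} (hσ : σ ∈ F.cones)
    (hx : L.proj x ∈ relInt σ) : L.proj '' L.carrier x = σ :=
  F.eq_of_mem_relInt (L.proj_mem _ (L.carrier_mem x)) hσ (L.proj_mem_relInt_carrier x) hx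

theorem exists_lift {σ : Set Plane} (hσ : σ ∈ F.cones) : ∃ σ' ∈ L.cones, L.proj '' σ' = σ := by
  obtain ⟨p, hp⟩ := F.relInt_nonempty hσ
  obtain ⟨x, rfl⟩ := L.surjective_proj p
  exact ⟨_, L.carrier_mem x, L.proj_carrier_of_mem_relInt hσ hp⟩

theorem finite_fiber (p : Plane) : (L.proj ⁻¹' {p}).Finite := by
  refine Set.Finite.of_finite_image (f := L.carrier) (L.finite.subset ?_) ?_
  · rintro _ ⟨x, -, rfl⟩
    exact L.carrier_mem x
  · intro x hx y hy hxy
    refine L.injOn_proj (L.carrier_mem x) (L.mem_carrier x) ?_ (hx.trans hy.symm)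
    rw [hxy]; exact L.mem_carrier y

theorem sum_weight_le {p : Plane} (T : Finset L.X) (hT : ∀ x ∈ T, L.proj x = p) :
    ∑ x ∈ T, L.weight x ≤ L.rank := by
  classical
  rw [← L.trace_eq_rank p, finsum_mem_eq_finite_toFinset_sum _ (L.finite_fiber p)]
  refine Finset.sum_le_sum_of_subset fun x hx => ?_
  rw [Set.Finite.mem_toFinset]
  exact hT x hx

theorem eq_of_fiber (hrank : L.rank = 2) {x y z : L.X} (hxy : x ≠ y) (hy : L.proj y = L.proj x)
    (hz : L.proj z = L.proj x) : z = x ∨ z = y := by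
  classical
  by_contra! hne
  have := L.sum_weight_le (p := L.proj x) {x, y, z} (by simp [hy, hz])
  rw [Finset.sum_insert (by simp [hxy, hne.1.symm]), Finset.sum_insert (by simp [hne.2.symm]),
    Finset.sum_singleton, hrank] at this
  have h1 := L.weight_pos x
  have h2 := L.weight_pos y
  have h3 := L.weight_pos z
  omega

theorem weight_eq_one (hrank : L.rank = 2) {x y : L.X} (hxy : x ≠ y) (hy : L.proj y = L.proj x) :
    L.weight x = 1 := by
  classical
  have := L.sum_weight_le (p := L.proj x) {x, y} (by simp [hy])
  rw [Finset.sum_insert (by simp [hxy]), Finset.sum_singleton, hrank] at this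
  have h1 := L.weight_pos x
  have h2 := L.weight_pos y
  omega

/-- A cone of `Σ` has at most two lifts to a multi-section of rank two. -/
theorem eq_of_lift (hrank : L.rank = 2) {a b c : Set L.X} (ha : a ∈ L.cones) (hb : b ∈ L.cones)
    (hc : c ∈ L.cones) (hab : a ≠ b) (hb' : L.proj '' b = L.proj '' a)
    (hc' : L.proj '' c = L.proj '' a) : c = a ∨ c = b := by
  obtain ⟨p, hp⟩ := F.relInt_nonempty (L.proj_mem a ha)
  obtain ⟨x, hx, rfl⟩ := hp.1
  obtain ⟨y, hy, hyx⟩ : L.proj x ∈ L.proj '' b := by rw [hb']; exact hp.1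
  obtain ⟨z, hz, hzx⟩ : L.proj x ∈ L.proj '' c := by rw [hc']; exact hp.1
  have ea := L.eq_carrier ha hx hp
  have eb := L.eq_carrier hb hy (by rwa [hb', hyx])
  have ec := L.eq_carrier hc hz (by rwa [hc', hzx])
  rcases L.eq_of_fiber hrank (fun h => hab (by rw [ea, eb, h])) hyx hzx with h | h
  · exact Or.inl (by rw [ec, ea, h])
  · exact Or.inr (by rw [ec, eb, h])

/-- Every point over a maximal cone `σ` lies in a lift of `σ`: otherwise the trace of the weight
along a small component around the point would drop to zero over the interior of `σ`. -/
theorem exists_lift_mem {σ : Set Plane} (hσ : σ ∈ F.dimCones 2) {y : L.X} (hy : L.proj y ∈ σ) :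
    ∃ σ' ∈ L.cones, L.proj '' σ' = σ ∧ y ∈ σ' := by
  set p := L.proj y with hp
  obtain ⟨r, hr, hball⟩ := F.exists_ball p
  obtain ⟨u, v, h⟩ := F.exists_sector hσ
  -- a point `q` of the interior of `σ` close to `p`
  have hlim : Filter.Tendsto (fun ε : ℝ => p + ε • (u + v)) (nhds 0) (nhds p) := by
    have : Continuous fun ε : ℝ => p + ε • (u + v) := by fun_prop
    simpa using this.tendsto 0
  obtain ⟨δ, hδ, hδb⟩ := Metric.mem_nhds_iff.1 (hlim (Metric.ball_mem_nhds p hr))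
  have hε : δ / 2 ∈ Metric.ball (0 : ℝ) δ := by
    rw [Metric.mem_ball, dist_zero_right, Real.norm_eq_abs, abs_of_pos (by linarith)]; linarith
  have hq := hδb hε
  set q := p + (δ / 2) • (u + v) with hqdef
  have hqσ : q ∈ relInt σ := by
    rw [h.mem_relInt, hqdef]
    simp only [planeDet_add_left, planeDet_add_right, planeDet_smul_left, planeDet_smul_right,
      planeDet_self]
    obtain ⟨h1, h2⟩ := (h.2 p).1 hy
    have := mul_pos (half_pos hδ) h.1
    constructor <;> nlinarith
  set U := Metric.ball p r with hU
  have hUc : IsConnected U :=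
    ⟨⟨p, Metric.mem_ball_self hr⟩, (convex_ball p r).isPreconnected⟩
  have hyU : y ∈ L.proj ⁻¹' U := Metric.mem_ball_self hr
  set V := connectedComponentIn (L.proj ⁻¹' U) y with hV
  -- the cones through `y` and the other cones over `p` are separated over `U`
  set A : Set L.X := ⋃ c ∈ {c | c ∈ L.cones ∧ y ∈ c}, c with hA
  set B : Set L.X := ⋃ c ∈ {c | c ∈ L.cones ∧ p ∈ L.proj '' c ∧ y ∉ c}, c with hB
  have hAcl : IsClosed A :=
    Set.Finite.isClosed_biUnion (L.finite.subset fun c hc => hc.1) fun c hc => L.isClosed c hc.1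
  have hBcl : IsClosed B :=
    Set.Finite.isClosed_biUnion (L.finite.subset fun c hc => hc.1) fun c hc => L.isClosed c hc.1
  have hVU : V ⊆ L.proj ⁻¹' U := connectedComponentIn_subset _ _
  have hpc : ∀ x ∈ L.proj ⁻¹' U, ∀ c ∈ L.cones, x ∈ c → p ∈ L.proj '' c := fun x hx c hc hxc =>
    hball _ (L.proj_mem c hc) _ hx (Set.mem_image_of_mem _ hxc)
  have hcov : V ⊆ A ∪ B := by
    intro x hx
    by_cases hyx : y ∈ L.carrier x
    · exact Or.inl (Set.mem_biUnion (show L.carrier x ∈ {c | c ∈ L.cones ∧ y ∈ c} from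
        ⟨L.carrier_mem x, hyx⟩) (L.mem_carrier x))
    · exact Or.inr (Set.mem_biUnion
        (show L.carrier x ∈ {c | c ∈ L.cones ∧ p ∈ L.proj '' c ∧ y ∉ c} from
        ⟨L.carrier_mem x, hpc x (hVU hx) _ (L.carrier_mem x) (L.mem_carrier x), hyx⟩)
        (L.mem_carrier x))
  have hcarry : ∀ x ∈ V, ∀ c ∈ L.cones, x ∈ c → y ∈ c → y ∈ L.carrier x := by
    intro x hx c hc hxc hyc
    obtain ⟨z, hz, hzp⟩ := hpc x (hVU hx) _ (L.carrier_mem x) (L.mem_carrier x)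
    rwa [← L.injOn_proj hc (L.carrier_subset hc hxc hz) hyc hzp]
  have hdisj : ∀ x ∈ V, x ∈ A → x ∉ B := by
    intro x hx hxA hxB
    obtain ⟨c, hc, hxc⟩ := Set.mem_iUnion₂.1 hxA
    obtain ⟨d, hd, hxd⟩ := Set.mem_iUnion₂.1 hxB
    exact hd.2.2 (L.carrier_subset hd.1 hxd (hcarry x hx c hc.1 hxc hc.2))
  have hyV : y ∈ V := mem_connectedComponentIn hyU
  have hVA : V ⊆ A := by
    intro x hx
    by_contra hxA
    have hxB := (hcov hx).resolve_left hxA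
    have hyA : y ∈ A := Set.mem_biUnion (show L.carrier y ∈ {c | c ∈ L.cones ∧ y ∈ c} from
        ⟨L.carrier_mem y, L.mem_carrier y⟩) (L.mem_carrier y)
    obtain ⟨z, hz, hzA, hzB⟩ := isPreconnected_closed_iff.1
      (isPreconnected_connectedComponentIn (F := L.proj ⁻¹' U) (x := y)) A B hAcl hBcl hcov
      ⟨y, hyV, hyA⟩ ⟨x, hx, hxB⟩
    exact hdisj z hz hzA hzB
  have htr := L.trace_const U Metric.isOpen_ball hUc y hyU p (Metric.mem_ball_self hr) q hq
  have hne : ∑ᶠ x ∈ V ∩ L.proj ⁻¹' {q}, L.weight x ≠ 0 := by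
    rw [← htr]
    have hfin : (V ∩ L.proj ⁻¹' {p}).Finite := (L.finite_fiber p).subset Set.inter_subset_right
    rw [finsum_mem_eq_finite_toFinset_sum _ hfin]
    have : L.weight y ≤ ∑ i ∈ hfin.toFinset, L.weight i :=
      Finset.single_le_sum (fun _ _ => Nat.zero_le _) ((Set.Finite.mem_toFinset _).2 ⟨hyV, rfl⟩)
    have := L.weight_pos y
    omega
  obtain ⟨x, ⟨hxV, hxq⟩, -⟩ := exists_ne_zero_of_finsum_mem_ne_zero hne
  obtain ⟨c, hc, hxc⟩ := Set.mem_iUnion₂.1 (hVA hxV)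
  refine ⟨L.carrier x, L.carrier_mem x, L.proj_carrier_of_mem_relInt hσ.1 ?_,
    hcarry x hxV c hc.1 hxc hc.2⟩
  rw [show L.proj x = q from hxq]; exact hqσ

theorem slope_spec {σ' : Set L.X} (h : σ' ∈ L.cones) :
    ∀ x ∈ σ', L.phi x = pairing (L.slope σ') (L.proj x) :=
  Classical.epsilon_spec (p := fun m : DualLattice => ∀ x ∈ σ', L.phi x = pairing m (L.proj x))
    (L.phi_linear σ' h)

/-- Two maximal cones of `L` share a ray if and only if they have a common point over the generator
of the common ray of their projections. -/
theorem inter_mem_dimCones_one_iff {a b : Set L.X} {v : Plane} (ha : a ∈ L.cones)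
    (hb : b ∈ L.cones) (hv : v ≠ 0) (hray : ray v ∈ F.cones)
    (hi : L.proj '' a ∩ L.proj '' b = ray v) :
    a ∩ b ∈ L.dimCones 1 ↔ ∃ x ∈ a ∩ b, L.proj x = v := by
  constructor
  · intro h
    obtain ⟨w, hw, he⟩ := F.exists_ray ⟨L.proj_mem _ h.1, h.2⟩
    have hsub : ray w ⊆ ray v := by
      rw [← he, ← hi]; exact Set.image_inter_subset _ _ _
    obtain ⟨t, ht, rfl⟩ := hsub (mem_ray_self w)
    have ht : 0 < t := lt_of_le_of_ne ht (by rintro rfl; simp at hw)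
    rw [ray_smul ht] at he
    have := mem_ray_self v
    rwa [← he] at this
  · rintro ⟨x, hx, rfl⟩
    have hc := L.proj_carrier_of_mem_relInt (x := x) hray ((mem_relInt_ray hv).2 ⟨1, one_pos, by simp⟩)
    have : a ∩ b = L.carrier x := by
      refine Set.Subset.antisymm (fun y hy => ?_)
        (Set.subset_inter (L.carrier_subset ha hx.1) (L.carrier_subset hb hx.2))
      have : L.proj y ∈ L.proj '' L.carrier x := by
        rw [hc, ← hi]; exact ⟨Set.mem_image_of_mem _ hy.1, Set.mem_image_of_mem _ hy.2⟩
      obtain ⟨z, hz, hzy⟩ := this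
      rwa [L.injOn_proj ha hy.1 (L.carrier_subset ha hx.1 hz) hzy.symm]
    rw [this]
    exact ⟨L.carrier_mem x, by rw [hc, coneDim_ray hv]⟩

theorem proj_inter {a b : Set L.X} {v : Plane} (hi : L.proj '' a ∩ L.proj '' b = ray v)
    (h : a ∩ b ∈ L.dimCones 1) : L.proj '' (a ∩ b) = ray v := by
  obtain ⟨w, hw, he⟩ := F.exists_ray ⟨L.proj_mem _ h.1, h.2⟩
  have hsub : ray w ⊆ ray v := by
    rw [← he, ← hi]; exact Set.image_inter_subset _ _ _
  obtain ⟨t, ht, rfl⟩ := hsub (mem_ray_self w)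
  have ht : 0 < t := lt_of_le_of_ne ht (by rintro rfl; simp at hw)
  rw [he, ray_smul ht]

theorem nextAnticlockwise_of_sector {a b : Set L.X} {u v w : Plane} (ha : a ∈ L.cones)
    (hb : b ∈ L.cones) (hsa : IsSector (L.proj '' a) u v) (hsb : IsSector (L.proj '' b) v w)
    (hx : ∃ x ∈ a ∩ b, L.proj x = v) : L.NextAnticlockwise a b := by
  have hv := hsa.right_ne_zero
  have hi := F.inter_eq_ray (L.proj_mem a ha) (L.proj_mem b hb) hsa hsb
  have hray : ray v ∈ F.cones := F.face_mem _ (L.proj_mem a ha) _ hsa.isFace_right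
  have hd := (L.inter_mem_dimCones_one_iff ha hb hv hray hi).2 hx
  refine ⟨hd, fun t ht => ?_⟩
  rw [L.proj_inter hi hd, mem_relInt_ray hv] at ht
  obtain ⟨c, hc, rfl⟩ := ht
  refine ⟨fun y hy => ?_, fun y hy => ?_⟩
  · rw [planeDet_smul_right]; exact mul_pos hc (hsa.mem_relInt.1 hy).2
  · rw [planeDet_smul_left]; exact mul_pos hc (hsb.mem_relInt.1 hy).1

theorem NextAnticlockwise.exists_sector {L : TropicalMultisection.{u} F} {a b : Set L.X}
    (h : L.NextAnticlockwise a b) (ha : a ∈ L.dimCones 2) (hb : b ∈ L.dimCones 2) :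
    ∃ u v w, IsSector (L.proj '' a) u v ∧ IsSector (L.proj '' b) v w := by
  obtain ⟨u, v, hsa⟩ := F.exists_sector ⟨L.proj_mem a ha.1, ha.2⟩
  obtain ⟨v', w, hsb⟩ := F.exists_sector ⟨L.proj_mem b hb.1, hb.2⟩
  obtain ⟨t, ht, he⟩ := F.exists_ray ⟨L.proj_mem _ h.1.1, h.1.2⟩
  have htr : t ∈ relInt (ray t) := (mem_relInt_ray ht).2 ⟨1, one_pos, by simp⟩
  have hrF : ray t ∈ F.cones := by rw [← he]; exact L.proj_mem _ h.1.1
  have hmem : t ∈ L.proj '' (a ∩ b) := by rw [he]; exact mem_ray_self t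
  have hta : t ∈ L.proj '' a := Set.image_mono Set.inter_subset_left hmem
  have htb : t ∈ L.proj '' b := Set.image_mono Set.inter_subset_right hmem
  obtain ⟨h1, h2⟩ := h.2 t (by rw [he]; exact htr)
  have h1 := h1 _ hsa.add_mem_relInt
  have h2 := h2 _ hsb.add_mem_relInt
  have hfa := F.isFace_of_mem_relInt hrF (L.proj_mem a ha.1) htr hta
  have hfb := F.isFace_of_mem_relInt hrF (L.proj_mem b hb.1) htr htb
  have hd := coneDim_ray ht
  have ea : ray t = ray v := by
    rcases hsa.eq_of_isFace hfa with e | e | e | e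
    · rw [e, coneDim_zero] at hd; omega
    · have := mem_ray_self t
      rw [e] at this
      obtain ⟨c, hc, rfl⟩ := this
      rw [planeDet_add_left, planeDet_smul_right, planeDet_smul_right, planeDet_self,
        planeDet_swap u v] at h1
      nlinarith [mul_nonneg hc hsa.1.le]
    · exact e
    · rw [e, hsa.coneDim] at hd; omega
  have eb : ray t = ray v' := by
    rcases hsb.eq_of_isFace hfb with e | e | e | e
    · rw [e, coneDim_zero] at hd; omega
    · exact e
    · have := mem_ray_self t
      rw [e] at this
      obtain ⟨c, hc, rfl⟩ := this
      rw [planeDet_add_right, planeDet_smul_left, planeDet_smul_left, planeDet_self,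
        planeDet_swap v' w] at h2
      nlinarith [mul_nonneg hc hsb.1.le]
    · rw [e, hsb.coneDim] at hd; omega
  have : v' ∈ ray v := by rw [← ea, eb]; exact mem_ray_self v'
  obtain ⟨c, hc, rfl⟩ := this
  have hc : 0 < c := lt_of_le_of_ne hc (by rintro rfl; exact hsb.left_ne_zero (by simp))
  exact ⟨u, c • v, w, hsa.smul_right hc, hsb⟩

end TropicalMultisection

end TropLag

namespace TropLag

variable {F : CompleteFan}

/-! ### Combinatorial unions of two piecewise linear functions -/

/-- A piecewise linear function with integral slopes on the fan. -/
def IsPiecewiseLinear (F : CompleteFan) (φ : Plane → ℝ) : Prop :=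
  ∀ σ ∈ F.cones, ∃ m : DualLattice, ∀ x ∈ σ, φ x = pairing m x

theorem image_down_preimage (σ : Set Plane) :
    (ULift.down : ULift.{u} Plane → Plane) '' (ULift.down ⁻¹' σ) = σ :=
  Set.image_preimage_eq σ ULift.down_surjective

/-- The multi-section of rank one whose domain is a copy of the plane. -/
def planeSection (F : CompleteFan) (φ : Plane → ℝ) (hφ : IsPiecewiseLinear F φ) :
    TropicalMultisection.{u} F where
  X := ULift.{u} Plane
  cones := (fun σ => ULift.down ⁻¹' σ) '' F.cones
  finite := F.finite.image _
  isClosed := by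
    rintro _ ⟨σ, hσ, rfl⟩
    exact (F.isClosed hσ).preimage continuous_uliftDown
  proj := ULift.down
  continuous_proj := continuous_uliftDown
  surjective_proj := ULift.down_surjective
  proj_mem := by
    rintro _ ⟨σ, hσ, rfl⟩
    rwa [image_down_preimage]
  isEmbedding_proj := by
    rintro _ ⟨σ, hσ, rfl⟩
    exact Homeomorph.ulift.isEmbedding.comp Topology.IsEmbedding.subtypeVal
  face_mem := by
    rintro _ ⟨σ, hσ, rfl⟩ τ hτ
    rw [image_down_preimage] at hτ
    refine ⟨τ, F.face_mem σ hσ τ hτ, ?_⟩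
    rw [← Set.preimage_inter, Set.inter_eq_right.2 hτ.subset]
  partition := by
    intro x
    obtain ⟨σ, hσ, hx⟩ := F.exists_mem_relInt x.down
    refine ⟨ULift.down ⁻¹' σ, ⟨⟨σ, hσ, rfl⟩, hx.1, by rwa [image_down_preimage]⟩, ?_⟩
    rintro _ ⟨⟨τ, hτ, rfl⟩, -, hr⟩
    rw [image_down_preimage] at hr
    rw [F.eq_of_mem_relInt hτ hσ hr hx]
  weight := fun _ => 1
  weight_pos := fun _ => one_pos
  weight_const := fun _ _ _ _ _ _ _ _ => rfl
  trace_const := by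
    intro U hU hUc y hy p hp q hq
    have hpre : IsPreconnected ((ULift.down : ULift.{u} Plane → Plane) ⁻¹' U) := by
      rw [show (ULift.down : ULift.{u} Plane → Plane) ⁻¹' U = ULift.up '' U by
        ext x; exact ⟨fun h => ⟨x.down, h, rfl⟩, by rintro ⟨p, hp, rfl⟩; exact hp⟩]
      exact hUc.isPreconnected.image _ continuous_uliftUp.continuousOn
    rw [hpre.connectedComponentIn hy]
    have key : ∀ p ∈ U, ((ULift.down : ULift.{u} Plane → Plane) ⁻¹' U) ∩ ULift.down ⁻¹' {p} =
        {ULift.up p} := by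
      intro p hp
      ext x
      constructor
      · rintro ⟨-, h⟩; exact ULift.ext _ _ h
      · rintro rfl; exact ⟨hp, rfl⟩
    rw [key p hp, key q hq, finsum_mem_singleton, finsum_mem_singleton]
  rank := 1
  trace_eq_rank := by
    intro p
    rw [show (ULift.down : ULift.{u} Plane → Plane) ⁻¹' {p} = {ULift.up p} by
      ext x; exact ⟨fun h => ULift.ext _ _ h, fun h => by rw [h]; rfl⟩, finsum_mem_singleton]
  phi := fun x => φ x.down
  phi_linear := by
    rintro _ ⟨σ, hσ, rfl⟩
    obtain ⟨m, hm⟩ := hφ σ hσ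
    exact ⟨m, fun x hx => hm _ hx⟩

theorem planeSection_connected (φ : Plane → ℝ) (hφ : IsPiecewiseLinear F φ) :
    (planeSection.{u} F φ hφ).Connected :=
  (Homeomorph.ulift.{u} (X := Plane)).symm.surjective.connectedSpace
    (Homeomorph.ulift (X := Plane)).symm.continuous

section union

variable (F : CompleteFan) (φ : Bool → Plane → ℝ)

/-- The locus along which two piecewise linear functions are glued in a combinatorial union. -/
def gluedLocus : Set Plane :=
  {p | ∃ σ ∈ F.cones, p ∈ σ ∧ ∀ x ∈ σ, φ true x = φ false x}

theorem isClosed_gluedLocus : IsClosed (gluedLocus F φ) := by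
  have : gluedLocus F φ = ⋃ σ ∈ {σ | σ ∈ F.cones ∧ ∀ x ∈ σ, φ true x = φ false x}, σ := by
    ext p
    simp only [gluedLocus, Set.mem_iUnion]
    constructor
    · rintro ⟨σ, h1, h2, h3⟩; exact ⟨σ, ⟨h1, h3⟩, h2⟩
    · rintro ⟨σ, ⟨h1, h3⟩, h2⟩; exact ⟨σ, h1, h2, h3⟩
  rw [this]
  exact Set.Finite.isClosed_biUnion (F.finite.subset fun σ h => h.1) fun σ h => F.isClosed h.1

variable {F φ}

theorem subset_gluedLocus {σ : Set Plane} (hσ : σ ∈ F.cones) {p : Plane} (hp : p ∈ relInt σ)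
    (hZ : p ∈ gluedLocus F φ) : σ ⊆ gluedLocus F φ := by
  obtain ⟨ρ, hρ, hpρ, h⟩ := hZ
  exact fun x hx => ⟨ρ, hρ, (F.isFace_of_mem_relInt hσ hρ hp hpρ).subset hx, h⟩

theorem eq_of_mem_gluedLocus {p : Plane} (hZ : p ∈ gluedLocus F φ) (b b' : Bool) :
    φ b p = φ b' p := by
  obtain ⟨ρ, -, hpρ, h⟩ := hZ
  cases b <;> cases b' <;> simp [h p hpρ]

variable (F φ)

/-- The projection of the disjoint union of two planes. -/
def basePoint : ULift.{u} Plane ⊕ ULift.{u} Plane → Plane := Sum.elim ULift.down ULift.down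

/-- Two planes glued along `gluedLocus`. -/
def gluedSetoid : Setoid (ULift.{u} Plane ⊕ ULift.{u} Plane) where
  r x y := basePoint x = basePoint y ∧ (basePoint x ∈ gluedLocus F φ ∨ x.isLeft = y.isLeft)
  iseqv :=
    { refl := fun _ => ⟨rfl, Or.inr rfl⟩
      symm := fun h => ⟨h.1.symm, h.2.imp (fun h' => h.1 ▸ h') Eq.symm⟩
      trans := fun {x y z} h h' => ⟨h.1.trans h'.1, by
        rcases h.2 with h2 | h2
        · exact Or.inl h2
        · rcases h'.2 with h3 | h3
          · exact Or.inl (h.1 ▸ h3)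
          · exact Or.inr (h2.trans h3)⟩ }

/-- The domain of the combinatorial union of two piecewise linear functions. -/
abbrev GluedPlanes : Type u := Quotient (gluedSetoid.{u} F φ)

namespace GluedPlanes

/-- The point over `p` on the first sheet (`b = true`) or on the second sheet. -/
def sheet (b : Bool) (p : Plane) : GluedPlanes.{u} F φ :=
  Quotient.mk _ (if b then Sum.inl ⟨p⟩ else Sum.inr ⟨p⟩)

/-- The projection of the glued planes. -/
def proj : GluedPlanes.{u} F φ → Plane := Quotient.lift basePoint fun _ _ h => h.1

/-- The function induced on the glued planes. -/
def phi : GluedPlanes.{u} F φ → ℝ :=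
  Quotient.lift (fun x => φ x.isLeft (basePoint x)) fun x y h => by
    obtain ⟨h1, h2 | h2⟩ := h
    · rw [← h1]; exact eq_of_mem_gluedLocus h2 _ _
    · rw [h1, h2]

variable {F φ}

@[simp] theorem proj_sheet (b : Bool) (p : Plane) : proj F φ (sheet.{u} F φ b p) = p := by
  cases b <;> rfl

@[simp] theorem phi_sheet (b : Bool) (p : Plane) : phi F φ (sheet.{u} F φ b p) = φ b p := by
  cases b <;> rfl

theorem sheet_eq_iff {b b' : Bool} {p p' : Plane} : sheet.{u} F φ b p = sheet F φ b' p' ↔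
    p = p' ∧ (p ∈ gluedLocus F φ ∨ b = b') := by
  unfold sheet
  rw [Quotient.eq]
  change _ ∧ _ ↔ _
  cases b <;> cases b' <;> simp [basePoint]

theorem exists_eq_sheet (x : GluedPlanes.{u} F φ) : ∃ b p, x = sheet F φ b p := by
  induction x using Quotient.inductionOn with
  | h x =>
    rcases x with x | x
    · exact ⟨true, x.down, rfl⟩
    · exact ⟨false, x.down, rfl⟩

theorem continuous_sheet (b : Bool) : Continuous (sheet.{u} F φ b) := by
  refine continuous_quotient_mk'.comp ?_
  cases b
  · exact continuous_inr.comp continuous_uliftUp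
  · exact continuous_inl.comp continuous_uliftUp

theorem continuous_proj : Continuous (proj.{u} F φ) :=
  Continuous.quotient_lift (continuous_uliftDown.sumElim continuous_uliftDown) _

theorem isClosed_iff {s : Set (GluedPlanes.{u} F φ)} :
    IsClosed s ↔ ∀ b, IsClosed (sheet F φ b ⁻¹' s) := by
  refine ⟨fun h b => h.preimage (continuous_sheet b), fun h => ?_⟩
  rw [← isQuotientMap_quotient_mk'.isClosed_preimage, isClosed_sum_iff]
  exact ⟨(h true).preimage continuous_uliftDown, (h false).preimage continuous_uliftDown⟩

theorem isOpen_iff {s : Set (GluedPlanes.{u} F φ)} :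
    IsOpen s ↔ ∀ b, IsOpen (sheet F φ b ⁻¹' s) := by
  simp only [← isClosed_compl_iff, isClosed_iff, Set.preimage_compl]

theorem isClosed_sheet_image {s : Set Plane} (hs : IsClosed s) (b : Bool) :
    IsClosed (sheet.{u} F φ b '' s) := by
  rw [isClosed_iff]
  intro b'
  by_cases hb : b = b'
  · have : sheet.{u} F φ b' ⁻¹' (sheet F φ b '' s) = s := by
      ext p
      constructor
      · rintro ⟨p', hp', h⟩
        rwa [← (sheet_eq_iff.1 h).1]
      · intro hp
        exact ⟨p, hp, by rw [hb]⟩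
    rwa [this]
  · have : sheet.{u} F φ b' ⁻¹' (sheet F φ b '' s) = s ∩ gluedLocus F φ := by
      ext p
      constructor
      · rintro ⟨p', hp', h⟩
        obtain ⟨rfl, h'⟩ := sheet_eq_iff.1 h
        exact ⟨hp', h'.resolve_right hb⟩
      · rintro ⟨hp, hZ⟩
        exact ⟨p, hp, sheet_eq_iff.2 ⟨rfl, Or.inl hZ⟩⟩
    rw [this]
    exact hs.inter (isClosed_gluedLocus F φ)

theorem proj_image_sheet (b : Bool) (s : Set Plane) : proj F φ '' (sheet.{u} F φ b '' s) = s := by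
  rw [Set.image_image]; simp

open scoped Classical in
/-- The weight on the glued planes: the number of sheets through a point. -/
noncomputable def weight (x : GluedPlanes.{u} F φ) : ℕ :=
  if proj F φ x ∈ gluedLocus F φ then 2 else 1

theorem fiber_of_mem {p : Plane} (hp : p ∈ gluedLocus F φ) (b : Bool) :
    proj.{u} F φ ⁻¹' {p} = {sheet F φ b p} := by
  ext x
  obtain ⟨b', p', rfl⟩ := exists_eq_sheet x
  simp only [Set.mem_preimage, proj_sheet, Set.mem_singleton_iff, sheet_eq_iff]
  constructor
  · rintro rfl; exact ⟨rfl, Or.inl hp⟩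
  · exact fun h => h.1

theorem fiber_eq_pair (p : Plane) :
    proj.{u} F φ ⁻¹' {p} = {sheet F φ true p, sheet F φ false p} := by
  ext x
  obtain ⟨b', p', rfl⟩ := exists_eq_sheet x
  simp only [Set.mem_preimage, proj_sheet, Set.mem_singleton_iff, Set.mem_insert_iff, sheet_eq_iff]
  constructor
  · rintro rfl; cases b' <;> simp
  · rintro (h | h) <;> exact h.1

theorem trace_fiber (p : Plane) : ∑ᶠ x ∈ proj.{u} F φ ⁻¹' {p}, weight x = 2 := by
  by_cases hp : p ∈ gluedLocus F φ
  · rw [fiber_of_mem hp true, finsum_mem_singleton]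
    simp [GluedPlanes.weight, hp]
  · rw [fiber_eq_pair, finsum_mem_pair (fun h => by simpa [hp] using sheet_eq_iff.1 h)]
    simp [GluedPlanes.weight, hp]

theorem sum_quotient_fiber (y : GluedPlanes.{u} F φ) (w : ULift.{u} Plane ⊕ ULift.{u} Plane → ℕ)
    (hw : ∀ x, w x = 1) : ∑ᶠ x ∈ (Quotient.mk (gluedSetoid.{u} F φ)) ⁻¹' {y}, w x = weight y := by
  obtain ⟨b, p, rfl⟩ := exists_eq_sheet y
  by_cases hp : p ∈ gluedLocus F φ
  · have : (Quotient.mk (gluedSetoid.{u} F φ)) ⁻¹' {sheet F φ b p} =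
        {Sum.inl ⟨p⟩, Sum.inr ⟨p⟩} := by
      ext x
      rcases x with x | x
      · change sheet F φ true x.down = sheet F φ b p ↔ _
        rw [sheet_eq_iff]
        constructor
        · rintro ⟨h, -⟩; exact Or.inl (by rw [← h])
        · rintro (h | h)
          · cases h; exact ⟨rfl, Or.inl hp⟩
          · cases h
      · change sheet F φ false x.down = sheet F φ b p ↔ _
        rw [sheet_eq_iff]
        constructor
        · rintro ⟨h, -⟩; exact Or.inr (by rw [← h]; rfl)
        · rintro (h | h)
          · cases h
          · cases h; exact ⟨rfl, Or.inl hp⟩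
    rw [this]
    rw [finsum_mem_pair (by simp), hw, hw]
    simp [weight, hp]
  · have : (Quotient.mk (gluedSetoid.{u} F φ)) ⁻¹' {sheet F φ b p} =
        {if b then Sum.inl ⟨p⟩ else Sum.inr ⟨p⟩} := by
      ext x
      rcases x with x | x
      · change sheet F φ true x.down = sheet F φ b p ↔ _
        rw [sheet_eq_iff]
        constructor
        · rintro ⟨h, h'⟩
          rcases h' with h' | rfl
          · exact absurd (h ▸ h') hp
          · rw [← h]; rfl
        · intro h
          cases b <;> cases h
          exact ⟨rfl, Or.inr rfl⟩
      · change sheet F φ false x.down = sheet F φ b p ↔ _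
        rw [sheet_eq_iff]
        constructor
        · rintro ⟨h, h'⟩
          rcases h' with h' | rfl
          · exact absurd (h ▸ h') hp
          · rw [← h]; rfl
        · intro h
          cases b <;> cases h
          exact ⟨rfl, Or.inr rfl⟩
    rw [this]
    rw [finsum_mem_singleton, hw]
    simp [weight, hp]

/-- Over a connected open set which meets the glued locus the domain is connected; over the others
its components are the two sheets. -/
theorem trace_component {U : Set Plane} (hU : IsOpen U) (hUc : IsConnected U)
    (y : GluedPlanes.{u} F φ) (hy : y ∈ proj F φ ⁻¹' U) {p q : Plane} (hp : p ∈ U) (hq : q ∈ U) :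
    ∑ᶠ x ∈ connectedComponentIn (proj F φ ⁻¹' U) y ∩ proj F φ ⁻¹' {p}, weight x =
      ∑ᶠ x ∈ connectedComponentIn (proj F φ ⁻¹' U) y ∩ proj F φ ⁻¹' {q}, weight x := by
  have hpre : ∀ b, IsPreconnected (sheet.{u} F φ b '' U) := fun b =>
    hUc.isPreconnected.image _ (continuous_sheet b).continuousOn
  have hunion : proj.{u} F φ ⁻¹' U = sheet F φ true '' U ∪ sheet F φ false '' U := by
    ext x
    obtain ⟨b, p, rfl⟩ := exists_eq_sheet x
    simp only [Set.mem_preimage, proj_sheet, Set.mem_union, Set.mem_image, sheet_eq_iff]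
    constructor
    · intro h; cases b
      · exact Or.inr ⟨p, h, rfl, Or.inr rfl⟩
      · exact Or.inl ⟨p, h, rfl, Or.inr rfl⟩
    · rintro (⟨_, h, rfl, -⟩ | ⟨_, h, rfl, -⟩) <;> exact h
  by_cases hZ : ∃ z ∈ U, z ∈ gluedLocus F φ
  · obtain ⟨z, hzU, hz⟩ := hZ
    have hconn : IsPreconnected (proj.{u} F φ ⁻¹' U) := by
      rw [hunion]
      exact (hpre true).union (sheet F φ true z) ⟨z, hzU, rfl⟩
        ⟨z, hzU, sheet_eq_iff.2 ⟨rfl, Or.inl hz⟩⟩ (hpre false)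
    have key : ∀ p ∈ U, proj.{u} F φ ⁻¹' U ∩ proj F φ ⁻¹' {p} = proj F φ ⁻¹' {p} := by
      intro p hp
      refine Set.inter_eq_right.2 fun x hx => ?_
      rw [Set.mem_preimage, show proj F φ x = p from hx]; exact hp
    rw [hconn.connectedComponentIn hy, key p hp, key q hq, trace_fiber, trace_fiber]
  · push Not at hZ
    obtain ⟨b, t, rfl⟩ := exists_eq_sheet y
    have htU : t ∈ U := by simpa using hy
    have hpreim : ∀ b b', sheet.{u} F φ b' ⁻¹' (sheet F φ b '' U) = {p | p ∈ U ∧ b = b'} := by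
      intro b b'
      ext p
      constructor
      · rintro ⟨p', hp', h⟩
        obtain ⟨rfl, h'⟩ := sheet_eq_iff.1 h
        exact ⟨hp', h'.resolve_left (hZ _ hp')⟩
      · rintro ⟨hp, h⟩; exact ⟨p, hp, sheet_eq_iff.2 ⟨rfl, Or.inr h⟩⟩
    have hopen : ∀ b, IsOpen (sheet.{u} F φ b '' U) := by
      intro b
      rw [isOpen_iff]
      intro b'
      rw [hpreim]
      by_cases h : b = b' <;> simp [h, hU]
    have hdisj : Disjoint (sheet.{u} F φ b '' U) (sheet F φ (!b) '' U) := by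
      rw [Set.disjoint_left]
      rintro _ ⟨p, hp, rfl⟩ ⟨p', hp', h⟩
      rcases (sheet_eq_iff.1 h).2 with h | h
      · exact hZ _ hp' h
      · cases b <;> simp at h
    have hunion' : proj.{u} F φ ⁻¹' U = sheet F φ b '' U ∪ sheet F φ (!b) '' U := by
      cases b
      · rw [hunion, Set.union_comm]; rfl
      · rw [hunion]; rfl
    have hcomp : connectedComponentIn (proj.{u} F φ ⁻¹' U) (sheet F φ b t) =
        sheet F φ b '' U := by
      refine Set.Subset.antisymm ?_ ?_
      · refine IsPreconnected.subset_left_of_subset_union (hopen b) (hopen (!b)) hdisj ?_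
          ⟨sheet F φ b t, mem_connectedComponentIn hy, t, htU, rfl⟩
          isPreconnected_connectedComponentIn
        rw [← hunion']; exact connectedComponentIn_subset _ _
      · refine (hpre b).subset_connectedComponentIn ⟨t, htU, rfl⟩ ?_
        rw [hunion']; exact Set.subset_union_left
    have key : ∀ p ∈ U, sheet.{u} F φ b '' U ∩ proj F φ ⁻¹' {p} = {sheet F φ b p} := by
      intro p hp
      ext x
      constructor
      · rintro ⟨⟨p', -, rfl⟩, h⟩
        have : p' = p := by simpa using h
        rw [this]; rfl
      · rintro rfl
        exact ⟨⟨p, hp, rfl⟩, by simp⟩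
    rw [hcomp, key p hp, key q hq, finsum_mem_singleton, finsum_mem_singleton]
    simp [weight, hZ p hp, hZ q hq]

end GluedPlanes

open GluedPlanes

/-- The combinatorial union of two piecewise linear functions. -/
noncomputable def gluedUnion (hφ : ∀ b, IsPiecewiseLinear F (φ b)) : TropicalMultisection.{u} F where
  X := GluedPlanes.{u} F φ
  cones := {s | ∃ b, ∃ σ ∈ F.cones, s = sheet F φ b '' σ}
  finite := by
    refine ((Set.finite_univ (α := Bool)).image2 (fun b σ => sheet.{u} F φ b '' σ)
      F.finite).subset ?_
    rintro _ ⟨b, σ, hσ, rfl⟩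
    exact ⟨b, trivial, σ, hσ, rfl⟩
  isClosed := by
    rintro _ ⟨b, σ, hσ, rfl⟩
    exact isClosed_sheet_image (F.isClosed hσ) b
  proj := GluedPlanes.proj F φ
  continuous_proj := GluedPlanes.continuous_proj
  surjective_proj := fun p => ⟨sheet F φ true p, proj_sheet _ _⟩
  proj_mem := by
    rintro _ ⟨b, σ, hσ, rfl⟩
    rwa [proj_image_sheet]
  isEmbedding_proj := by
    rintro _ ⟨b, σ, hσ, rfl⟩
    refine (Topology.IsClosedEmbedding.of_continuous_injective_isClosedMap
      (GluedPlanes.continuous_proj.comp continuous_subtype_val) ?_ ?_).isEmbedding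
    · rintro ⟨_, p, hp, rfl⟩ ⟨_, p', hp', rfl⟩ h
      have : p = p' := by simpa using h
      exact Subtype.ext (congrArg (sheet F φ b) this)
    · intro C hC
      obtain ⟨D, hD, rfl⟩ := isClosed_induced_iff.1 hC
      have : (GluedPlanes.proj F φ ∘ Subtype.val) ''
          ((Subtype.val : (sheet.{u} F φ b '' σ) → _) ⁻¹' D) = σ ∩ sheet F φ b ⁻¹' D := by
        ext p
        constructor
        · rintro ⟨⟨_, p', hp', rfl⟩, h, rfl⟩
          simpa using ⟨hp', h⟩
        · rintro ⟨hp, hpD⟩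
          exact ⟨⟨_, p, hp, rfl⟩, hpD, by simp⟩
      rw [this]
      exact (F.isClosed hσ).inter (hD.preimage (continuous_sheet b))
  face_mem := by
    rintro _ ⟨b, σ, hσ, rfl⟩ τ hτ
    rw [proj_image_sheet] at hτ
    refine ⟨b, τ, F.face_mem σ hσ τ hτ, ?_⟩
    ext x
    constructor
    · rintro ⟨⟨p, hp, rfl⟩, h⟩
      exact ⟨p, by simpa using h, rfl⟩
    · rintro ⟨p, hp, rfl⟩
      exact ⟨⟨p, hτ.subset hp, rfl⟩, by simpa using hp⟩
  partition := by
    intro x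
    obtain ⟨b, p, rfl⟩ := exists_eq_sheet x
    obtain ⟨σ, hσ, hp⟩ := F.exists_mem_relInt p
    refine ⟨sheet F φ b '' σ, ⟨⟨b, σ, hσ, rfl⟩, ⟨p, hp.1, rfl⟩, ?_⟩, ?_⟩
    · rw [proj_image_sheet]; simpa using hp
    · rintro _ ⟨⟨b', σ', hσ', rfl⟩, ⟨p', hp', h⟩, hr⟩
      rw [proj_image_sheet, proj_sheet] at hr
      obtain rfl := F.eq_of_mem_relInt hσ' hσ hr hp
      obtain ⟨rfl, hZ | rfl⟩ := sheet_eq_iff.1 h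
      · refine Set.image_congr fun t ht => sheet_eq_iff.2 ⟨rfl, Or.inl ?_⟩
        exact subset_gluedLocus hσ hp hZ ht
      · rfl
  weight := weight
  weight_pos := by
    intro x
    unfold weight
    split_ifs <;> norm_num
  weight_const := by
    rintro _ ⟨b, σ, hσ, rfl⟩ x - y - hx hy
    rw [proj_image_sheet] at hx hy
    have : GluedPlanes.proj F φ x ∈ gluedLocus F φ ↔ GluedPlanes.proj F φ y ∈ gluedLocus F φ :=
      ⟨fun h => subset_gluedLocus hσ hx h hy.1, fun h => subset_gluedLocus hσ hy h hx.1⟩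
    classical exact if_congr this rfl rfl
  trace_const := fun U hU hUc y hy p hp q hq => trace_component hU hUc y hy hp hq
  rank := 2
  trace_eq_rank := trace_fiber
  phi := GluedPlanes.phi F φ
  phi_linear := by
    rintro _ ⟨b, σ, hσ, rfl⟩
    obtain ⟨m, hm⟩ := hφ b σ hσ
    refine ⟨m, ?_⟩
    rintro _ ⟨p, hp, rfl⟩
    rw [phi_sheet, proj_sheet, hm p hp]

open TropicalMultisection

theorem isCombUnion_gluedUnion (hφ : ∀ b, IsPiecewiseLinear F (φ b)) :
    IsCombUnion (gluedUnion.{u} F φ hφ) (planeSection F (φ true) (hφ true))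
      (planeSection F (φ false) (hφ false)) := by
  have hglue : ∀ p p' : ULift.{u} Plane, p = p' → p.down ∈ gluedLocus F φ →
      Glue (planeSection.{u} F (φ true) (hφ true)) (planeSection F (φ false) (hφ false))
        (Sum.inl p) (Sum.inr p') := by
    rintro p _ rfl ⟨ρ, hρ, hp, h⟩
    refine ⟨ULift.down ⁻¹' ρ, ⟨ρ, hρ, rfl⟩, ULift.down ⁻¹' ρ, ⟨ρ, hρ, rfl⟩, rfl, ?_, p, hp, p, hp,
      rfl, rfl, rfl⟩
    intro x₁ h₁ x₂ h₂ e
    change x₁.down = x₂.down at e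
    change φ true x₁.down = φ false x₂.down
    rw [← e]; exact h _ h₁
  refine ⟨Quotient.mk (gluedSetoid F φ), isQuotientMap_quotient_mk', ?_, ?_, ?_, ?_, ?_⟩
  · intro x y
    refine Iff.trans (Quotient.eq (r := gluedSetoid F φ)) ?_
    constructor
    · rintro ⟨h1, h2⟩
      rcases x with p | p <;> rcases y with p' | p'
      · rw [show p = p' from ULift.ext _ _ h1]; exact Relation.EqvGen.refl _
      · exact Relation.EqvGen.rel _ _ (hglue p p' (ULift.ext _ _ h1) (h2.resolve_right Bool.noConfusion))
      · refine Relation.EqvGen.symm _ _ (Relation.EqvGen.rel _ _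
          (hglue p' p (ULift.ext _ _ h1.symm) ?_))
        have h2 := h2.resolve_right Bool.noConfusion
        rwa [h1] at h2
      · rw [show p = p' from ULift.ext _ _ h1]; exact Relation.EqvGen.refl _
    · intro h
      induction h with
      | rel x y h =>
        obtain ⟨_, ⟨σ₁, hσ₁, rfl⟩, _, ⟨σ₂, hσ₂, rfl⟩, he, hφe, x₁, h₁, x₂, h₂, e, rfl, rfl⟩ := h
        refine ⟨e, Or.inl ⟨σ₁, hσ₁, h₁, fun p hp => ?_⟩⟩
        have he : σ₁ = σ₂ := by
          rw [← image_down_preimage.{u} σ₁, ← image_down_preimage.{u} σ₂]; exact he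
        exact hφe ⟨p⟩ hp ⟨p⟩ (he ▸ hp) rfl
      | refl x => exact (gluedSetoid F φ).refl x
      | symm x y _ ih => exact (gluedSetoid F φ).symm ih
      | trans x y z _ _ ih ih' => exact (gluedSetoid F φ).trans ih ih'
  · have himg : ∀ (b : Bool) (σ : Set Plane), sheet.{u} F φ b '' σ =
        (fun p : ULift.{u} Plane => sheet F φ b p.down) '' (ULift.down ⁻¹' σ) := by
      intro b σ
      ext x
      constructor
      · rintro ⟨p, hp, rfl⟩; exact ⟨⟨p⟩, hp, rfl⟩
      · rintro ⟨p, hp, rfl⟩; exact ⟨p.down, hp, rfl⟩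
    ext s
    constructor
    · rintro ⟨b, σ, hσ, rfl⟩
      cases b
      · exact Or.inr ⟨ULift.down ⁻¹' σ, ⟨σ, hσ, rfl⟩, himg false σ⟩
      · exact Or.inl ⟨ULift.down ⁻¹' σ, ⟨σ, hσ, rfl⟩, himg true σ⟩
    · rintro (⟨_, ⟨σ, hσ, rfl⟩, rfl⟩ | ⟨_, ⟨σ, hσ, rfl⟩, rfl⟩)
      · exact ⟨true, σ, hσ, (himg true σ).symm⟩
      · exact ⟨false, σ, hσ, (himg false σ).symm⟩
  · rintro (x | x) <;> rfl
  · intro y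
    exact (sum_quotient_fiber y _ (by rintro (x | x) <;> rfl)).symm
  · rintro (x | x) <;> rfl

end union

namespace TropicalMultisection

variable (L : TropicalMultisection.{u} F)

theorem le_refl : Le L L :=
  ⟨id, continuous_id, Function.surjective_id, fun σ' h => ⟨σ', h, by simp⟩, fun _ => rfl,
    fun y => by rw [Set.preimage_id, finsum_mem_singleton], fun _ => rfl⟩

open GluedPlanes in
/-- If the lifts of the maximal cones can be distributed over two sheets such that `φ` induces a
piecewise linear function of the plane on each of them, then a multi-section of rank two lies above
the combinatorial union of these functions. -/
theorem le_gluedUnion (hrank : L.rank = 2) (φ : Bool → Plane → ℝ)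
    (hφ : ∀ b, IsPiecewiseLinear F (φ b)) (c : Bool → Set Plane → Set L.X)
    (hc : ∀ b, ∀ σ ∈ F.dimCones 2, c b σ ∈ L.cones ∧ L.proj '' c b σ = σ ∧
      ∀ x ∈ c b σ, L.phi x = φ b (L.proj x))
    (hall : ∀ σ' ∈ L.cones, L.proj '' σ' ∈ F.dimCones 2 → ∃ b, σ' = c b (L.proj '' σ')) :
    Le (gluedUnion F φ hφ) L := by
  have hside : ∀ x : L.X, ∃ b, ∃ σ ∈ F.dimCones 2, x ∈ c b σ := by
    intro x
    obtain ⟨σ, hσ, hsub⟩ := F.exists_dimCones_two_superset (L.proj_mem _ (L.carrier_mem x))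
    obtain ⟨σ', hσ', rfl, hx⟩ := L.exists_lift_mem hσ
      (hsub (Set.mem_image_of_mem _ (L.mem_carrier x)))
    obtain ⟨b, hb⟩ := hall σ' hσ' hσ
    exact ⟨b, _, hσ, hb ▸ hx⟩
  choose side hside using hside
  have hf : ∀ x b σ, σ ∈ F.dimCones 2 → x ∈ c b σ →
      sheet.{u} F φ (side x) (L.proj x) = sheet F φ b (L.proj x) := by
    intro x b σ hσ hx
    rw [sheet_eq_iff]
    refine ⟨rfl, ?_⟩
    by_cases hb : side x = b
    · exact Or.inr hb
    left
    obtain ⟨σ₁, hσ₁, hx₁⟩ := hside x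
    refine ⟨L.proj '' L.carrier x, L.proj_mem _ (L.carrier_mem x),
      Set.mem_image_of_mem _ (L.mem_carrier x), ?_⟩
    rintro _ ⟨z, hz, rfl⟩
    have h1 := (hc _ σ₁ hσ₁).2.2 z (L.carrier_subset (hc _ σ₁ hσ₁).1 hx₁ hz)
    have h2 := (hc b σ hσ).2.2 z (L.carrier_subset (hc b σ hσ).1 hx hz)
    rw [h1] at h2
    cases hs : side x <;> cases b <;> simp_all
  have hsurj : ∀ b p, ∃ x, L.proj x = p ∧
      sheet.{u} F φ (side x) (L.proj x) = sheet F φ b p := by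
    intro b p
    obtain ⟨τ, hτ, hp⟩ := F.exists_mem_relInt p
    obtain ⟨σ, hσ, hsub⟩ := F.exists_dimCones_two_superset hτ
    have hpσ : p ∈ L.proj '' c b σ := by rw [(hc b σ hσ).2.1]; exact hsub hp.1
    obtain ⟨x, hx, rfl⟩ := hpσ
    exact ⟨x, rfl, hf x b σ hσ hx⟩
  refine ⟨fun x => sheet F φ (side x) (L.proj x), ?_, ?_, ?_, ?_, ?_, ?_⟩
  · refine (continuous_iff_isClosed (Y := GluedPlanes.{u} F φ)).2 fun D hD => ?_
    have : (fun x => sheet.{u} F φ (side x) (L.proj x)) ⁻¹' D =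
        ⋃ b, ⋃ σ ∈ F.dimCones 2, (c b σ ∩ (fun x => sheet F φ b (L.proj x)) ⁻¹' D) := by
      ext x
      simp only [Set.mem_iUnion]
      constructor
      · intro hx
        obtain ⟨σ, hσ, hxσ⟩ := hside x
        exact ⟨side x, σ, hσ, hxσ, hx⟩
      · rintro ⟨b, σ, hσ, hxσ, hx⟩
        rw [Set.mem_preimage, hf x b σ hσ hxσ]; exact hx
    rw [this]
    refine isClosed_iUnion_of_finite fun b => Set.Finite.isClosed_biUnion
      (F.finite.subset fun σ h => h.1) fun σ hσ => ?_
    exact (L.isClosed _ (hc b σ hσ).1).inter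
      (hD.preimage ((continuous_sheet b).comp L.continuous_proj))
  · intro y
    obtain ⟨b, p, rfl⟩ := exists_eq_sheet y
    obtain ⟨x, -, hx⟩ := hsurj b p
    exact ⟨x, hx⟩
  · intro σ' hσ'
    obtain ⟨p, hp⟩ := F.relInt_nonempty (L.proj_mem σ' hσ')
    obtain ⟨x, hx, rfl⟩ := hp.1
    obtain ⟨σ, hσ, hxσ⟩ := hside x
    refine ⟨sheet F φ (side x) '' σ, ⟨side x, σ, hσ.1, rfl⟩, ?_⟩
    rintro _ ⟨z, hz, rfl⟩
    rw [L.eq_carrier hσ' hx hp] at hz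
    have hz' := L.carrier_subset (hc _ σ hσ).1 hxσ hz
    refine ⟨L.proj z, ?_, (hf z _ σ hσ hz').symm⟩
    rw [← (hc (side x) σ hσ).2.1]
    exact Set.mem_image_of_mem _ hz'
  · intro x
    exact proj_sheet (F := F) (φ := φ) _ _
  · intro y
    obtain ⟨b, p, rfl⟩ := exists_eq_sheet y
    change _ = GluedPlanes.weight (sheet.{u} F φ b p)
    by_cases hp : p ∈ gluedLocus F φ
    · have : (fun x => sheet.{u} F φ (side x) (L.proj x)) ⁻¹' {sheet F φ b p} =
          L.proj ⁻¹' {p} := by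
        ext x
        simp only [Set.mem_preimage, Set.mem_singleton_iff, sheet_eq_iff]
        exact ⟨fun h => h.1, fun h => ⟨h, Or.inl (h ▸ hp)⟩⟩
      refine (congrArg (fun s => ∑ᶠ x ∈ s, L.weight x) this).trans ?_
      rw [L.trace_eq_rank, hrank]
      simp [GluedPlanes.weight, hp]
    · obtain ⟨x, hxp, hx⟩ := hsurj b p
      obtain ⟨y, hyp, hy⟩ := hsurj (!b) p
      have hne : y ≠ x := by
        rintro rfl
        rw [hx, sheet_eq_iff] at hy
        simp [hp] at hy
      have : (fun x => sheet.{u} F φ (side x) (L.proj x)) ⁻¹' {sheet F φ b p} = {x} := by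
        ext z
        simp only [Set.mem_preimage, Set.mem_singleton_iff]
        constructor
        · intro hz
          have hzp := (sheet_eq_iff.1 hz).1
          rcases L.eq_of_fiber hrank hne.symm (hyp.trans hxp.symm) (hzp.trans hxp.symm) with h | h
          · exact h
          · rw [h, hy, sheet_eq_iff] at hz
            simp [hp] at hz
        · rintro rfl; exact hx
      refine (congrArg (fun s => ∑ᶠ x ∈ s, L.weight x) this).trans ?_
      rw [finsum_mem_singleton, L.weight_eq_one hrank hne.symm (hyp.trans hxp.symm)]
      simp [GluedPlanes.weight, hp]
  · intro x
    obtain ⟨σ, hσ, hx⟩ := hside x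
    rw [(hc _ σ hσ).2.2 x hx]
    exact phi_sheet (F := F) (φ := φ) _ _

/-- The combinatorial union of the functions on the two sheets is a common lower bound of itself and
`L`. -/
theorem not_combIndecomposable_of_sheets (hrank : L.rank = 2) (φ : Bool → Plane → ℝ)
    (hφ : ∀ b, IsPiecewiseLinear F (φ b)) (c : Bool → Set Plane → Set L.X)
    (hc : ∀ b, ∀ σ ∈ F.dimCones 2, c b σ ∈ L.cones ∧ L.proj '' c b σ = σ ∧
      ∀ x ∈ c b σ, L.phi x = φ b (L.proj x))
    (hall : ∀ σ' ∈ L.cones, L.proj '' σ' ∈ F.dimCones 2 → ∃ b, σ' = c b (L.proj '' σ')) :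
    ¬ L.CombIndecomposable := by
  rintro ⟨hconn, hdec⟩
  have hle := L.le_gluedUnion hrank φ hφ c hc hall
  refine hdec ⟨planeSection F (φ true) (hφ true), planeSection F (φ false) (hφ false),
    gluedUnion F φ hφ, planeSection_connected _ _, planeSection_connected _ _,
    isCombUnion_gluedUnion F φ hφ, Relation.ReflTransGen.single ⟨hconn, ?_, hrank, _, hle,
      le_refl _⟩⟩
  obtain ⟨f, hf, hs, -⟩ := hle
  have : ConnectedSpace L.X := hconn
  exact hs.connectedSpace hf

end TropicalMultisection

end TropLag

namespace TropLag

namespace TropicalMultisection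

variable {F : CompleteFan} {L : TropicalMultisection.{u} F}

/-! ### Anti-clockwise arrangements -/

namespace Arrangement

variable (A : L.Arrangement)

theorem k_pos : 0 < A.k := by
  obtain ⟨σ, hσ⟩ := F.dimCones_two_nonempty
  obtain ⟨σ', h, rfl⟩ := L.exists_lift hσ.1
  obtain ⟨i, hi, -⟩ := A.bijOn.surjOn ⟨h, hσ.2⟩
  have := hi.1.trans hi.2
  omega

theorem seq_mod (i : ℕ) : A.seq (i % (2 * A.k)) = A.seq i := by
  conv_rhs => rw [← Nat.mod_add_div i (2 * A.k)]
  generalize i / (2 * A.k) = n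
  induction n with
  | zero => simp
  | succ n ih => rw [mul_add, mul_one, ← add_assoc, A.periodic, ih]

theorem exists_Icc (i : ℕ) : ∃ j ∈ Set.Icc 1 (2 * A.k), A.seq j = A.seq i ∧
    j % (2 * A.k) = i % (2 * A.k) := by
  have hk := A.k_pos
  rcases Nat.eq_zero_or_pos (i % (2 * A.k)) with h | h
  · refine ⟨2 * A.k, ⟨by omega, le_rfl⟩, ?_, by simp [h]⟩
    rw [← A.seq_mod, ← A.seq_mod i, h, Nat.mod_self]
  · exact ⟨i % (2 * A.k), ⟨h, (Nat.mod_lt _ (by omega)).le⟩, A.seq_mod i, by simp⟩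

theorem seq_mem (i : ℕ) : A.seq i ∈ L.dimCones 2 := by
  obtain ⟨j, hj, e, -⟩ := A.exists_Icc i
  rw [← e]; exact A.bijOn.mapsTo hj

theorem modEq_of_seq_eq {i j : ℕ} (h : A.seq i = A.seq j) : i ≡ j [MOD 2 * A.k] := by
  obtain ⟨i', hi, e, h1⟩ := A.exists_Icc i
  obtain ⟨j', hj, e', h2⟩ := A.exists_Icc j
  have := A.bijOn.injOn hi hj (e.trans (h.trans e'.symm))
  rw [Nat.ModEq, ← h1, ← h2, this]

theorem seq_ne (i : ℕ) : A.seq i ≠ A.seq (i + A.k) := fun h => by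
  have h1 := A.modEq_of_seq_eq h
  have h2 : 0 ≡ A.k [MOD 2 * A.k] := Nat.ModEq.add_left_cancel' i (by simpa using h1)
  have := Nat.le_of_dvd A.k_pos ((Nat.modEq_zero_iff_dvd).1 h2.symm)
  have := A.k_pos
  omega

theorem seq_add_k_add_k (i : ℕ) : A.seq (i + A.k + A.k) = A.seq i := by
  rw [add_assoc, ← two_mul, A.periodic]

/-- The maximal cone of the fan below the `i`-th cone of an arrangement. -/
def base (i : ℕ) : Set Plane := L.proj '' A.seq i

theorem base_mem (i : ℕ) : A.base i ∈ F.dimCones 2 :=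
  ⟨L.proj_mem _ (A.seq_mem i).1, (A.seq_mem i).2⟩

theorem base_add_k (i : ℕ) : A.base (i + A.k) = A.base i := A.same_base i

theorem exists_sector (i : ℕ) :
    ∃ u v w, IsSector (A.base i) u v ∧ IsSector (A.base (i + 1)) v w :=
  (A.next i).exists_sector (A.seq_mem i) (A.seq_mem (i + 1))

theorem succeeds (i : ℕ) : Succeeds (A.base i) (A.base (i + 1)) := A.exists_sector i

theorem exists_base_eq {σ : Set Plane} (hσ : σ ∈ F.dimCones 2) :
    ∃ i, 1 ≤ i ∧ i ≤ A.k ∧ A.base i = σ := by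
  obtain ⟨σ', h, rfl⟩ := L.exists_lift hσ.1
  obtain ⟨i, hi, rfl⟩ := A.bijOn.surjOn ⟨h, hσ.2⟩
  have h1 := hi.1
  have h2 := hi.2
  by_cases hik : i ≤ A.k
  · exact ⟨i, hi.1, hik, rfl⟩
  · refine ⟨i - A.k, by omega, by omega, ?_⟩
    rw [← A.base_add_k, Nat.sub_add_cancel (by omega)]
    rfl

theorem eq_seq (hrank : L.rank = 2) {σ' : Set L.X} {i : ℕ} (h : σ' ∈ L.cones) (hb : L.proj '' σ' = A.base i) :
    σ' = A.seq i ∨ σ' = A.seq (i + A.k) :=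
  L.eq_of_lift hrank (A.seq_mem i).1 (A.seq_mem _).1 h (A.seq_ne i) (A.same_base i) hb

/-- The cone `σ' = seq i` receives wall-crossing terms from the other lift of its base when its last
ray is crossed: the slope of the other lift minus the slope of `σ'` is non-negative on the ray. -/
def Moves (i : ℕ) : Prop :=
  InDual (L.slope (A.seq (i + A.k)) - L.slope (A.seq i)) (A.base i ∩ A.base (i + 1))

theorem inDual_ray {m : DualLattice} {v : Plane} : InDual m (ray v) ↔ 0 ≤ pairing m v := by
  constructor
  · exact fun h => h v (mem_ray_self v)
  · rintro h _ ⟨t, ht, rfl⟩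
    rw [pairing_smul]; exact mul_nonneg ht h

/-- The function `φ` at the two points over a generator of the last ray of `base i`. -/
theorem exists_ray_points (i : ℕ) : ∃ (v : Plane) (x y : L.X), v ≠ 0 ∧
    A.base i ∩ A.base (i + 1) = ray v ∧ ray v ∈ F.cones ∧
    x ∈ A.seq i ∧ x ∈ A.seq (i + 1) ∧ y ∈ A.seq (i + A.k) ∧ y ∈ A.seq (i + 1 + A.k) ∧
    L.proj x = v ∧ L.proj y = v := by
  obtain ⟨u, v, w, h1, h2⟩ := A.exists_sector i
  have hi := F.inter_eq_ray (A.base_mem i).1 (A.base_mem (i + 1)).1 h1 h2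
  have hray : ray v ∈ F.cones := F.face_mem _ (A.base_mem i).1 _ h1.isFace_right
  obtain ⟨x, hx, hxv⟩ := (L.inter_mem_dimCones_one_iff (A.seq_mem i).1 (A.seq_mem (i + 1)).1
    h1.right_ne_zero hray hi).1 (A.next i).1
  have hk := A.next (i + A.k)
  rw [add_right_comm] at hk
  have hi' := hi
  rw [← A.base_add_k i, ← A.base_add_k (i + 1)] at hi'
  obtain ⟨y, hy, hyv⟩ := (L.inter_mem_dimCones_one_iff (A.seq_mem _).1 (A.seq_mem _).1
    h1.right_ne_zero hray hi').1 hk.1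
  exact ⟨v, x, y, h1.right_ne_zero, hi, hray, hx.1, hx.2, hy.1, hy.2, hxv, hyv⟩

theorem moves_iff {i : ℕ} {v : Plane} {x y : L.X} (hi : A.base i ∩ A.base (i + 1) = ray v)
    (hx : x ∈ A.seq i) (hy : y ∈ A.seq (i + A.k)) (hxv : L.proj x = v) (hyv : L.proj y = v) :
    A.Moves i ↔ L.phi x ≤ L.phi y := by
  rw [Moves, hi, inDual_ray, pairing_sub, L.slope_spec (A.seq_mem i).1 x hx,
    L.slope_spec (A.seq_mem (i + A.k)).1 y hy, hxv, hyv, sub_nonneg]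

theorem moves_add_two_k (i : ℕ) : A.Moves (i + A.k + A.k) ↔ A.Moves i := by
  unfold Moves
  rw [A.seq_add_k_add_k, A.seq_add_k_add_k, A.base_add_k, A.base_add_k, add_right_comm _ A.k 1,
    A.base_add_k, add_right_comm _ A.k 1, A.base_add_k]

theorem moves_or (i : ℕ) : A.Moves i ∨ A.Moves (i + A.k) := by
  obtain ⟨v, x, y, -, hi, -, hx, -, hy, -, hxv, hyv⟩ := A.exists_ray_points i
  have hi' := hi
  rw [← A.base_add_k i, ← A.base_add_k (i + 1), add_right_comm] at hi'
  have hx' : x ∈ A.seq (i + A.k + A.k) := by rwa [A.seq_add_k_add_k]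
  rw [A.moves_iff hi hx hy hxv hyv, A.moves_iff hi' hy hx' hyv hxv]
  exact le_total _ _

theorem inDual_next_iff {i : ℕ} (m : DualLattice) :
    InDual (m - L.slope (A.seq (i + 1))) (A.base i ∩ A.base (i + 1)) ↔
      InDual (m - L.slope (A.seq i)) (A.base i ∩ A.base (i + 1)) := by
  obtain ⟨v, x, y, -, hi, -, hx, hx', -, -, hxv, -⟩ := A.exists_ray_points i
  rw [hi, inDual_ray, inDual_ray, pairing_sub, pairing_sub]
  have h1 := L.slope_spec (A.seq_mem i).1 x hx
  have h2 := L.slope_spec (A.seq_mem (i + 1)).1 x hx'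
  rw [hxv] at h1 h2
  rw [← h1, ← h2]

/-- The two entries `∞` and `m` of a slope matrix are told apart by the monomial matrix. -/
theorem monomialMatrix_ne_zero_iff (i j : ℕ) (α β : Fin 2) :
    monomialMatrix (A.slopeMatrix i j) β α ≠ 0 ↔
      InDual (L.slope (A.cone i α) - L.slope (A.cone j β))
        (L.proj '' A.cone i α ∩ L.proj '' A.cone j β) := by
  simp only [monomialMatrix, slopeMatrix, Matrix.map_apply, Matrix.of_apply, slopeEntry]
  split_ifs with h
  · simp only [h, iff_true]
    change mono _ 1 ≠ 0
    simp [mono]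
  · simp only [h, iff_false, not_not]
    rfl

theorem isUpper_iff (i : ℕ) :
    IsUpper (A.slopeMatrix i (i + 1)) ↔ ¬ A.Moves (i + A.k) := by
  have h1 : IsUpper (A.slopeMatrix i (i + 1)) ↔
      monomialMatrix (A.slopeMatrix i (i + 1)) 1 0 = 0 := by
    refine ⟨fun h => h 1 0 (by decide), fun h a b hab => ?_⟩
    obtain ⟨rfl, rfl⟩ : a = 1 ∧ b = 0 := by omega
    exact h
  rw [h1, ← not_iff_not, not_not, ← ne_eq, A.monomialMatrix_ne_zero_iff]
  simp only [cone, Fin.val_zero, zero_mul, add_zero, Fin.val_one, one_mul]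
  have e : i + 1 + A.k = i + A.k + 1 := by ring
  have := A.inDual_next_iff (i := i + A.k) (L.slope (A.seq i))
  change InDual _ (A.base i ∩ A.base (i + 1 + A.k)) ↔ _
  rw [Moves, A.seq_add_k_add_k, ← this, ← e, A.base_add_k, A.base_add_k]

theorem isLower_iff (i : ℕ) : IsLower (A.slopeMatrix i (i + 1)) ↔ ¬ A.Moves i := by
  have h1 : IsLower (A.slopeMatrix i (i + 1)) ↔
      monomialMatrix (A.slopeMatrix i (i + 1)) 0 1 = 0 := by
    refine ⟨fun h => h 0 1 (by decide), fun h a b hab => ?_⟩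
    obtain ⟨rfl, rfl⟩ : a = 0 ∧ b = 1 := by omega
    exact h
  rw [h1, ← not_iff_not, not_not, ← ne_eq, A.monomialMatrix_ne_zero_iff]
  simp only [cone, Fin.val_zero, zero_mul, add_zero, Fin.val_one, one_mul]
  change InDual _ (A.base (i + A.k) ∩ A.base (i + 1)) ↔ _
  rw [Moves, ← A.inDual_next_iff, A.base_add_k]

theorem slopeMatrix_k_one (α β : Fin 2) : monomialMatrix (A.slopeMatrix A.k 1) β α ≠ 0 ↔
    InDual (L.slope (A.seq (A.k + α * A.k)) - L.slope (A.seq (A.k + (β + 1 : ℕ) * A.k)))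
      (A.base A.k ∩ A.base (A.k + 1)) := by
  rw [A.monomialMatrix_ne_zero_iff]
  have key : ∀ m, InDual (m - L.slope (A.cone 1 β)) (A.base A.k ∩ A.base (A.k + 1)) ↔
      InDual (m - L.slope (A.seq (A.k + (β + 1 : ℕ) * A.k))) (A.base A.k ∩ A.base (A.k + 1)) := by
    intro m
    have h := A.inDual_next_iff (i := A.k + (β + 1 : ℕ) * A.k) m
    have e1 : A.base (A.k + (β + 1 : ℕ) * A.k) = A.base A.k := by
      fin_cases β
      · simp [A.base_add_k]
      · simp [two_mul, ← add_assoc, A.base_add_k]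
    have e2 : A.base (A.k + (β + 1 : ℕ) * A.k + 1) = A.base (A.k + 1) := by
      fin_cases β
      · rw [add_right_comm]; simp [A.base_add_k]
      · rw [add_right_comm]; simp [two_mul, ← add_assoc, A.base_add_k]
    have e3 : A.seq (A.k + (β + 1 : ℕ) * A.k + 1) = A.cone 1 β := by
      rw [show A.k + ((β : ℕ) + 1) * A.k + 1 = 1 + β * A.k + 2 * A.k by ring, A.periodic]; rfl
    rwa [e1, e2, e3] at h
  rw [← key]
  have e1 : L.proj '' A.cone A.k α = A.base A.k := by
    change A.base (A.k + α * A.k) = _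
    fin_cases α <;> simp [A.base_add_k]
  have e2 : L.proj '' A.cone 1 β = A.base (A.k + 1) := by
    change A.base (1 + β * A.k) = _
    rw [add_comm A.k 1, A.base_add_k]
    fin_cases β <;> simp [A.base_add_k]
  rw [e1, e2]
  rfl

/-- A normalized arrangement in terms of the sheets that receive wall-crossing terms. -/
theorem normalized_iff : A.Normalized ↔ ¬ A.Moves A.k ∧
    ∀ i, 1 ≤ i → i ≤ A.k → ¬ (A.Moves i ∧ A.Moves (i + A.k)) := by
  have h00 := A.slopeMatrix_k_one 0 0
  have h01 := A.slopeMatrix_k_one 1 0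
  have h10 := A.slopeMatrix_k_one 0 1
  have h11 := A.slopeMatrix_k_one 1 1
  have hself : ∀ m : DualLattice, InDual (m - m) (A.base A.k ∩ A.base (A.k + 1)) := by
    intro m x _; simp [pairing]
  have h2k : A.seq (A.k + 2 * A.k) = A.seq A.k := A.periodic _
  simp only [Fin.val_zero, Fin.val_one, zero_add, one_add_one_eq_two, zero_mul, one_mul, add_zero,
    h2k] at h00 h01 h10 h11
  have h00' : A.Moves (A.k + A.k) ↔ InDual (L.slope (A.seq A.k) - L.slope (A.seq (A.k + A.k)))
      (A.base A.k ∩ A.base (A.k + 1)) := by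
    rw [Moves, A.seq_add_k_add_k, A.base_add_k, add_right_comm, A.base_add_k]
  have e11 : (monomialMatrix (A.slopeMatrix A.k 1) 1 1 = 0) ↔ ¬ A.Moves A.k := by
    rw [← not_iff_not, not_not]; exact h11
  rw [Normalized, e11]
  simp only [h00, h01, h10, hself, true_and, ← h00', A.isUpper_iff, A.isLower_iff]
  constructor
  · rintro ⟨⟨h1, h2⟩, h3⟩
    refine ⟨h2, fun i hi hik ⟨ha, hb⟩ => ?_⟩
    rcases Nat.lt_or_ge i A.k with hlt | hge
    · rcases h3 i hi hlt with h | h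
      exacts [h hb, h ha]
    · obtain rfl : i = A.k := by omega
      exact h2 ha
  · rintro ⟨h1, h2⟩
    refine ⟨⟨(A.moves_or A.k).resolve_left h1, h1⟩, fun i hi hik => ?_⟩
    exact (not_and_or.1 (h2 i hi hik.le)).symm

/-- The slope condition asks that the second sheet moves before the first one does. -/
theorem slopeCondition_iff (hA : A.Normalized) : A.SlopeCondition ↔
    ∃ i j, 1 ≤ i ∧ i < j ∧ j < A.k ∧ A.Moves (i + A.k) ∧ A.Moves j := by
  obtain ⟨hk, hn⟩ := A.normalized_iff.1 hA
  have key : ∀ i, 1 ≤ i → i ≤ A.k → (¬ A.Moves i ↔ A.Moves (i + A.k)) := fun i h1 h2 =>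
    ⟨(A.moves_or i).resolve_left, fun hb ha => hn i h1 h2 ⟨ha, hb⟩⟩
  have hkp := A.k_pos
  rw [SlopeCondition]
  by_cases hk1 : A.k = 1
  · rw [hk1]
    constructor
    · rintro (⟨-, i, h1, h2, -⟩ | ⟨-, i, j, h1, h2, h3, -⟩) <;> omega
    · rintro ⟨i, j, h1, h2, h3, -⟩; omega
  have e : A.slopeMatrix (A.k - 1) A.k = A.slopeMatrix (A.k - 1) (A.k - 1 + 1) := by
    rw [Nat.sub_add_cancel hkp]
  simp only [e, A.isUpper_iff, A.isLower_iff]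
  constructor
  · rintro (⟨h, i, h1, h2, h3⟩ | ⟨h, i, j, h1, h2, h3, h4, h5⟩)
    · refine ⟨i, A.k - 1, h1, h2, by omega, (key i h1 (by omega)).1 h3, ?_⟩
      exact not_not.1 fun hm => h ((key (A.k - 1) (by omega) (by omega)).1 hm)
    · refine ⟨i, j, h1, h2, by omega, (key i h1 (by omega)).1 h5, ?_⟩
      exact not_not.1 fun hm => h4 ((key j (by omega) (by omega)).1 hm)
  · rintro ⟨i, j, h1, h2, h3, h4, h5⟩
    have ki := key i h1 (by omega)
    have kj := key j (by omega) (by omega)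
    have kk := key (A.k - 1) (by omega) (by omega)
    by_cases hm : A.Moves (A.k - 1)
    · exact Or.inl ⟨fun h => kk.2 h hm, i, h1, by omega, ki.2 h4⟩
    · have : j ≠ A.k - 1 := by rintro rfl; exact hm h5
      exact Or.inr ⟨hm, i, j, h1, h2, by omega, fun h => kj.2 h h5, ki.2 h4⟩

end Arrangement

end TropicalMultisection

end TropLag

namespace TropLag

namespace TropicalMultisection

variable {F : CompleteFan} (L : TropicalMultisection.{u} F)

/-! ### Labellings of the lifts, and the existence of a normalized arrangement -/

theorem phi_eq_zero {x : L.X} (hx : L.proj x = 0) : L.phi x = 0 := by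
  rw [L.slope_spec (L.carrier_mem x) x (L.mem_carrier x), hx, pairing_zero]

/-- A choice of a lift of every maximal cone on each of two sheets decomposes `L`, as soon as the
values of `φ` on each sheet fit together along the rays. -/
theorem not_combIndecomposable_of_labelling (hrank : L.rank = 2) (C : Bool → Set Plane → Set L.X)
    (hC : ∀ b, ∀ σ ∈ F.dimCones 2, C b σ ∈ L.cones ∧ L.proj '' C b σ = σ)
    (hall : ∀ σ' ∈ L.cones, L.proj '' σ' ∈ F.dimCones 2 → ∃ b, σ' = C b (L.proj '' σ'))
    (hcompat : ∀ b, ∀ σ ∈ F.dimCones 2, ∀ σ' ∈ F.dimCones 2, Succeeds σ σ' →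
      ∀ x ∈ C b σ, ∀ y ∈ C b σ', L.proj x = L.proj y → L.phi x = L.phi y) :
    ¬ L.CombIndecomposable := by
  have hsup : ∀ p : Plane, ∃ σ ∈ F.dimCones 2, p ∈ σ := by
    intro p
    obtain ⟨τ, hτ, hp⟩ := F.exists_mem_relInt p
    obtain ⟨σ, hσ, hsub⟩ := F.exists_dimCones_two_superset hτ
    exact ⟨σ, hσ, hsub hp.1⟩
  choose sup hsup hmem using hsup
  have hpt : ∀ b p, ∃ x ∈ C b (sup p), L.proj x = p := by
    intro b p
    have h := hmem p
    rw [← (hC b _ (hsup p)).2] at h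
    exact h
  choose pt hpt hproj using hpt
  have hval : ∀ b, ∀ σ ∈ F.dimCones 2, ∀ x ∈ C b σ, L.phi x = L.phi (pt b (L.proj x)) := by
    intro b σ hσ x hx
    by_cases h0 : L.proj x = 0
    · rw [L.phi_eq_zero h0, L.phi_eq_zero (by rw [hproj, h0])]
    have hxσ : L.proj x ∈ σ := by
      have := Set.mem_image_of_mem L.proj hx
      rwa [(hC b σ hσ).2] at this
    rcases F.eq_or_succeeds hσ (hsup (L.proj x)) h0 hxσ (hmem _) with h | h | h
    · have hp := hpt b (L.proj x)
      rw [← h] at hp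
      rw [L.injOn_proj (hC b σ hσ).1 hx hp (hproj _ _).symm, hproj]
    · exact hcompat b σ hσ _ (hsup _) h x hx _ (hpt _ _) (hproj _ _).symm
    · exact (hcompat b _ (hsup _) σ hσ h _ (hpt _ _) x hx (hproj _ _)).symm
  refine L.not_combIndecomposable_of_sheets hrank (fun b p => L.phi (pt b p)) ?_ C
    (fun b σ hσ => ⟨(hC b σ hσ).1, (hC b σ hσ).2, hval b σ hσ⟩) hall
  intro b σ hσ
  obtain ⟨σ₂, hσ₂, hsub⟩ := F.exists_dimCones_two_superset hσ
  refine ⟨L.slope (C b σ₂), fun p hp => ?_⟩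
  have hp' : p ∈ L.proj '' C b σ₂ := by rw [(hC b σ₂ hσ₂).2]; exact hsub hp
  obtain ⟨x, hx, rfl⟩ := hp'
  refine (hval b σ₂ hσ₂ x hx).symm.trans ?_
  exact L.slope_spec (hC b σ₂ hσ₂).1 x hx

/-- A labelling of the lifts of `σ` by the two sheets; a single lift gets both labels. -/
def IsLabelling (σ : Set Plane) (d : Bool → Set L.X) : Prop :=
  (∀ b, d b ∈ L.cones ∧ L.proj '' d b = σ) ∧
    ∀ σ' ∈ L.cones, L.proj '' σ' = σ → ∃ b, σ' = d b

variable {L}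

theorem isLabelling_pair (hrank : L.rank = 2) {σ : Set Plane} {a b : Set L.X} (ha : a ∈ L.cones)
    (hb : b ∈ L.cones) (hab : a ≠ b) (haσ : L.proj '' a = σ) (hbσ : L.proj '' b = σ) :
    L.IsLabelling σ fun t => if t then a else b := by
  refine ⟨fun t => by cases t <;> simp [ha, hb, haσ, hbσ], fun c hc hcσ => ?_⟩
  rcases L.eq_of_lift hrank ha hb hc hab (hbσ.trans haσ.symm) (hcσ.trans haσ.symm) with h | h
  · exact ⟨true, by simpa using h⟩
  · exact ⟨false, by simpa using h⟩

variable (L) in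
theorem exists_isLabelling (hrank : L.rank = 2) {σ : Set Plane} (hσ : σ ∈ F.cones) :
    ∃ d, L.IsLabelling σ d := by
  obtain ⟨a, ha, haσ⟩ := L.exists_lift hσ
  by_cases h : ∃ b ∈ L.cones, L.proj '' b = σ ∧ a ≠ b
  · obtain ⟨b, hb, hbσ, hab⟩ := h
    exact ⟨_, isLabelling_pair hrank ha hb hab haσ hbσ⟩
  · push Not at h
    exact ⟨fun _ => a, fun _ => ⟨ha, haσ⟩, fun c hc hcσ => ⟨true, (h c hc hcσ).symm⟩⟩

theorem IsLabelling.exists_mem {σ : Set Plane} {d : Bool → Set L.X} (h : L.IsLabelling σ d)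
    (hσ : σ ∈ F.dimCones 2) {x : L.X} (hx : L.proj x ∈ σ) : ∃ b, x ∈ d b := by
  obtain ⟨σ', hσ', hp, hxσ'⟩ := L.exists_lift_mem hσ hx
  obtain ⟨b, rfl⟩ := h.2 σ' hσ' hp
  exact ⟨b, hxσ'⟩

/-- A labelling can be continued across a ray. -/
theorem IsLabelling.exists_next (hrank : L.rank = 2) {σ σ' : Set Plane} {d : Bool → Set L.X}
    (hd : L.IsLabelling σ d) (hσ : σ ∈ F.dimCones 2) (hσ' : σ' ∈ F.dimCones 2)
    (hs : Succeeds σ σ') : ∃ d', L.IsLabelling σ' d' ∧ ∀ b, d b ∩ d' b ∈ L.dimCones 1 := by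
  obtain ⟨u, v, w, h1, h2⟩ := hs
  have hi := F.inter_eq_ray hσ.1 hσ'.1 h1 h2
  have hray : ray v ∈ F.cones := F.face_mem _ hσ.1 _ h1.isFace_right
  have key : ∀ d', L.IsLabelling σ' d' → (∀ b, ∃ x ∈ d b ∩ d' b, L.proj x = v) →
      ∃ d', L.IsLabelling σ' d' ∧ ∀ b, d b ∩ d' b ∈ L.dimCones 1 := fun d' hd' h =>
    ⟨d', hd', fun b => (L.inter_mem_dimCones_one_iff (hd.1 b).1 (hd'.1 b).1 h1.right_ne_zero hray
      (by rw [(hd.1 b).2, (hd'.1 b).2, hi])).2 (h b)⟩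
  have hpt : ∀ b, ∃ x ∈ d b, L.proj x = v := by
    intro b
    have h := h1.right_mem
    rw [← (hd.1 b).2] at h
    exact h
  choose x hx hxv using hpt
  by_cases he : x true = x false
  · obtain ⟨d', hd'⟩ := L.exists_isLabelling hrank hσ'.1
    refine key d' hd' fun b => ?_
    have h := h2.left_mem
    rw [← (hd'.1 b).2] at h
    obtain ⟨y, hy, hyv⟩ := h
    obtain ⟨b', hb'⟩ := hd.exists_mem hσ (x := y) (by rw [hyv]; exact h1.right_mem)
    have hxy : y = x b' := L.injOn_proj (hd.1 b').1 hb' (hx b') (by rw [hyv, hxv])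
    have hyb : y = x b := by
      rw [hxy]; cases b <;> cases b' <;> first | rfl | exact he | exact he.symm
    exact ⟨y, ⟨hyb ▸ hx b, hy⟩, hyv⟩
  · have hlift : ∀ b, ∃ c ∈ L.cones, L.proj '' c = σ' ∧ x b ∈ c := fun b =>
      L.exists_lift_mem hσ' (by rw [hxv]; exact h2.left_mem)
    choose c hc hcσ hxc using hlift
    have hne : c true ≠ c false := fun h =>
      he (L.injOn_proj (hc false) (h ▸ hxc true) (hxc false) (by rw [hxv, hxv]))
    refine key _ (isLabelling_pair hrank (hc true) (hc false) hne (hcσ _) (hcσ _)) fun b => ?_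
    exact ⟨x b, ⟨hx b, by cases b <;> simp [hxc]⟩, hxv b⟩

theorem IsLabelling.eq_or_eq_not {σ : Set Plane} {d d' : Bool → Set L.X} (h : L.IsLabelling σ d)
    (h' : L.IsLabelling σ d') : (∀ b, d b = d' b) ∨ ∀ b, d b = d' (!b) := by
  obtain ⟨b₁, e₁⟩ := h'.2 _ (h.1 true).1 (h.1 true).2
  obtain ⟨b₂, e₂⟩ := h'.2 _ (h.1 false).1 (h.1 false).2
  obtain ⟨b₃, e₃⟩ := h.2 _ (h'.1 true).1 (h'.1 true).2
  obtain ⟨b₄, e₄⟩ := h.2 _ (h'.1 false).1 (h'.1 false).2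
  simp only [Bool.forall_bool, Bool.not_false, Bool.not_true]
  cases b₁ <;> cases b₂ <;> cases b₃ <;> cases b₄ <;> grind

variable (L) in
/-- `φ` takes a single value over each point of the common face of `σ` and `σ'`. -/
def Agree (σ σ' : Set Plane) : Prop :=
  ∀ x y, L.proj x = L.proj y → L.proj x ∈ σ → L.proj x ∈ σ' → L.phi x = L.phi y

theorem exists_of_not_agree {σ σ' : Set Plane} (hσ : σ ∈ F.dimCones 2) (hσ' : σ' ∈ F.dimCones 2)
    (hs : Succeeds σ σ') (h : ¬ L.Agree σ σ') : ∃ x y, L.proj x ≠ 0 ∧ L.proj y = L.proj x ∧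
      σ ∩ σ' = ray (L.proj x) ∧ ray (L.proj x) ∈ F.cones ∧ x ≠ y := by
  simp only [Agree, not_forall] at h
  obtain ⟨x, y, hxy, hx, hx', hne⟩ := h
  have h0 : L.proj x ≠ 0 := fun h0 =>
    hne (by rw [L.phi_eq_zero h0, L.phi_eq_zero (hxy ▸ h0)])
  obtain ⟨u, v, w, h1, h2⟩ := hs
  have hi := F.inter_eq_ray hσ.1 hσ'.1 h1 h2
  have hmem : L.proj x ∈ σ ∩ σ' := ⟨hx, hx'⟩
  rw [hi] at hmem
  obtain ⟨t, ht, he⟩ := hmem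
  have ht : 0 < t := lt_of_le_of_ne ht (by rintro rfl; simp [he] at h0)
  refine ⟨x, y, h0, hxy.symm, ?_, ?_, fun h => hne (by rw [h])⟩
  · rw [hi, he, ray_smul ht]
  · rw [he, ray_smul ht]; exact F.face_mem _ hσ.1 _ h1.isFace_right

theorem IsLabelling.true_ne_false {σ σ' : Set Plane} {d : Bool → Set L.X} (hd : L.IsLabelling σ d)
    (hσ : σ ∈ F.dimCones 2) (hσ' : σ' ∈ F.dimCones 2) (hs : Succeeds σ σ')
    (h : ¬ L.Agree σ σ') : d true ≠ d false := by
  intro he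
  obtain ⟨x, y, -, hxy, hi, -, hne⟩ := exists_of_not_agree hσ hσ' hs h
  have hx : L.proj x ∈ σ := by
    have := mem_ray_self (L.proj x)
    rw [← hi] at this
    exact this.1
  obtain ⟨b, hb⟩ := hd.exists_mem hσ hx
  obtain ⟨b', hb'⟩ := hd.exists_mem hσ (x := y) (by rwa [hxy])
  have : d b = d b' := by cases b <;> cases b' <;> simp [he]
  exact hne (L.injOn_proj (hd.1 b').1 (this ▸ hb) hb' hxy.symm)

theorem proj_inter_of_succeeds {σ σ' : Set Plane} {a b : Set L.X} (ha : a ∈ L.cones)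
    (hb : b ∈ L.cones) (haσ : L.proj '' a = σ) (hbσ : L.proj '' b = σ') (hs : Succeeds σ σ')
    (h : a ∩ b ∈ L.dimCones 1) : L.proj '' (a ∩ b) = σ ∩ σ' := by
  obtain ⟨u, v, w, h1, h2⟩ := hs
  have hi := F.inter_eq_ray (haσ ▸ L.proj_mem a ha) (hbσ ▸ L.proj_mem b hb) h1 h2
  rw [hi]
  exact L.proj_inter (by rw [haσ, hbσ, hi]) h

theorem eq_of_adjacent {σ σ' : Set Plane} {a b x y} (ha : a ∈ L.cones)
    (hb : b ∈ L.cones) (haσ : L.proj '' a = σ) (hbσ : L.proj '' b = σ') (hs : Succeeds σ σ')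
    (h : a ∩ b ∈ L.dimCones 1) (hx : x ∈ a) (hy : y ∈ b) (hxy : L.proj x = L.proj y) : x = y := by
  have : L.proj x ∈ L.proj '' (a ∩ b) := by
    rw [proj_inter_of_succeeds ha hb haσ hbσ hs h, ← haσ, ← hbσ]
    exact ⟨Set.mem_image_of_mem _ hx, hxy ▸ Set.mem_image_of_mem _ hy⟩
  obtain ⟨z, hz, hzx⟩ := this
  rw [← L.injOn_proj ha hz.1 hx hzx]
  exact L.injOn_proj hb hz.2 hy (hzx.trans hxy)

/-- Where the two lifts of a ray are distinct, the lift on the other side of the ray is unique. -/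
theorem adjacent_unique (hrank : L.rank = 2) {σ σ' : Set Plane} {a b b' : Set L.X}
    (hσ : σ ∈ F.dimCones 2) (hσ' : σ' ∈ F.dimCones 2) (hs : Succeeds σ σ')
    (hna : ¬ L.Agree σ σ') (ha : a ∈ L.cones) (hb : b ∈ L.cones) (hb' : b' ∈ L.cones)
    (haσ : L.proj '' a = σ) (hbσ : L.proj '' b = σ') (hbσ' : L.proj '' b' = σ')
    (h : a ∩ b ∈ L.dimCones 1) (h' : a ∩ b' ∈ L.dimCones 1) : b = b' := by
  by_contra hne
  obtain ⟨x, y, h0, hyx, hi, -, hxy⟩ := exists_of_not_agree hσ hσ' hs hna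
  have hp : L.proj x ∈ σ ∩ σ' := by rw [hi]; exact mem_ray_self _
  obtain ⟨z, hz, hzx⟩ : L.proj x ∈ L.proj '' a := by rw [haσ]; exact hp.1
  obtain ⟨t, ht, htx⟩ : L.proj x ∈ L.proj '' b := by rw [hbσ]; exact hp.2
  obtain ⟨t', ht', htx'⟩ : L.proj x ∈ L.proj '' b' := by rw [hbσ']; exact hp.2
  have e1 := eq_of_adjacent ha hb haσ hbσ hs h hz ht (hzx.trans htx.symm)
  have e2 := eq_of_adjacent ha hb' haσ hbσ' hs h' hz ht' (hzx.trans htx'.symm)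
  -- every point over `proj x` is `z`, as both lifts of `σ'` pass through `z`
  have key : ∀ s : L.X, L.proj s = L.proj x → s = z := by
    intro s hs'
    obtain ⟨c, hc, hcσ, hsc⟩ := L.exists_lift_mem hσ' (y := s) (by rw [hs']; exact hp.2)
    rcases L.eq_of_lift hrank hb hb' hc hne (hbσ'.trans hbσ.symm) (hcσ.trans hbσ.symm) with rfl | rfl
    · exact L.injOn_proj hc hsc (e1 ▸ ht) (hs'.trans hzx.symm)
    · exact L.injOn_proj hc hsc (e2 ▸ ht') (hs'.trans hzx.symm)
  exact hxy ((key x rfl).trans (key y hyx).symm)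

theorem Arrangement.not_moves_of_not_agree (hrank : L.rank = 2) (A : L.Arrangement) {i : ℕ}
    (h : ¬ L.Agree (A.base i) (A.base (i + 1))) : ¬ (A.Moves i ∧ A.Moves (i + A.k)) := by
  rintro ⟨h1, h2⟩
  obtain ⟨v, x, y, hv, hi, -, hx, -, hy, -, hxv, hyv⟩ := A.exists_ray_points i
  have hi' := hi
  rw [← A.base_add_k i, ← A.base_add_k (i + 1), add_right_comm] at hi'
  have hx' : x ∈ A.seq (i + A.k + A.k) := by rwa [A.seq_add_k_add_k]
  rw [A.moves_iff hi hx hy hxv hyv] at h1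
  rw [A.moves_iff hi' hy hx' hyv hxv] at h2
  have he := le_antisymm h1 h2
  refine h fun s t hst hs hs' => ?_
  have hmem : L.proj s ∈ A.base i ∩ A.base (i + 1) := ⟨hs, hs'⟩
  rw [hi] at hmem
  obtain ⟨r, -, hr⟩ := hmem
  have key : ∀ s : L.X, L.proj s = r • v → L.phi s = r * L.phi x := by
    intro s hsr
    obtain ⟨c, hc, hcσ, hsc⟩ := L.exists_lift_mem (A.base_mem i) (y := s) (by rw [hsr, ← hr]; exact hs)
    rw [L.slope_spec hc s hsc, hsr, pairing_smul]
    rcases A.eq_seq hrank hc hcσ with rfl | rfl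
    · rw [L.slope_spec hc x hx, hxv]
    · rw [he, L.slope_spec hc y hy, hyv]
  rw [key s hr, key t (hst ▸ hr)]

variable (L) in
/-- The maximal cones of an indecomposable multi-section form a single cycle, a connected double cover
of the cycle of maximal cones of the fan, and over each ray at most one sheet moves. -/
theorem exists_arrangement (hrank : L.rank = 2) (hL : L.CombIndecomposable) :
    ∃ A : L.Arrangement, ∀ i, ¬ (A.Moves i ∧ A.Moves (i + A.k)) := by
  obtain ⟨k, S, hk, hper, hdim, hsucc, hinj, hcov⟩ := F.exists_cyclic_order
  have hmod : ∀ i, S i = S (i % k) := fun i => by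
    conv_lhs => rw [← Nat.mod_add_div i k]
    generalize i / k = n
    induction n with
    | zero => simp
    | succ n ih => rw [mul_add, mul_one, ← add_assoc, hper, ih]
  have hstep : ∀ i (d : {d // L.IsLabelling (S i) d}), ∃ d' : {d // L.IsLabelling (S (i + 1)) d},
      ∀ b, d.1 b ∩ d'.1 b ∈ L.dimCones 1 := fun i d => by
    obtain ⟨d', h, h'⟩ := d.2.exists_next hrank (hdim i) (hdim (i + 1)) (hsucc i)
    exact ⟨⟨d', h⟩, h'⟩
  choose nxt hnxt using hstep
  obtain ⟨d₀, hd₀⟩ := L.exists_isLabelling hrank (hdim 0).1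
  let f : ∀ i, {d // L.IsLabelling (S i) d} := fun i => Nat.rec ⟨d₀, hd₀⟩ (fun i d => nxt i d) i
  obtain ⟨c, hc, hadj⟩ : ∃ c : ℕ → Bool → Set L.X, (∀ i, L.IsLabelling (S i) (c i)) ∧
      ∀ i b, c i b ∩ c (i + 1) b ∈ L.dimCones 1 :=
    ⟨fun i => (f i).1, fun i => (f i).2, fun i b => hnxt i (f i) b⟩
  clear_value f
  -- exchanging the sheets at rays on which `φ` agrees must not close up the labelling
  have hclaim : ∀ ε : ℕ → Bool, (∀ i, i + 1 < k → ε i = ε (i + 1) ∨ L.Agree (S i) (S (i + 1))) →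
      ((∀ b, c k (b ^^ ε (k - 1)) = c 0 (b ^^ ε 0)) ∨ L.Agree (S (k - 1)) (S k)) → False := by
    intro ε hε hlast
    choose! idx hidx hS using hcov
    refine L.not_combIndecomposable_of_labelling hrank (fun b σ => c (idx σ) (b ^^ ε (idx σ)))
      ?_ ?_ ?_ hL
    · intro b σ hσ
      have := (hc (idx σ)).1 (b ^^ ε (idx σ))
      rwa [hS σ hσ] at this
    · intro σ' hσ' hσ
      obtain ⟨b, hb⟩ := (hc (idx (L.proj '' σ'))).2 σ' hσ' (hS _ hσ).symm
      refine ⟨b ^^ ε (idx (L.proj '' σ')), ?_⟩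
      simpa using hb
    · intro b σ hσ σ' hσ' hs x hx y hy hxy
      generalize hi : idx σ = i at hx
      generalize hj : idx σ' = j at hy
      have hik : i < k := hi ▸ hidx σ hσ
      have hjk : j < k := hj ▸ hidx σ' hσ'
      have hSi : S i = σ := hi ▸ hS σ hσ
      have hSj : S j = σ' := hj ▸ hS σ' hσ'
      subst hSi hSj
      have hji : S j = S (i + 1) := F.succeeds_right_unique hσ'.1 (hdim _).1 hs (hsucc i)
      have hx' := (hc i).1 (b ^^ ε i)
      have hy' := (hc j).1 (b ^^ ε j)
      have hagree : L.Agree (S i) (S (i + 1)) → L.phi x = L.phi y := fun h => by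
        refine h x y hxy ?_ ?_
        · have := Set.mem_image_of_mem L.proj hx
          rwa [hx'.2] at this
        · have := Set.mem_image_of_mem L.proj hy
          rwa [hy'.2, hji, ← hxy] at this
      have hsame : y ∈ c (i + 1) (b ^^ ε i) → L.phi x = L.phi y := fun hy2 => by
        have h2 := (hc (i + 1)).1 (b ^^ ε i)
        rw [eq_of_adjacent hx'.1 h2.1 hx'.2 h2.2 (hsucc i) (hadj i _) hx hy2 hxy]
      rcases Nat.lt_or_ge (i + 1) k with h | h
      · obtain rfl : j = i + 1 := hinj hjk h hji
        rcases hε i h with e | e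
        · exact hsame (by rw [e]; exact hy)
        · exact hagree e
      · obtain rfl : k = i + 1 := by omega
        have hSk : S (i + 1) = S 0 := by have := hper 0; rwa [zero_add] at this
        obtain rfl : j = 0 := hinj hjk hk (hji.trans hSk)
        rcases hlast with e | e
        · refine hsame ?_
          have := e b
          rw [Nat.add_sub_cancel] at this
          rw [this]; exact hy
        · exact hagree (by rwa [Nat.add_sub_cancel] at e)
  have hSk : S k = S 0 := by have := hper 0; rwa [zero_add] at this
  have hswap : ∀ b, c k b = c 0 (!b) := by
    have h0 := hc k
    rw [hSk] at h0
    refine (h0.eq_or_eq_not (hc 0)).resolve_left fun h => ?_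
    exact hclaim (fun _ => false) (fun _ _ => Or.inl rfl) (Or.inl fun b => by simp [h])
  have hna' : ∀ i < k, ¬ L.Agree (S i) (S (i + 1)) := by
    intro i₀ hi₀ hag
    refine hclaim (fun i => decide (i₀ < i)) (fun i _ => ?_) ?_
    · by_cases h : i = i₀
      · exact Or.inr (h ▸ hag)
      · left
        have : i₀ < i ↔ i₀ < i + 1 := by omega
        simp [this]
    · by_cases h : i₀ = k - 1
      · right
        rw [h, Nat.sub_add_cancel hk] at hag
        exact hag
      · left
        intro b
        have : i₀ < k - 1 := by omega
        simp [this, hswap]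
  have hna : ∀ i, ¬ L.Agree (S i) (S (i + 1)) := by
    intro i
    have h := hna' (i % k) (Nat.mod_lt _ hk)
    rwa [← hmod, hmod (i % k + 1), Nat.mod_add_mod, ← hmod] at h
  have hck : ∀ i b, c (i + k) b = c i (!b) := by
    intro i
    induction i with
    | zero => simpa using hswap
    | succ i ih =>
      intro b
      have h1 := hadj (i + k) b
      rw [ih b] at h1
      have h2 := hadj i (!b)
      rw [show i + 1 + k = i + k + 1 by ring]
      have h3 := (hc (i + k + 1)).1 b
      rw [show i + k + 1 = i + 1 + k by ring, hper, show i + 1 + k = i + k + 1 by ring] at h3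
      have h4 := (hc i).1 (!b)
      have h5 := (hc (i + 1)).1 (!b)
      exact adjacent_unique hrank (hdim i) (hdim (i + 1)) (hsucc i) (hna i) h4.1 h3.1 h5.1 h4.2
        h3.2 h5.2 h1 h2
  have hne : ∀ i, c i true ≠ c i false := fun i =>
    (hc i).true_ne_false (hdim i) (hdim (i + 1)) (hsucc i) (hna i)
  have hmodk : ∀ {i j}, S i = S j → i % k = j % k := fun {i j} h => by
    rw [hmod i, hmod j] at h
    exact hinj (Nat.mod_lt _ hk) (Nat.mod_lt _ hk) h
  have hne2 : ∀ i, c (i + k) true ≠ c i true := fun i => by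
    rw [hck]; exact (hne i).symm
  let A : L.Arrangement :=
    { k := k
      seq := fun i => c i true
      periodic := fun i => by
        rw [two_mul, ← add_assoc, hck, hck]; rfl
      bijOn := by
        refine ⟨fun i _ => ?_, fun i hi j hj hij => ?_, fun σ' hσ' => ?_⟩
        · have h := (hc i).1 true
          exact ⟨h.1, by rw [h.2]; exact (hdim i).2⟩
        · dsimp only at hij
          have h : S i = S j := by
            rw [← ((hc i).1 true).2, hij, ((hc j).1 true).2]
          have h' := hmodk h
          have hi1 := hi.1
          have hi2 := hi.2
          have hj1 := hj.1
          have hj2 := hj.2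
          by_contra hij'
          rcases Nat.lt_or_gt_of_ne hij' with hlt | hlt
          · obtain ⟨m, hm⟩ := (Nat.modEq_iff_dvd' hlt.le).1 h'
            have : m = 1 := by
              have h1 : 0 < m := Nat.pos_of_ne_zero (by rintro rfl; omega)
              have h2 : m < 2 := by
                by_contra! h2
                have := Nat.mul_le_mul_left k h2
                omega
              omega
            subst this
            obtain rfl : j = i + k := by omega
            exact hne2 i hij.symm
          · obtain ⟨m, hm⟩ := (Nat.modEq_iff_dvd' hlt.le).1 h'.symm
            have : m = 1 := by
              have h1 : 0 < m := Nat.pos_of_ne_zero (by rintro rfl; omega)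
              have h2 : m < 2 := by
                by_contra! h2
                have := Nat.mul_le_mul_left k h2
                omega
              omega
            subst this
            obtain rfl : i = j + k := by omega
            exact hne2 j hij
        · obtain ⟨i, hi, hSi⟩ := hcov (L.proj '' σ') ⟨L.proj_mem _ hσ'.1, hσ'.2⟩
          obtain ⟨b, rfl⟩ := (hc i).2 σ' hσ'.1 hSi.symm
          cases b
          · exact ⟨i + k, ⟨by omega, by omega⟩, by simp [hck]⟩
          · rcases Nat.eq_zero_or_pos i with rfl | h
            · refine ⟨0 + k + k, ⟨by omega, by omega⟩, ?_⟩
              dsimp only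
              rw [hck, hck]; rfl
            · exact ⟨i, ⟨h, by omega⟩, rfl⟩
      same_base := fun i => by
        rw [((hc (i + k)).1 true).2, ((hc i).1 true).2, hper]
      next := fun i => by
        obtain ⟨u, v, w, h1, h2⟩ := hsucc i
        have ha := (hc i).1 true
        have hb := (hc (i + 1)).1 true
        refine L.nextAnticlockwise_of_sector (u := u) (v := v) (w := w) ha.1 hb.1
          (by rw [ha.2]; exact h1) (by rw [hb.2]; exact h2) ?_
        refine (L.inter_mem_dimCones_one_iff ha.1 hb.1 h1.right_ne_zero
          (F.face_mem _ (hdim i).1 _ h1.isFace_right) ?_).1 (hadj i true)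
        rw [ha.2, hb.2]
        exact F.inter_eq_ray (hdim i).1 (hdim (i + 1)).1 h1 h2 }
  refine ⟨A, fun i => A.not_moves_of_not_agree hrank ?_⟩
  have e : ∀ i, A.base i = S i := fun i => ((hc i).1 true).2
  rw [e, e]
  exact hna i

/-- The arrangement with the two sheets exchanged. -/
def Arrangement.shift (A : L.Arrangement) : L.Arrangement where
  k := A.k
  seq := fun i => A.seq (i + A.k)
  periodic := fun i => by rw [add_right_comm, A.periodic]
  bijOn := by
    have hk := A.k_pos
    refine ⟨fun i _ => A.seq_mem _, fun i hi j hj hij => ?_, fun σ' hσ' => ?_⟩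
    · have h := Nat.ModEq.add_right_cancel' A.k (A.modEq_of_seq_eq hij)
      obtain ⟨hi1, hi2⟩ := hi
      obtain ⟨hj1, hj2⟩ := hj
      by_contra hij'
      rcases Nat.lt_or_gt_of_ne hij' with hlt | hlt
      · have := Nat.le_of_dvd (by omega) ((Nat.modEq_iff_dvd' hlt.le).1 h)
        omega
      · have := Nat.le_of_dvd (by omega) ((Nat.modEq_iff_dvd' hlt.le).1 h.symm)
        omega
    · obtain ⟨i, ⟨hi1, hi2⟩, rfl⟩ := A.bijOn.surjOn hσ'
      by_cases h : i ≤ A.k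
      · refine ⟨i + A.k, ⟨by omega, by omega⟩, ?_⟩
        exact A.seq_add_k_add_k i
      · exact ⟨i - A.k, ⟨by omega, by omega⟩, by
          dsimp only; rw [Nat.sub_add_cancel (by omega)]⟩
  same_base := fun i => A.same_base _
  next := fun i => by
    have := A.next (i + A.k)
    rwa [add_right_comm] at this

variable (L) in
/-- At the ray between `σ_k` and `σ_1` it is the first or the second sheet that does not move; the
exchange of the sheets reduces to the first case. -/
theorem exists_normalized_arrangement (hrank : L.rank = 2) (hL : L.CombIndecomposable) :
    ∃ A : L.Arrangement, A.Normalized := by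
  obtain ⟨A, hA⟩ := L.exists_arrangement hrank hL
  by_cases h : A.Moves A.k
  · refine ⟨A.shift, A.shift.normalized_iff.2 ?_⟩
    have hm : ∀ i, A.shift.Moves i ↔ A.Moves (i + A.k) := fun i => by
      unfold Arrangement.Moves
      have e : ∀ i, A.shift.base i = A.base (i + A.k) := fun i => rfl
      rw [e, e, add_right_comm i 1 A.k]
      rfl
    refine ⟨fun h' => hA A.k ⟨h, (hm _).1 h'⟩, fun i _ _ ⟨h1, h2⟩ => hA (i + A.k) ⟨(hm i).1 h1, ?_⟩⟩
    exact (hm _).1 h2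
  · exact ⟨A, A.normalized_iff.2 ⟨h, fun i _ _ => hA i⟩⟩

end TropicalMultisection

end TropLag

namespace TropLag

namespace TropicalMultisection

variable {F : CompleteFan} {L : TropicalMultisection.{u} F}

/-! ### Transition maps in rank two -/

theorem mono_mul_mono (m m' : DualLattice) (c c' : ℂ) :
    mono m c * mono m' c' = mono (m + m') (c * c') :=
  AddMonoidAlgebra.single_mul_single ..

theorem mono_add (m : DualLattice) (c c' : ℂ) : mono m c + mono m c' = mono m (c + c') :=
  (AddMonoidAlgebra.single_add ..).symm

@[simp] theorem mono_zero (m : DualLattice) : mono m 0 = 0 :=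
  AddMonoidAlgebra.single_zero ..

theorem mono_zero_one : mono 0 1 = 1 := rfl

/-- The evaluation of Laurent polynomials at the identity of the torus. -/
noncomputable def evalOne : Laurent →ₐ[ℂ] ℂ := AddMonoidAlgebra.lift ℂ ℂ DualLattice 1

@[simp] theorem evalOne_mono (m : DualLattice) (c : ℂ) : evalOne (mono m c) = c := by
  simp [evalOne, mono]

/-- On the way from `σ₁` to `σ₂`, the lift `b` of `σ₂` is reached from the lift `a` of `σ₁`, and `a'`
is the other lift of `σ₁`; over the common ray `φ` has different values on `a` and `a'`. -/
structure IsCrossing (L : TropicalMultisection.{u} F) {σ₁ σ₂ : Set Plane} (a a' : L.Lift σ₁)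
    (b : L.Lift σ₂) : Prop where
  ne : a ≠ a'
  eq_or_eq : ∀ c : L.Lift σ₁, c = a ∨ c = a'
  adj : a.1 ∩ b.1 ∈ L.dimCones 1
  not_adj : a'.1 ∩ b.1 ∉ L.dimCones 1
  separated : ¬ (InDual (L.slope a'.1 - L.slope a.1) (σ₁ ∩ σ₂) ∧
    InDual (L.slope a.1 - L.slope a'.1) (σ₁ ∩ σ₂))

open scoped Classical in
/-- The coefficient of the wall-crossing term from `a'` to `a`. -/
noncomputable def wallCoeff (n : L.WallData) {σ₁ : Set Plane} (σ₂ : Set Plane)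
    (a a' : L.Lift σ₁) : ℂ :=
  if InDual (L.slope a'.1 - L.slope a.1) (σ₁ ∩ σ₂) then n σ₁ σ₂ (a.1 ∩ a'.1) a'.1 a.1 else 0

namespace IsCrossing

variable {σ₁ σ₂ : Set Plane} {a a' : L.Lift σ₁} {b : L.Lift σ₂} (h : IsCrossing L a a' b)
include h

theorem sum_eq {M : Type*} [AddCommMonoid M] (f : L.Lift σ₁ → M) : ∑ c, f c = f a + f a' := by
  have : (Finset.univ : Finset (L.Lift σ₁)) = {a, a'} := by
    ext c; simpa using h.eq_or_eq c
  rw [this, Finset.sum_pair h.ne]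

/-- There is at most one wall, and its nilpotent endomorphism has square zero. -/
theorem wallTheta_eq (n : L.WallData) :
    L.wallTheta n σ₁ σ₂ = 1 + L.wallN n σ₁ σ₂ (a.1 ∩ a'.1) := by
  classical
  set N := L.wallN n σ₁ σ₂ (a.1 ∩ a'.1) with hN
  -- at most one entry of `N` is non-zero, and it is off the diagonal
  have hdiag : ∀ c, N c c = 0 := fun c => by simp [hN, wallN]
  have hoff : N a a' = 0 ∨ N a' a = 0 := by
    by_contra! hne
    refine h.separated ⟨?_, ?_⟩
    · by_contra hd; exact hne.1 (by simp [hN, wallN, hd])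
    · by_contra hd; exact hne.2 (by simp [hN, wallN, hd])
  have hsq : N ^ 2 = 0 := by
    ext x y
    rw [sq, Matrix.mul_apply, h.sum_eq]
    rcases h.eq_or_eq x with rfl | rfl <;> rcases h.eq_or_eq y with rfl | rfl <;>
      rcases hoff with e | e <;> simp [hdiag, e]
  have hexp : IsNilpotent.exp N = 1 + N := by
    rw [IsNilpotent.exp_eq_sum hsq]
    simp [Finset.sum_range_succ]
  have hsub : L.wallSet σ₁ σ₂ ⊆ {a.1 ∩ a'.1} := by
    rintro _ ⟨⟨⟨c, d⟩, hcd, -⟩, rfl⟩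
    dsimp only at hcd ⊢
    rcases h.eq_or_eq c with rfl | rfl <;> rcases h.eq_or_eq d with rfl | rfl
    · exact absurd rfl hcd
    · rfl
    · exact Set.inter_comm _ _
    · exact absurd rfl hcd
  have hlist : ((L.finite_wallSet σ₁ σ₂).toFinset.toList.map fun ω' =>
      IsNilpotent.exp (L.wallN n σ₁ σ₂ ω')).prod = 1 + N := by
    rcases Set.subset_singleton_iff_eq.1 hsub with he | he
    · have hN0 : N = 0 := by
        have hno : ∀ c d : L.Lift σ₁, c ≠ d → ¬ InDual (L.slope c.1 - L.slope d.1) (σ₁ ∩ σ₂) :=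
          fun c d hcd hin => by
            have : c.1 ∩ d.1 ∈ L.wallSet σ₁ σ₂ := ⟨⟨(c, d), hcd, hin⟩, rfl⟩
            rw [he] at this
            exact this
        ext1 x y
        simp only [hN, wallN, Matrix.of_apply, Matrix.zero_apply]
        exact if_neg fun hc => hno y x hc.1 hc.2.2
      have hf : (L.finite_wallSet σ₁ σ₂).toFinset = ∅ := by
        rw [Set.Finite.toFinset_eq_empty]; exact he
      rw [hf, hN0]
      simp
    · have hf : (L.finite_wallSet σ₁ σ₂).toFinset = {a.1 ∩ a'.1} := by
        ext x
        rw [Set.Finite.mem_toFinset, he]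
        simp
      rw [hf, Finset.toList_singleton, List.map_singleton, List.prod_singleton, ← hexp]
  exact hlist

theorem transition_left (ℒ : L.LocalSystem) (n : L.WallData) :
    L.transition ℒ n σ₁ σ₂ b a = mono (L.slope a.1 - L.slope b.1) (ℒ.g a.1 b.1) := by
  rw [transition, Matrix.mul_apply, h.sum_eq, h.wallTheta_eq]
  simp [Gsf, h.adj, h.not_adj, wallN]

theorem transition_right (ℒ : L.LocalSystem) (n : L.WallData) :
    L.transition ℒ n σ₁ σ₂ b a' =
      mono (L.slope a'.1 - L.slope b.1) (ℒ.g a.1 b.1 * wallCoeff n σ₂ a a') := by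
  rw [transition, Matrix.mul_apply, h.sum_eq, h.wallTheta_eq]
  simp only [Gsf, Matrix.of_apply, h.adj, h.not_adj, if_true, if_false, zero_mul, add_zero,
    Matrix.add_apply, Matrix.one_apply_ne h.ne, zero_add, wallN, wallCoeff]
  by_cases hd : InDual (L.slope a'.1 - L.slope a.1) (σ₁ ∩ σ₂)
  · rw [if_pos ⟨h.ne.symm, by rw [Set.inter_comm], hd⟩, if_pos hd, mono_mul_mono]
    congr 1; abel
  · rw [if_neg (fun hc => hd hc.2.2), if_neg hd]
    simp

end IsCrossing

namespace Arrangement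

variable (A : L.Arrangement)

/-- The `i`-th cone as a lift of its base. -/
def lift (i : ℕ) : L.Lift (A.base i) := ⟨A.seq i, (A.seq_mem i).1, rfl⟩

/-- The other lift of the base of the `i`-th cone. -/
def lift' (i : ℕ) : L.Lift (A.base i) := ⟨A.seq (i + A.k), (A.seq_mem _).1, A.same_base i⟩

theorem seq_congr {i j : ℕ} (h : i ≡ j [MOD 2 * A.k]) : A.seq i = A.seq j := by
  rw [← A.seq_mod i, ← A.seq_mod j, h]

theorem Normalized.not_moves {A : L.Arrangement} (hA : A.Normalized) (i : ℕ) :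
    ¬ (A.Moves i ∧ A.Moves (i + A.k)) := by
  have hk := A.k_pos
  have h := (A.normalized_iff.1 hA).2
  induction i using Nat.strong_induction_on with
  | _ i ih =>
    rcases Nat.eq_zero_or_pos i with rfl | hi
    · rintro ⟨h1, h2⟩
      rw [zero_add] at h2
      rw [← A.moves_add_two_k, zero_add] at h1
      exact h A.k hk le_rfl ⟨h2, h1⟩
    · by_cases hik : i ≤ A.k
      · exact h i hi hik
      · rintro ⟨h1, h2⟩
        refine ih (i - A.k) (by omega) ⟨?_, ?_⟩
        · rw [← A.moves_add_two_k, Nat.sub_add_cancel (by omega)]; exact h2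
        · rwa [Nat.sub_add_cancel (by omega)]

theorem inter_mem (i : ℕ) : A.base i ∩ A.base (i + 1) ∈ F.dimCones 1 := by
  obtain ⟨v, x, y, hv, hi, hray, -⟩ := A.exists_ray_points i
  rw [hi]; exact ⟨hray, coneDim_ray hv⟩

/-- The two lifts of a ray are distinct unless both sheets may move, so the sheets are not glued there. -/
theorem not_adjacent {i : ℕ} (h : ¬ (A.Moves i ∧ A.Moves (i + A.k))) :
    A.seq i ∩ A.seq (i + 1 + A.k) ∉ L.dimCones 1 := by
  intro hadj
  obtain ⟨v, x, y, hv, hi, hray, hx, -, hy, hy', hxv, hyv⟩ := A.exists_ray_points i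
  have hi1 : L.proj '' A.seq i ∩ L.proj '' A.seq (i + 1 + A.k) = ray v := by
    rw [← hi]; exact congrArg _ (A.base_add_k (i + 1))
  obtain ⟨z, hz, hzv⟩ := (L.inter_mem_dimCones_one_iff (A.seq_mem i).1 (A.seq_mem _).1 hv hray
    hi1).1 hadj
  have e1 : z = x := L.injOn_proj (A.seq_mem i).1 hz.1 hx (hzv.trans hxv.symm)
  have e2 : z = y := L.injOn_proj (A.seq_mem _).1 hz.2 hy' (hzv.trans hyv.symm)
  obtain rfl : x = y := e1.symm.trans e2
  have hi' := hi
  rw [← A.base_add_k i, ← A.base_add_k (i + 1), add_right_comm] at hi'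
  have hx' : x ∈ A.seq (i + A.k + A.k) := by rwa [A.seq_add_k_add_k]
  exact h ⟨(A.moves_iff hi hx hy hxv hyv).2 le_rfl, (A.moves_iff hi' hy hx' hyv hxv).2 le_rfl⟩

theorem moves_add_k_iff (i : ℕ) : A.Moves (i + A.k) ↔
    InDual (L.slope (A.seq i) - L.slope (A.seq (i + A.k))) (A.base i ∩ A.base (i + 1)) := by
  rw [Moves, A.seq_add_k_add_k, A.base_add_k, add_right_comm, A.base_add_k]

theorem moves_iff_next (i : ℕ) : A.Moves i ↔
    InDual (L.slope (A.seq (i + 1 + A.k)) - L.slope (A.seq (i + 1)))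
      (A.base (i + 1) ∩ A.base i) := by
  obtain ⟨v, x, y, hv, hi, -, hx, hx', hy, hy', hxv, hyv⟩ := A.exists_ray_points i
  rw [A.moves_iff hi hx hy hxv hyv, Set.inter_comm, hi, inDual_ray, pairing_sub,
    L.slope_spec (A.seq_mem (i + 1)).1 x hx', L.slope_spec (A.seq_mem (i + 1 + A.k)).1 y hy',
    hxv, hyv, sub_nonneg]

theorem moves_add_k_iff_next (i : ℕ) : A.Moves (i + A.k) ↔
    InDual (L.slope (A.seq (i + 1)) - L.slope (A.seq (i + 1 + A.k)))
      (A.base (i + 1) ∩ A.base i) := by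
  rw [A.moves_iff_next, show i + A.k + 1 = i + 1 + A.k by ring, A.seq_add_k_add_k, A.base_add_k,
    A.base_add_k]

theorem lift_eq_or (hrank : L.rank = 2) (i : ℕ) (c : L.Lift (A.base i)) :
    c = A.lift i ∨ c = A.lift' i :=
  (A.eq_seq hrank c.2.1 c.2.2).imp (fun h => Subtype.ext h) fun h => Subtype.ext h

theorem lift_ne (i : ℕ) : A.lift i ≠ A.lift' i := fun h => A.seq_ne i (congrArg Subtype.val h)

variable {A}

theorem Normalized.isCrossing (hA : A.Normalized) (hrank : L.rank = 2) (i : ℕ) :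
    IsCrossing L (A.lift i) (A.lift' i) (A.lift (i + 1)) where
  ne := A.lift_ne i
  eq_or_eq := A.lift_eq_or hrank i
  adj := (A.next i).1
  not_adj := by
    have := A.not_adjacent (hA.not_moves (i + A.k))
    rwa [show i + A.k + 1 + A.k = i + 1 + A.k + A.k by ring, A.seq_add_k_add_k] at this
  separated := fun ⟨h1, h2⟩ => hA.not_moves i ⟨h1, (A.moves_add_k_iff i).2 h2⟩

theorem Normalized.isCrossing' (hA : A.Normalized) (hrank : L.rank = 2) (i : ℕ) :
    IsCrossing L (A.lift' i) (A.lift i) (A.lift' (i + 1)) where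
  ne := (A.lift_ne i).symm
  eq_or_eq := fun c => (A.lift_eq_or hrank i c).symm
  adj := by
    have := (A.next (i + A.k)).1
    rwa [add_right_comm] at this
  not_adj := A.not_adjacent (hA.not_moves i)
  separated := fun ⟨h1, h2⟩ => hA.not_moves i ⟨h2, (A.moves_add_k_iff i).2 h1⟩

theorem Normalized.isCrossing_back (hA : A.Normalized) (hrank : L.rank = 2) (i : ℕ) :
    IsCrossing L (A.lift (i + 1)) (A.lift' (i + 1)) (A.lift i) where
  ne := A.lift_ne _
  eq_or_eq := A.lift_eq_or hrank _
  adj := by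
    rw [Set.inter_comm]; exact (A.next i).1
  not_adj := by
    rw [Set.inter_comm]; exact A.not_adjacent (hA.not_moves i)
  separated := fun ⟨h1, h2⟩ =>
    hA.not_moves i ⟨(A.moves_iff_next i).2 h1, (A.moves_add_k_iff_next i).2 h2⟩

/-! ### Unobstructedness implies the slope condition -/

/-- The composition of the transition maps around the origin sends the first sheet of `σ_1` to the
second one with a non-zero coefficient, unless the second sheet moves before the first one. -/
theorem Normalized.slopeCondition_of_unobstructed (hA : A.Normalized) (hrank : L.rank = 2)
    (hL : L.Unobstructed) : A.SlopeCondition := by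
  rw [A.slopeCondition_iff hA]
  by_contra hno
  push Not at hno
  obtain ⟨ℒ, n, hcons⟩ := hL
  have hkp := A.k_pos
  have hz : ({0} : Set Plane) ∈ F.cones := by
    obtain ⟨u, v, w, h, -⟩ := A.exists_sector 0
    exact F.face_mem _ (A.base_mem 0).1 _ h.isFace_zero
  set τ : ℕ → Set Plane := fun m => A.base (m + 1) with hτ
  have hτk : τ A.k = τ 0 := by
    simp only [hτ]
    rw [add_comm A.k 1, A.base_add_k]
  set X : ℕ → ℂ := fun m => evalOne (L.holonomy ℒ n τ m (A.lift (m + 1)) (A.lift 1)) with hX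
  set Y : ℕ → ℂ := fun m => evalOne (L.holonomy ℒ n τ m (A.lift' (m + 1)) (A.lift 1)) with hY
  have hX1 : ∀ m, ∃ g : ℂ, g ≠ 0 ∧ ∃ c : ℂ, (¬ A.Moves (m + 1) → c = 0) ∧
      X (m + 1) = g * (X m + c * Y m) := by
    intro m
    have hc := hA.isCrossing hrank (m + 1)
    refine ⟨ℒ.g (A.lift (m + 1)).1 (A.lift (m + 2)).1, Units.ne_zero _,
      wallCoeff n (A.base (m + 1 + 1)) (A.lift (m + 1)) (A.lift' (m + 1)),
      fun hm => if_neg hm, ?_⟩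
    simp only [hX, hY, holonomy]
    rw [Matrix.mul_apply, hc.sum_eq, hc.transition_left, hc.transition_right, map_add, map_mul,
      map_mul, evalOne_mono, evalOne_mono]
    ring
  have hY1 : ∀ m, ¬ A.Moves (m + 1 + A.k) → Y m = 0 → Y (m + 1) = 0 := by
    intro m hm hYm
    have hc := hA.isCrossing' hrank (m + 1)
    have hw : wallCoeff n (A.base (m + 1 + 1)) (A.lift' (m + 1)) (A.lift (m + 1)) = 0 :=
      if_neg fun h => hm ((A.moves_add_k_iff (m + 1)).2 h)
    simp only [hY, holonomy] at hYm ⊢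
    rw [Matrix.mul_apply, hc.sum_eq, hc.transition_left, hc.transition_right, map_add, map_mul,
      map_mul, evalOne_mono, evalOne_mono, hw, hYm]
    ring
  have hmain : ∀ m, m < A.k → X m ≠ 0 ∧
      ((∀ i, 1 ≤ i → i ≤ m → ¬ A.Moves (i + A.k)) → Y m = 0) := by
    intro m
    induction m with
    | zero =>
      refine fun _ => ⟨?_, fun _ => ?_⟩
      · simp only [hX, holonomy]
        rw [show A.lift (0 + 1) = A.lift 1 from rfl, Matrix.one_apply_eq]
        simp
      · simp only [hY, holonomy]
        rw [Matrix.one_apply_ne (A.lift_ne 1).symm]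
        simp
    | succ m ih =>
      intro hm
      obtain ⟨h1, h2⟩ := ih (by omega)
      obtain ⟨g, hg, c, hc, hXm⟩ := hX1 m
      constructor
      · rw [hXm]
        by_cases hmv : A.Moves (m + 1)
        · rw [h2 fun i hi him hi' => hno i (m + 1) hi (by omega) hm hi' hmv, mul_zero, add_zero]
          exact mul_ne_zero hg h1
        · rw [hc hmv, zero_mul, add_zero]
          exact mul_ne_zero hg h1
      · intro hall
        exact hY1 m (hall (m + 1) (by omega) le_rfl) (h2 fun i hi him => hall i hi (by omega))
  obtain ⟨g, hg, c, hc, hXk⟩ := hX1 (A.k - 1)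
  rw [Nat.sub_add_cancel hkp] at hc hXk
  rw [hc (A.normalized_iff.1 hA).1, zero_mul, add_zero] at hXk
  have hne : X A.k ≠ 0 := by
    rw [hXk]; exact mul_ne_zero hg (hmain _ (by omega)).1
  have hid := hcons _ hz A.k τ hτk
    (fun i _ => ⟨A.base_mem _, Set.singleton_subset_iff.2 (F.zero_mem (A.base_mem _).1)⟩)
    (fun i _ => A.inter_mem _) (A.lift (A.k + 1)) (A.lift 1)
  rw [if_neg (fun h => A.seq_ne 1 (by rw [add_comm 1]; exact h.symm))] at hid
  exact hne (by simp only [hX]; rw [hid, map_zero])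

end Arrangement

/-! ### The slope condition implies unobstructedness -/

/-- A flat frame over `σ`: the vectors `z^{-m(α)} Q(α)` for the lifts `α` of `σ`, as the rows of a
matrix. -/
noncomputable def frame (L : TropicalMultisection.{u} F) (Q : Set L.X → Fin 2 → ℂ)
    (σ : Set Plane) : Matrix (L.Lift σ) (Fin 2) Laurent :=
  Matrix.of fun α t => mono (-L.slope α.1) (Q α.1 t)

/-- The monomials cancel, so flatness of a frame is an identity between constant vectors. -/
theorem IsCrossing.transition_mul_frame {σ₁ σ₂ : Set Plane} {a a' : L.Lift σ₁} {b : L.Lift σ₂}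
    (h : IsCrossing L a a' b) (ℒ : L.LocalSystem) (n : L.WallData) (Q : Set L.X → Fin 2 → ℂ)
    (hQ : Q b.1 = (ℒ.g a.1 b.1 : ℂ) • (Q a.1 + wallCoeff n σ₂ a a' • Q a'.1)) (t : Fin 2) :
    (L.transition ℒ n σ₁ σ₂ * L.frame Q σ₁) b t = L.frame Q σ₂ b t := by
  rw [Matrix.mul_apply, h.sum_eq, h.transition_left, h.transition_right]
  simp only [frame, Matrix.of_apply, mono_mul_mono, hQ, Pi.smul_apply, Pi.add_apply, smul_eq_mul]
  rw [show L.slope a.1 - L.slope b.1 + -L.slope a.1 = -L.slope b.1 by abel,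
    show L.slope a'.1 - L.slope b.1 + -L.slope a'.1 = -L.slope b.1 by abel, mono_add]
  congr 1; ring

theorem holonomy_mul_frame (ℒ : L.LocalSystem) (n : L.WallData) (Q : Set L.X → Fin 2 → ℂ)
    (σ : ℕ → Set Plane) (l : ℕ)
    (h : ∀ i < l, L.transition ℒ n (σ i) (σ (i + 1)) * L.frame Q (σ i) = L.frame Q (σ (i + 1))) :
    L.holonomy ℒ n σ l * L.frame Q (σ 0) = L.frame Q (σ l) := by
  induction l with
  | zero => simp [holonomy]
  | succ l ih =>
    rw [holonomy, Matrix.mul_assoc, ih fun i hi => h i (by omega), h l (by omega)]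

/-- A frame is invertible if its two constant vectors are linearly independent. -/
theorem exists_frame_mul_eq_one (Q : Set L.X → Fin 2 → ℂ) {σ : Set Plane} {a a' : L.Lift σ}
    (hne : a ≠ a') (hall : ∀ c : L.Lift σ, c = a ∨ c = a')
    (hdet : Q a.1 0 * Q a'.1 1 - Q a.1 1 * Q a'.1 0 ≠ 0) :
    ∃ K : Matrix (Fin 2) (L.Lift σ) Laurent, L.frame Q σ * K = 1 := by
  set D := Q a.1 0 * Q a'.1 1 - Q a.1 1 * Q a'.1 0 with hD
  let K₀ : Fin 2 → L.Lift σ → ℂ := fun t c =>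
    if c = a then ![Q a'.1 1 / D, -Q a'.1 0 / D] t else ![-Q a.1 1 / D, Q a.1 0 / D] t
  refine ⟨Matrix.of fun t c => mono (L.slope c.1) (K₀ t c), ?_⟩
  ext1 x c
  rw [Matrix.mul_apply, Fin.sum_univ_two]
  simp only [frame, Matrix.of_apply, mono_mul_mono, mono_add]
  by_cases hxc : x = c
  · subst hxc
    rw [Matrix.one_apply_eq, ← mono_zero_one]
    congr 1
    · abel
    · rcases hall x with rfl | rfl
      · simp only [K₀, if_true, Matrix.cons_val_zero, Matrix.cons_val_one]
        field_simp
        rw [hD]; ring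
      · simp only [K₀, hne.symm, if_false, Matrix.cons_val_zero, Matrix.cons_val_one]
        field_simp
        rw [hD]; ring
  · rw [Matrix.one_apply_ne hxc]
    convert mono_zero _
    rcases hall x with rfl | rfl <;> rcases hall c with rfl | rfl
    · exact absurd rfl hxc
    · simp only [K₀, hne.symm, if_false, Matrix.cons_val_zero, Matrix.cons_val_one]
      ring
    · simp only [K₀, if_true, Matrix.cons_val_zero, Matrix.cons_val_one]
      ring
    · exact absurd rfl hxc

/-- A matrix that fixes an invertible frame is the identity. -/
theorem eq_ite_of_mul_frame (Q : Set L.X → Fin 2 → ℂ) {σ σ' : Set Plane} (hσ : σ' = σ)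
    (G : Matrix (L.Lift σ') (L.Lift σ) Laurent) (hG : G * L.frame Q σ = L.frame Q σ')
    (hinv : ∃ K : Matrix (Fin 2) (L.Lift σ) Laurent, L.frame Q σ * K = 1) (β : L.Lift σ') (α : L.Lift σ) [Decidable (β.1 = α.1)] :
    G β α = if β.1 = α.1 then 1 else 0 := by
  subst hσ
  obtain ⟨K, hK⟩ := hinv
  have : G = 1 := by
    rw [← Matrix.mul_one G, ← hK, ← Matrix.mul_assoc, hG]
  rw [this, Matrix.one_apply]
  split_ifs with h1 h2 h2
  · rfl
  · exact absurd (congrArg Subtype.val h1) h2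
  · exact absurd (Subtype.ext h2) h1
  · rfl

/-- A flat frame, given by constant vectors `Q` up to monomials, trivializes the holonomy. -/
theorem unobstructed_of_frame (ℒ : L.LocalSystem) (Q : Set L.X → Fin 2 → ℂ)
    (hinv : ∀ σ ∈ F.dimCones 2, ∃ K : Matrix (Fin 2) (L.Lift σ) Laurent, L.frame Q σ * K = 1)
    (hcross : ∀ σ₁ ∈ F.dimCones 2, ∀ σ₂ ∈ F.dimCones 2, σ₁ ∩ σ₂ ∈ F.dimCones 1 →
      ∀ b : L.Lift σ₂, ∃ a a' : L.Lift σ₁, IsCrossing L a a' b ∧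
        ∃ c : ℂ, Q b.1 = (ℒ.g a.1 b.1 : ℂ) • (Q a.1 + c • Q a'.1) ∧
          (c ≠ 0 → InDual (L.slope a'.1 - L.slope a.1) (σ₁ ∩ σ₂)))
    (huniq : ∀ σ₁ ∈ F.dimCones 2, ∀ σ₂ ∈ F.dimCones 2, σ₁ ∩ σ₂ ∈ F.dimCones 1 →
      ∀ (a : L.Lift σ₁) (b b' : L.Lift σ₂), a.1 ∩ b.1 ∈ L.dimCones 1 →
        a.1 ∩ b'.1 ∈ L.dimCones 1 → b = b') :
    L.Unobstructed := by
  classical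
  -- the coefficient is determined by the flatness of the frame
  let n : L.WallData := fun σ₁ σ₂ _ α β => Classical.epsilon fun c : ℂ =>
    ∃ b : L.Lift σ₂, β ∩ b.1 ∈ L.dimCones 1 ∧ Q b.1 = (ℒ.g β b.1 : ℂ) • (Q β + c • Q α)
  have htrans : ∀ σ₁ ∈ F.dimCones 2, ∀ σ₂ ∈ F.dimCones 2, σ₁ ∩ σ₂ ∈ F.dimCones 1 →
      L.transition ℒ n σ₁ σ₂ * L.frame Q σ₁ = L.frame Q σ₂ := by
    intro σ₁ h₁ σ₂ h₂ hi
    ext1 b t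
    obtain ⟨a, a', hc, c, hQ, hd⟩ := hcross σ₁ h₁ σ₂ h₂ hi b
    refine hc.transition_mul_frame ℒ n Q ?_ t
    by_cases hD : InDual (L.slope a'.1 - L.slope a.1) (σ₁ ∩ σ₂)
    · rw [wallCoeff, if_pos hD]
      obtain ⟨b', hb', hQb'⟩ := Classical.epsilon_spec (p := fun c : ℂ => ∃ b : L.Lift σ₂,
        a.1 ∩ b.1 ∈ L.dimCones 1 ∧ Q b.1 = (ℒ.g a.1 b.1 : ℂ) • (Q a.1 + c • Q a'.1))
        ⟨c, b, hc.adj, hQ⟩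
      obtain rfl := huniq σ₁ h₁ σ₂ h₂ hi a b b' hc.adj hb'
      exact hQb'
    · rw [wallCoeff, if_neg hD, hQ, not_not.1 fun h => hD (hd h)]
  refine ⟨ℒ, n, fun ω _ l σ hl hdim hadj β α => ?_⟩
  refine eq_ite_of_mul_frame Q hl _ ?_ (hinv _ (hdim 0 (Nat.zero_le l)).1) β α
  exact holonomy_mul_frame ℒ n Q σ l fun i hi =>
    htrans _ (hdim i hi.le).1 _ (hdim (i + 1) hi).1 (hadj i hi)

namespace Arrangement

variable {A : L.Arrangement}

/-- The constant vectors of the flat frame, along the `2k` cones of the arrangement. The first sheet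
moves from `(1, 0)` to the line of `(0, 1)` at the `j`-th ray, after the second sheet has moved
from `(0, 1)` to `(1, 1)` at the `i`-th ray. -/
def frameVector (k i j m : ℕ) : Fin 2 → ℂ :=
  if m ≤ j then ![1, 0] else if m ≤ k + i then ![0, 1] else ![1, 1]

/-- Each step along the arrangement adds a multiple of the vector on the other sheet, up to a sign; the
multiple is non-zero only at the positions `j`, `k + i` and `2k`. -/
theorem exists_frameVector_step {k i j m : ℕ} (hi : 1 ≤ i) (hij : i < j) (hjk : j < k)
    (h1 : 1 ≤ m) (h2 : m ≤ 2 * k) :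
    ∃ c : ℂ, (if m < 2 * k then frameVector k i j (m + 1) else frameVector k i j 1) =
      (if m = j then -1 else 1 : ℂ) • (frameVector k i j m +
        c • if m ≤ k then frameVector k i j (m + k) else frameVector k i j (m - k)) ∧
      (c ≠ 0 → m = j ∨ m = k + i ∨ m = 2 * k) := by
  have low : ∀ l, l ≤ j → frameVector k i j l = ![1, 0] := fun l h => if_pos h
  have mid : ∀ l, j < l → l ≤ k + i → frameVector k i j l = ![0, 1] := fun l h h' => by
    rw [frameVector, if_neg (by omega), if_pos h']
  have high : ∀ l, k + i < l → frameVector k i j l = ![1, 1] := fun l h => by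
    rw [frameVector, if_neg (by omega), if_neg (by omega)]
  rcases eq_or_ne m j with rfl | hmj
  · refine ⟨-1, ?_, fun _ => Or.inl rfl⟩
    rw [if_pos (by omega), if_pos rfl, if_pos (by omega), low m le_rfl,
      mid (m + 1) (by omega) (by omega), high (m + k) (by omega)]
    simp
  rcases eq_or_ne m (k + i) with rfl | hmi
  · refine ⟨1, ?_, fun _ => Or.inr (Or.inl rfl)⟩
    rw [if_pos (by omega), if_neg (by omega), if_neg (by omega), high (k + i + 1) (by omega),
      mid (k + i) (by omega) le_rfl, low (k + i - k) (by omega)]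
    simp
  rcases eq_or_ne m (2 * k) with rfl | hmk
  · refine ⟨-1, ?_, fun _ => Or.inr (Or.inr rfl)⟩
    rw [if_neg (by omega), if_neg (by omega), if_neg (by omega), low 1 (by omega),
      high (2 * k) (by omega), mid (2 * k - k) (by omega) (by omega)]
    simp
  · refine ⟨0, ?_, fun h => absurd rfl h⟩
    rw [if_pos (by omega), if_neg hmj, zero_smul, add_zero, one_smul]
    rcases lt_or_ge m j with h | h
    · rw [low m (by omega), low (m + 1) (by omega)]
    rcases lt_or_ge m (k + i) with h' | h'
    · rw [mid m (by omega) (by omega), mid (m + 1) (by omega) (by omega)]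
    · rw [high m (by omega), high (m + 1) (by omega)]

theorem exists_base_eq_base_succ_eq {σ₁ σ₂ : Set Plane} (h₁ : σ₁ ∈ F.dimCones 2)
    (h₂ : σ₂ ∈ F.dimCones 2) (hs : Succeeds σ₁ σ₂) :
    ∃ i, A.base i = σ₁ ∧ A.base (i + 1) = σ₂ := by
  obtain ⟨i, -, -, rfl⟩ := A.exists_base_eq h₁
  exact ⟨i, rfl, F.succeeds_right_unique (A.base_mem _).1 h₂.1 (A.succeeds i) hs⟩

/-- Every crossing of a ray is, forwards or backwards, a step of the arrangement. -/
theorem crossing_cases (hrank : L.rank = 2) {σ₁ σ₂ : Set Plane} (h₁ : σ₁ ∈ F.dimCones 2)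
    (h₂ : σ₂ ∈ F.dimCones 2) (hi : σ₁ ∩ σ₂ ∈ F.dimCones 1) (b : L.Lift σ₂) :
    (∃ i, A.base i = σ₁ ∧ A.base (i + 1) = σ₂ ∧ b.1 = A.seq (i + 1)) ∨
      ∃ i, A.base (i + 1) = σ₁ ∧ A.base i = σ₂ ∧ b.1 = A.seq i := by
  rcases F.succeeds_of_inter_mem h₁ h₂ hi with hs | hs
  · left
    obtain ⟨i, rfl, rfl⟩ := exists_base_eq_base_succ_eq (A := A) h₁ h₂ hs
    rcases A.eq_seq hrank b.2.1 b.2.2 with h | h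
    · exact ⟨i, rfl, rfl, h⟩
    · refine ⟨i + A.k, A.base_add_k i, ?_, ?_⟩
      · rw [add_right_comm, A.base_add_k]
      · rw [h, add_right_comm]
  · right
    obtain ⟨i, rfl, rfl⟩ := exists_base_eq_base_succ_eq (A := A) h₂ h₁ hs
    rcases A.eq_seq hrank b.2.1 b.2.2 with h | h
    · exact ⟨i, rfl, rfl, h⟩
    · refine ⟨i + A.k, ?_, A.base_add_k i, h⟩
      rw [add_right_comm, A.base_add_k]

theorem Normalized.adjacent_unique (hA : A.Normalized) (hrank : L.rank = 2) {σ₁ σ₂ : Set Plane}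
    (h₁ : σ₁ ∈ F.dimCones 2) (h₂ : σ₂ ∈ F.dimCones 2) (hi : σ₁ ∩ σ₂ ∈ F.dimCones 1)
    (a : L.Lift σ₁) (b b' : L.Lift σ₂) (hb : a.1 ∩ b.1 ∈ L.dimCones 1)
    (hb' : a.1 ∩ b'.1 ∈ L.dimCones 1) : b = b' := by
  rcases crossing_cases (A := A) hrank h₂ h₁ (by rwa [Set.inter_comm]) a with
    ⟨i, rfl, rfl, ha⟩ | ⟨i, rfl, rfl, ha⟩
  · have hn : A.seq (i + 1) ∩ A.seq (i + A.k) ∉ L.dimCones 1 := by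
      have := A.not_adjacent (hA.not_moves (i + A.k))
      rwa [show i + A.k + 1 + A.k = i + 1 + A.k + A.k by ring, A.seq_add_k_add_k,
        Set.inter_comm] at this
    have key : ∀ c : L.Lift (A.base i), a.1 ∩ c.1 ∈ L.dimCones 1 → c = A.lift i := fun c hc =>
      (A.lift_eq_or hrank i c).resolve_right fun h => hn (by rw [h, ha] at hc; exact hc)
    rw [key b hb, key b' hb']
  · have hn := A.not_adjacent (hA.not_moves i)
    have key : ∀ c : L.Lift (A.base (i + 1)), a.1 ∩ c.1 ∈ L.dimCones 1 → c = A.lift (i + 1) :=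
      fun c hc => (A.lift_eq_or hrank _ c).resolve_right fun h =>
        hn (by rw [h, ha] at hc; exact hc)
    rw [key b hb, key b' hb']

/-- A sequence of constant vectors along the arrangement, in which only the sheets that may move do
so, makes `L` unobstructed. -/
theorem Normalized.unobstructed_of_vectors (hA : A.Normalized) (hrank : L.rank = 2)
    (ℒ : L.LocalSystem) (Q : Set L.X → Fin 2 → ℂ)
    (hdet : ∀ i, 1 ≤ i → i ≤ A.k → Q (A.seq i) 0 * Q (A.seq (i + A.k)) 1 -
      Q (A.seq i) 1 * Q (A.seq (i + A.k)) 0 ≠ 0)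
    (hstep : ∀ i, ∃ c : ℂ, Q (A.seq (i + 1)) =
      (ℒ.g (A.seq i) (A.seq (i + 1)) : ℂ) • (Q (A.seq i) + c • Q (A.seq (i + A.k))) ∧
        (c ≠ 0 → A.Moves i)) : L.Unobstructed := by
  refine unobstructed_of_frame ℒ Q ?_ ?_ fun σ₁ h₁ σ₂ h₂ hi => hA.adjacent_unique hrank h₁ h₂ hi
  · intro σ hσ
    obtain ⟨i, hi1, hik, rfl⟩ := A.exists_base_eq hσ
    exact exists_frame_mul_eq_one Q (A.lift_ne i) (A.lift_eq_or hrank i) (hdet i hi1 hik)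
  · intro σ₁ h₁ σ₂ h₂ hi b
    rcases crossing_cases (A := A) hrank h₁ h₂ hi b with ⟨i, rfl, rfl, hb⟩ | ⟨i, rfl, rfl, hb⟩
    · obtain rfl : b = A.lift (i + 1) := Subtype.ext hb
      exact ⟨_, _, hA.isCrossing hrank i, hstep i⟩
    · obtain rfl : b = A.lift i := Subtype.ext hb
      refine ⟨_, _, hA.isCrossing_back hrank i, ?_⟩
      obtain ⟨c, hc, hcm⟩ := hstep i
      obtain ⟨c', hc', hcm'⟩ := hstep (i + A.k)
      have hg := ℒ.g_symm _ (A.seq_mem i) _ (A.seq_mem (i + 1)) (A.next i).1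
      set g := ℒ.g (A.seq i) (A.seq (i + 1)) with hgdef
      change ∃ c : ℂ, Q (A.seq i) = (ℒ.g (A.seq (i + 1)) (A.seq i) : ℂ) •
        (Q (A.seq (i + 1)) + c • Q (A.seq (i + 1 + A.k))) ∧
        (c ≠ 0 → InDual (L.slope (A.seq (i + 1 + A.k)) - L.slope (A.seq (i + 1)))
          (A.base (i + 1) ∩ A.base i))
      rw [← A.moves_iff_next, hg, Units.val_inv_eq_inv_val]
      have hg0 : (g : ℂ) ≠ 0 := g.ne_zero
      by_cases h0 : c = 0
      · refine ⟨0, ?_, fun h => absurd rfl h⟩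
        rw [hc, h0, zero_smul, zero_smul, add_zero, add_zero, smul_smul, inv_mul_cancel₀ hg0,
          one_smul]
      · have hm := hcm h0
        have h0' : c' = 0 := not_not.1 fun h => hA.not_moves i ⟨hm, hcm' h⟩
        rw [h0', zero_smul, add_zero, add_right_comm] at hc'
        set g' := ℒ.g (A.seq (i + A.k)) (A.seq (i + 1 + A.k)) with hgdef'
        have hg0' : (g' : ℂ) ≠ 0 := g'.ne_zero
        refine ⟨-(g * c * (g' : ℂ)⁻¹), ?_, fun _ => hm⟩
        rw [hc', hc]
        ext t
        simp only [Pi.smul_apply, Pi.add_apply, smul_eq_mul]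
        field_simp
        ring

/-- The sign of `frameVector` at the `j`-th ray is the only non-trivial transition constant of the
local system. -/
theorem Normalized.unobstructed_of_slopeCondition (hA : A.Normalized) (hrank : L.rank = 2)
    (hS : A.SlopeCondition) : L.Unobstructed := by
  classical
  obtain ⟨i, j, hi, hij, hjk, hmi, hmj⟩ := (A.slopeCondition_iff hA).1 hS
  have hmk : A.Moves (A.k + A.k) := (A.moves_or A.k).resolve_left (A.normalized_iff.1 hA).1
  let ℒ : L.LocalSystem :=
    { g := fun a b => if (a = A.seq j ∧ b = A.seq (j + 1)) ∨ (b = A.seq j ∧ a = A.seq (j + 1))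
        then -1 else 1
      g_symm := fun a _ b _ _ => by
        have : ((b = A.seq j ∧ a = A.seq (j + 1)) ∨ (a = A.seq j ∧ b = A.seq (j + 1))) ↔
          ((a = A.seq j ∧ b = A.seq (j + 1)) ∨ (b = A.seq j ∧ a = A.seq (j + 1))) := or_comm
        simp only [this]
        split_ifs <;> simp }
  choose! idx hidx hseq using fun σ' (h : σ' ∈ L.dimCones 2) => A.bijOn.surjOn h
  set w := frameVector A.k i j with hw
  let Q : Set L.X → Fin 2 → ℂ := fun σ' => w (idx σ')
  have hQ : ∀ m, 1 ≤ m → m ≤ 2 * A.k → Q (A.seq m) = w m := fun m h1 h2 =>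
    congrArg w (A.bijOn.injOn (hidx _ (A.seq_mem m)) ⟨h1, h2⟩ (hseq _ (A.seq_mem m)))
  have hg : ∀ m, 1 ≤ m → m ≤ 2 * A.k → (ℒ.g (A.seq m) (A.seq (m + 1)) : ℂ) =
      if m = j then -1 else 1 := by
    intro m h1 h2
    by_cases hm : m = j
    · subst hm
      simp [ℒ]
    · have hno : ¬ ((A.seq m = A.seq j ∧ A.seq (m + 1) = A.seq (j + 1)) ∨
          (A.seq (m + 1) = A.seq j ∧ A.seq m = A.seq (j + 1))) := by
        rintro (⟨h, -⟩ | ⟨h, h'⟩)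
        · exact hm (A.bijOn.injOn ⟨h1, h2⟩ ⟨by omega, by omega⟩ h)
        · have e := A.bijOn.injOn ⟨h1, h2⟩ ⟨by omega, by omega⟩ h'
          subst e
          have := A.bijOn.injOn (⟨by omega, by omega⟩ : j + 1 + 1 ∈ Set.Icc 1 (2 * A.k))
            ⟨by omega, by omega⟩ h
          omega
      simp [ℒ, hno, hm]
  refine hA.unobstructed_of_vectors hrank ℒ Q ?_ ?_
  · intro m h1 h2
    rw [hQ m h1 (by omega), hQ (m + A.k) (by omega) (by omega)]
    simp only [hw, frameVector]
    split_ifs <;> first | omega | simp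
  · intro m
    obtain ⟨m', ⟨h1, h2⟩, e, hmod⟩ := A.exists_Icc m
    have e1 : A.seq (m' + 1) = A.seq (m + 1) := A.seq_congr (Nat.ModEq.add_right 1 hmod)
    have e2 : A.seq (m' + A.k) = A.seq (m + A.k) := A.seq_congr (Nat.ModEq.add_right _ hmod)
    have em : A.Moves m ↔ A.Moves m' := by
      rw [Moves, Moves, base, base, base, base, e, e1, e2]
    rw [← e, ← e1, ← e2, em, hg m' h1 h2, hQ m' h1 h2]
    clear_value ℒ Q
    clear e e1 e2 em hmod hg
    have hnext : Q (A.seq (m' + 1)) = if m' < 2 * A.k then w (m' + 1) else w 1 := by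
      split_ifs with h
      · exact hQ _ (by omega) (by omega)
      · obtain rfl : m' = 2 * A.k := by omega
        rw [add_comm, A.periodic]
        exact hQ 1 le_rfl (by omega)
    have hother : Q (A.seq (m' + A.k)) = if m' ≤ A.k then w (m' + A.k) else w (m' - A.k) := by
      split_ifs with h
      · exact hQ _ (by omega) (by omega)
      · rw [← hQ (m' - A.k) (by omega) (by omega), ← A.periodic (m' - A.k)]
        congr 2
        omega
    rw [hnext, hother]
    obtain ⟨c, hc, hcm⟩ := exists_frameVector_step hi hij hjk h1 h2
    refine ⟨c, hc, fun h => ?_⟩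
    rcases hcm h with rfl | rfl | rfl
    · exact hmj
    · rwa [add_comm]
    · rwa [two_mul]

end Arrangement

end TropicalMultisection

end TropLag

theorem theorem5p6 (F : TropLag.CompleteFan) (L : TropLag.TropicalMultisection.{u} F)
    (hrank : L.rank = 2) (hL : L.CombIndecomposable) :
    (∃ A : L.Arrangement, A.Normalized) ∧
      ∀ A : L.Arrangement, A.Normalized → (L.Unobstructed ↔ A.SlopeCondition) :=
  ⟨L.exists_normalized_arrangement hrank hL, fun _ hA =>
    ⟨hA.slopeCondition_of_unobstructed hrank, hA.unobstructed_of_slopeCondition hrank⟩⟩
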